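/- Let $\Omega$ be the category whose objects are finite rooted trees $T$ and whose arrows $S\to T$ are the maps of (symmetric) coloured operads $\Omega(S)\to\Omega(T)$, where $\Omega(T)$ is the coloured operad whose colours are the edges of $T$ and which is freely generated by the vertices of $T$. A dendroidal set is a functor $X:\Omega^{op}\to \mathrm{Set}$, $X_T:=X(T)$; write $\Omega[T]$ for the dendroidal set represented by $T$. The dendroidal nerve of a coloured operad $P$ is the dendroidal set $N_d(P)_T=\mathrm{Hom}(\Omega(T),P)$, and $\tau_d$ denotes the left adjoint of the functor $N_d$ from coloured operads (in sets) to dendroidal sets. An edge of $T$ is inner if it is neither the root nor a leaf. The faces of $T$ are: for each inner edge $e$, the map $\partial_e:T/e\to T$ given by contracting $e$; for each vertex $v$ with exactly one inner edge attached to it, the map $\partial_v:T/v\to T$ given by deleting $v$ together with all outer edges attached to it; and, if $T$ has exactly one vertex, the inclusion of each edge of $T$. For an inner edge $e$ of $T$, the inner horn $\Lambda^e[T]\subseteq\Omega[T]$ is the union of the images of all faces of $T$ except $\partial_e$. A dendroidal set $K$ is a strict inner Kan complex if for every tree $T$ and every inner edge $e$ of $T$ the restriction map $\mathrm{Hom}(\Omega[T],K)\to\mathrm{Hom}(\Lambda^e[T],K)$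 is a bijection. **Theorem 6.1.** For every strict inner Kan complex $X$, the canonical map $X\to N_d(\tau_d(X))$ (the unit of the adjunction between $\tau_d$ and $N_d$) is an isomorphism. Moreover, a dendroidal set $X$ is a strict inner Kan complex if and only if it is isomorphic to the dendroidal nerve $N_d(P)$ of some coloured operad $P$. -/

import Mathlib

open CategoryTheory Opposite

universe u v w

namespace Dendroidal

/-! ### Bookkeeping of inputs

The inputs of a composite operation are indexed by `Fin (∑ i, k i)`, which is identified
(lexicographically) with `Σ i, Fin (k i)`. -/

/-- Position in a concatenation: which block, and where in that block. -/
def blocks {n : ℕ} (k : Fin n → ℕ) : Fin (∑ i, k i) ≃ Σ i, Fin (k i) :=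
  finSigmaFinEquiv.symm

/-- The concatenation of a family of lists of colours. -/
abbrev concat {C : Type u} {n : ℕ} {k : Fin n → ℕ} (b : ∀ i, Fin (k i) → C) :
    Fin (∑ i, k i) → C :=
  fun x => b (blocks k x).1 (blocks k x).2

/-- One block of length `n` is the same as a list of length `n`. -/
def oneBlock (n : ℕ) : Fin (∑ _i : Fin 1, n) ≃ Fin n :=
  (blocks fun _ : Fin 1 => n).trans
    ⟨fun p => p.2, fun x => ⟨0, x⟩,
      fun p => by obtain ⟨i, x⟩ := p; rw [Subsingleton.elim i 0], fun _ => rfl⟩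

/-- `n` blocks of length one are the same as a list of length `n`. -/
def unitBlocks (n : ℕ) : Fin (∑ _i : Fin n, 1) ≃ Fin n :=
  (blocks fun _ : Fin n => 1).trans
    ⟨fun p => p.1, fun i => ⟨i, 0⟩,
      fun p => by obtain ⟨i, x⟩ := p; rw [Subsingleton.elim x 0], fun _ => rfl⟩

/-- Permuting whole blocks. -/
def permBlocks {m n : ℕ} (σ : Fin m ≃ Fin n) (k : Fin n → ℕ) :
    Fin (∑ i, k (σ i)) ≃ Fin (∑ i, k i) :=
  ((blocks fun i => k (σ i)).trans (Equiv.sigmaCongrLeft (β := fun i => Fin (k i)) σ)).trans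
    (blocks k).symm

/-- Permuting inside each block. -/
def permInBlocks {n : ℕ} {k k' : Fin n → ℕ} (τ : ∀ i, Fin (k' i) ≃ Fin (k i)) :
    Fin (∑ i, k' i) ≃ Fin (∑ i, k i) :=
  ((blocks k').trans (Equiv.sigmaCongrRight τ)).trans (blocks k).symm

/-- Blocks of blocks: the two ways of concatenating twice. -/
def assocBlocks {n : ℕ} {k : Fin n → ℕ} (l : ∀ i, Fin (k i) → ℕ) :
    Fin (∑ x, concat l x) ≃ Fin (∑ i, ∑ j, l i j) :=
  ((((blocks (concat l)).trans
    (Equiv.sigmaCongrLeft (β := fun y : Σ i, Fin (k i) => Fin (l y.1 y.2)) (blocks k))).trans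
    (Equiv.sigmaAssoc fun i j => Fin (l i j))).trans
    (Equiv.sigmaCongrRight fun i => (blocks (l i)).symm)).trans
    (blocks fun i => ∑ j, l i j).symm

theorem concat_oneBlock {C : Type u} {n : ℕ} (c : Fin n → C) (x : Fin (∑ _i : Fin 1, n)) :
    concat (fun _ : Fin 1 => c) x = c (oneBlock n x) := rfl

theorem concat_unitBlocks {C : Type u} {n : ℕ} (c : Fin n → C) (x : Fin (∑ _i : Fin n, 1)) :
    concat (fun (i : Fin n) (_ : Fin 1) => c i) x = c (unitBlocks n x) := rfl

theorem concat_symm {C : Type u} {n : ℕ} {k : Fin n → ℕ} (b : ∀ i, Fin (k i) → C)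
    (y : Σ i, Fin (k i)) : concat b ((blocks k).symm y) = b y.1 y.2 :=
  congrArg (fun p : Σ i, Fin (k i) => b p.1 p.2) ((blocks k).apply_symm_apply y)

theorem concat_permBlocks {C : Type u} {m n : ℕ} (σ : Fin m ≃ Fin n) {k : Fin n → ℕ}
    (b : ∀ i, Fin (k i) → C) (x : Fin (∑ i, k (σ i))) :
    concat (fun i => b (σ i)) x = concat b (permBlocks σ k x) :=
  (concat_symm b (Equiv.sigmaCongrLeft (β := fun i => Fin (k i)) σ
    (blocks (fun i => k (σ i)) x))).symm

theorem concat_permInBlocks {C : Type u} {n : ℕ} {k k' : Fin n → ℕ}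
    (τ : ∀ i, Fin (k' i) ≃ Fin (k i)) {b : ∀ i, Fin (k i) → C} {b' : ∀ i, Fin (k' i) → C}
    (h : ∀ i j, b' i j = b i (τ i j)) (x : Fin (∑ i, k' i)) :
    concat b' x = concat b (permInBlocks τ x) :=
  (h _ _).trans (concat_symm b (Equiv.sigmaCongrRight τ (blocks k' x))).symm

theorem concat_assocBlocks {C : Type u} {n : ℕ} {k : Fin n → ℕ} (l : ∀ i, Fin (k i) → ℕ)
    (a : ∀ i j, Fin (l i j) → C) (x : Fin (∑ y, concat l y)) :
    concat (k := concat l) (fun y => a (blocks k y).1 (blocks k y).2) x =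
      concat (fun i => concat (a i)) (assocBlocks l x) := by
  let y := blocks (concat l) x
  exact ((concat_symm (fun i => concat (a i))
    ⟨(blocks k y.1).1, (blocks (l (blocks k y.1).1)).symm ⟨(blocks k y.1).2, y.2⟩⟩).trans
    (concat_symm (a (blocks k y.1).1) ⟨(blocks k y.1).2, y.2⟩)).symm

/-! ### Coloured operads -/

/-- A (symmetric) coloured operad in sets. `Op c d` is the set of operations with inputs of
colours `c 0, …, c (n - 1)` and output colour `d`; `one` are the units, `act` is the right action
of the symmetric groups (a bijection `Fin m ≃ Fin n` forces `m = n`, so this is the usual action,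
written so that equal lists of colours need not be syntactically equal), and `comp` is the total
composition `p ∘ (q₀, …, qₙ₋₁)`. -/
structure Operad where
  /-- the colours -/
  Color : Type u
  /-- the operations -/
  Op : {n : ℕ} → (Fin n → Color) → Color → Type u
  /-- the units -/
  one : (c : Color) → Op (fun _ : Fin 1 => c) c
  /-- the symmetric group actions -/
  act : {m n : ℕ} → (σ : Fin m ≃ Fin n) → {c : Fin n → Color} → {c' : Fin m → Color} →
    {d : Color} → (∀ i, c' i = c (σ i)) → Op c d → Op c' d
  /-- the composition -/
  comp : {n : ℕ} → {k : Fin n → ℕ} → {c : Fin n → Color} → {b : ∀ i, Fin (k i) → Color} →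
    {d : Color} → Op c d → (∀ i, Op (b i) (c i)) → Op (concat b) d
  act_refl : ∀ {n : ℕ} {c : Fin n → Color} {d : Color} (p : Op c d),
    act (Equiv.refl _) (fun _ => rfl) p = p
  act_act : ∀ {l m n : ℕ} (τ : Fin l ≃ Fin m) (σ : Fin m ≃ Fin n) {c : Fin n → Color}
    {c' : Fin m → Color} {c'' : Fin l → Color} {d : Color} (h : ∀ i, c' i = c (σ i))
    (h' : ∀ i, c'' i = c' (τ i)) (p : Op c d),
    act τ h' (act σ h p) = act (τ.trans σ) (fun i => (h' i).trans (h (τ i))) p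
  one_comp : ∀ {n : ℕ} {c : Fin n → Color} {d : Color} (p : Op c d),
    comp (one d) (fun _ => p) = act (oneBlock n) (concat_oneBlock c) p
  comp_one : ∀ {n : ℕ} {c : Fin n → Color} {d : Color} (p : Op c d),
    comp p (fun i => one (c i)) = act (unitBlocks n) (concat_unitBlocks c) p
  act_comp : ∀ {m n : ℕ} (σ : Fin m ≃ Fin n) {k : Fin n → ℕ} {c : Fin n → Color}
    {b : ∀ i, Fin (k i) → Color} {d : Color} (p : Op c d) (q : ∀ i, Op (b i) (c i)),
    comp (act σ (c' := fun i => c (σ i)) (fun _ => rfl) p) (fun i => q (σ i)) =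
      act (permBlocks σ k) (concat_permBlocks σ b) (comp p q)
  comp_act : ∀ {n : ℕ} {k k' : Fin n → ℕ} (τ : ∀ i, Fin (k' i) ≃ Fin (k i)) {c : Fin n → Color}
    {b : ∀ i, Fin (k i) → Color} {b' : ∀ i, Fin (k' i) → Color} {d : Color}
    (h : ∀ i j, b' i j = b i (τ i j)) (p : Op c d) (q : ∀ i, Op (b i) (c i)),
    comp p (fun i => act (τ i) (h i) (q i)) =
      act (permInBlocks τ) (concat_permInBlocks τ h) (comp p q)
  assoc : ∀ {n : ℕ} {k : Fin n → ℕ} {l : ∀ i, Fin (k i) → ℕ} {c : Fin n → Color}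
    {b : ∀ i, Fin (k i) → Color} {a : ∀ i j, Fin (l i j) → Color} {d : Color}
    (p : Op c d) (q : ∀ i, Op (b i) (c i)) (r : ∀ i j, Op (a i j) (b i j)),
    comp (k := concat l) (comp p q) (fun y => r (blocks k y).1 (blocks k y).2) =
      act (assocBlocks l) (concat_assocBlocks l a) (comp p (fun i => comp (q i) (r i)))

/-- A map of coloured operads (possibly between different universes). -/
structure Operad.Hom (P : Operad.{u}) (Q : Operad.{v}) where
  /-- the map on colours -/
  color : P.Color → Q.Color
  /-- the map on operations -/
  op : {n : ℕ} → {c : Fin n → P.Color} → {d : P.Color} → P.Op c d →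
    Q.Op (fun i => color (c i)) (color d)
  op_one : ∀ c : P.Color, op (P.one c) = Q.one (color c)
  op_act : ∀ {m n : ℕ} (σ : Fin m ≃ Fin n) {c : Fin n → P.Color} {c' : Fin m → P.Color}
    {d : P.Color} (h : ∀ i, c' i = c (σ i)) (p : P.Op c d),
    op (P.act σ h p) = Q.act σ (fun i => congrArg color (h i)) (op p)
  op_comp : ∀ {n : ℕ} {k : Fin n → ℕ} {c : Fin n → P.Color} {b : ∀ i, Fin (k i) → P.Color}
    {d : P.Color} (p : P.Op c d) (q : ∀ i, P.Op (b i) (c i)),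
    op (P.comp p q) = Q.comp (op p) (fun i => op (q i))

namespace Operad

/-- The identity map. -/
def Hom.id (P : Operad.{u}) : Hom P P where
  color c := c
  op p := p
  op_one _ := rfl
  op_act _ _ _ _ _ _ := rfl
  op_comp _ _ := rfl

/-- The composition of operad maps. -/
def Hom.comp {P : Operad.{u}} {Q : Operad.{v}} {R : Operad.{w}} (f : Hom P Q) (g : Hom Q R) :
    Hom P R where
  color c := g.color (f.color c)
  op p := g.op (f.op p)
  op_one c := by rw [f.op_one, g.op_one]
  op_act σ _ _ _ h p := by rw [f.op_act, g.op_act]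
  op_comp p q := (congrArg g.op (f.op_comp p q)).trans (g.op_comp _ _)

instance : Category.{u} Operad.{u} where
  Hom P Q := Hom P Q
  id P := Hom.id P
  comp f g := Hom.comp f g

/-- Transport of an operation along equalities of colours. -/
def recolor (P : Operad.{u}) {n : ℕ} {c c' : Fin n → P.Color} {d d' : P.Color}
    (hc : ∀ i, c i = c' i) (hd : d = d') (p : P.Op c d) : P.Op c' d' :=
  cast (by rw [funext hc, hd]) p

theorem recolor_rfl (P : Operad.{u}) {n : ℕ} {c : Fin n → P.Color} {d : P.Color}
    (p : P.Op c d) : P.recolor (fun _ => rfl) rfl p = p := rfl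

theorem Hom.ext' {P : Operad.{u}} {Q : Operad.{v}} {f g : Hom P Q}
    (hc : ∀ c, f.color c = g.color c)
    (hp : ∀ {n : ℕ} {c : Fin n → P.Color} {d : P.Color} (p : P.Op c d),
      Q.recolor (fun i => hc (c i)) (hc d) (f.op p) = g.op p) : f = g := by
  obtain ⟨fc, fo, _, _, _⟩ := f
  obtain ⟨gc, go, _, _, _⟩ := g
  obtain rfl : fc = gc := funext hc
  have : @fo = @go := by
    funext n c d p
    exact hp p
  subst this
  rfl

end Operad

/-! ### Trees -/

/-- A finite rooted tree, with edges as in a graph whose output and input vertices have been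
removed. Every vertex `v` has one edge `out v` pointing towards the root; `below e` is the vertex
of which `e` is an input edge, and every edge except the root has such a vertex. Following the
edges downwards one arrives at the root. -/
structure Tree where
  /-- the edges -/
  Edge : Type
  /-- the vertices -/
  Vertex : Type
  finite : Finite Edge
  /-- the output edge -/
  root : Edge
  /-- the output of a vertex -/
  out : Vertex → Edge
  out_injective : Function.Injective out
  /-- the vertex that an edge enters, if there is one -/
  below : Edge → Option Vertex
  below_eq_none : ∀ e, below e = none ↔ e = root
  path : ∀ e, Relation.ReflTransGen (fun a b => ∃ v, below a = some v ∧ out v = b) e root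

namespace Tree

/-- The list `c` enumerates the input edges of the vertex `v`, without repetition. -/
def Enumerates (T : Tree) (v : T.Vertex) {n : ℕ} (c : Fin n → T.Edge) : Prop :=
  Function.Injective c ∧ ∀ e, e ∈ Set.range c ↔ T.below e = some v

/-- The profiles of the operations of the operad of a tree: they are generated by the vertices
(each with every planar ordering of its inputs) under units, permutations and composition. -/
inductive Operation (T : Tree) : {n : ℕ} → (Fin n → T.Edge) → T.Edge → Prop
  | vertex (v : T.Vertex) {n : ℕ} (c : Fin n → T.Edge) (hc : T.Enumerates v c) :
      Operation T c (T.out v)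
  | one (e : T.Edge) : Operation T (fun _ : Fin 1 => e) e
  | act {m n : ℕ} (σ : Fin m ≃ Fin n) {c : Fin n → T.Edge} {c' : Fin m → T.Edge} {d : T.Edge}
      (h : ∀ i, c' i = c (σ i)) (p : Operation T c d) : Operation T c' d
  | comp {n : ℕ} {k : Fin n → ℕ} {c : Fin n → T.Edge} {b : ∀ i, Fin (k i) → T.Edge} {d : T.Edge}
      (p : Operation T c d) (q : ∀ i, Operation T (b i) (c i)) : Operation T (concat b) d

/-- The coloured operad of a tree: its colours are the edges, and it is freely generated by the
vertices. In a tree an operation of this free operad is determined by its inputs and its output,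
so the set of operations with a given profile has at most one element, and it has one exactly if
the profile is obtained from the vertices by units, permutations and composition. -/
def operad (T : Tree) : Operad.{0} where
  Color := T.Edge
  Op c d := PLift (T.Operation c d)
  one e := ⟨.one e⟩
  act σ _ _ _ h p := ⟨.act σ h p.down⟩
  comp p q := ⟨.comp p.down fun i => (q i).down⟩
  act_refl _ := rfl
  act_act _ _ _ _ _ _ _ _ _ := rfl
  one_comp _ := rfl
  comp_one _ := rfl
  act_comp _ _ _ _ _ _ _ := rfl
  comp_act _ _ _ _ _ _ _ _ := rfl
  assoc _ _ _ := rfl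

/-- The category `Ω` of trees: a map of trees is a map of the associated coloured operads. -/
instance : Category.{0} Tree where
  Hom S T := Operad.Hom S.operad T.operad
  id T := Operad.Hom.id T.operad
  comp f g := Operad.Hom.comp f g

/-- The effect of a map of trees on edges. -/
def edgeMap {S T : Tree} (f : S ⟶ T) : S.Edge → T.Edge := Operad.Hom.color f

theorem hom_ext {S T : Tree} {f g : S ⟶ T} (h : ∀ e, edgeMap f e = edgeMap g e) : f = g :=
  Operad.Hom.ext' h fun _ => Subsingleton.elim (α := PLift _) _ _

/-- A map of edges that sends the vertices to operations is a map of trees. -/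
def homMk {S T : Tree} (f : S.Edge → T.Edge)
    (hf : ∀ (v : S.Vertex) {n : ℕ} (c : Fin n → S.Edge), S.Enumerates v c →
      T.Operation (fun i => f (c i)) (f (S.out v))) : S ⟶ T :=
  have key : ∀ {n : ℕ} {c : Fin n → S.Edge} {d : S.Edge}, S.Operation c d →
      T.Operation (fun i => f (c i)) (f d) := by
    intro n c d p
    induction p with
    | vertex v c hc => exact hf v c hc
    | one e => exact .one _
    | act σ h p ih => exact .act σ (fun i => congrArg f (h i)) ih
    | comp p q ih ih' => exact .comp ih ih'
  { color := f
    op := fun p => ⟨key p.down⟩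
    op_one := fun _ => rfl
    op_act := fun _ _ _ _ _ _ => rfl
    op_comp := fun _ _ => rfl }

/-- The tree with one edge and no vertices. -/
def eta : Tree where
  Edge := Unit
  Vertex := Empty
  finite := inferInstance
  root := ()
  out := Empty.elim
  out_injective := fun v => v.elim
  below _ := none
  below_eq_none _ := ⟨fun _ => rfl, fun _ => rfl⟩
  path _ := .refl

/-- The map from the tree with one edge to `T` that picks out an edge `e`. -/
def edgeHom {T : Tree} (e : T.Edge) : eta ⟶ T :=
  homMk (fun _ => e) fun v => v.elim

/-- The corolla: one vertex with `n` inputs; its root is `none`. -/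
def corolla (n : ℕ) : Tree where
  Edge := Option (Fin n)
  Vertex := Unit
  finite := inferInstance
  root := none
  out _ := none
  out_injective _ _ _ := rfl
  below e := e.map fun _ => ()
  below_eq_none e := by simp
  path e := by
    cases e with
    | none => exact .refl
    | some i => exact .single ⟨(), rfl, rfl⟩

/-! ### Inner and outer edges -/

/-- An inner edge is an edge between two vertices, i.e. neither the root nor a leaf. -/
def IsInner (T : Tree) (e : T.Edge) : Prop :=
  e ≠ T.root ∧ ∃ v, T.out v = e

/-- The edge `e` is attached to the vertex `v`. -/
def IsAttached (T : Tree) (e : T.Edge) (v : T.Vertex) : Prop :=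
  T.out v = e ∨ T.below e = some v

/-- An outer vertex: a vertex with exactly one inner edge attached to it. -/
def IsOuter (T : Tree) (v : T.Vertex) : Prop :=
  ∃! e, T.IsInner e ∧ T.IsAttached e v

theorem below_root (T : Tree) : T.below T.root = none := (T.below_eq_none _).2 rfl

theorem below_out_ne (T : Tree) (v : T.Vertex) : T.below (T.out v) ≠ some v := by
  intro h
  have aux : ∀ b, Relation.ReflTransGen (fun a b => ∃ v, T.below a = some v ∧ T.out v = b)
      (T.out v) b → b = T.out v := by
    intro b hb
    induction hb with
    | refl => rfl
    | tail _ hs ih =>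
      obtain ⟨w, hw, rfl⟩ := hs
      rw [ih, h] at hw
      rw [Option.some.inj hw]
  have := aux _ (T.path _)
  rw [← this, below_root] at h
  exact absurd h (by simp)

/-! ### Outer faces -/

/-- The edges that remain when the vertex `v` and the outer edges attached to it are deleted. -/
def Remains (T : Tree) (v : T.Vertex) (e : T.Edge) : Prop :=
  T.IsAttached e v → T.IsInner e

theorem remains_out {T : Tree} {v w : T.Vertex} (hw : w ≠ v) : T.Remains v (T.out w) := by
  rintro (h | h)
  · exact absurd (T.out_injective h).symm hw
  · refine ⟨fun h' => ?_, w, rfl⟩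
    rw [h', below_root] at h
    exact absurd h (by simp)

theorem remains_root {T : Tree} {v : T.Vertex} (hv : T.out v ≠ T.root) :
    T.Remains v T.root := by
  rintro (h | h)
  · exact absurd h hv
  · rw [below_root] at h
    exact absurd h (by simp)

theorem not_remains_root {T : Tree} {v : T.Vertex} (hv : T.out v = T.root) :
    ¬ T.Remains v T.root := fun h => (h (Or.inl hv)).1 rfl

open Classical in
/-- The tree `T/v` obtained from `T` by deleting an outer vertex `v` and all the outer edges
attached to it. If `v` was the lowest vertex, then the new root is the inner edge attached
to `v`. -/
noncomputable def outerFace (T : Tree) (v : T.Vertex) (hv : T.IsOuter v) : Tree where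
  Edge := {e : T.Edge // T.Remains v e}
  Vertex := {w : T.Vertex // w ≠ v}
  finite := by
    have := T.finite
    infer_instance
  root := if h : T.out v = T.root then ⟨hv.choose, fun _ => hv.choose_spec.1.1⟩
    else ⟨T.root, remains_root h⟩
  out w := ⟨T.out w.1, remains_out w.2⟩
  out_injective w w' h := Subtype.ext (T.out_injective (congrArg Subtype.val h))
  below e := (T.below e.1).bind fun w => if h : w = v then none else some ⟨w, h⟩
  below_eq_none := by
    rintro ⟨e, he⟩
    have hbelow : ((T.below e).bind fun w => if h : w = v then none
        else some (⟨w, h⟩ : {w : T.Vertex // w ≠ v})) = none ↔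
        T.below e = none ∨ T.below e = some v := by
      cases hb : T.below e with
      | none => simp
      | some w => by_cases hwv : w = v <;> simp [hwv]
    rw [hbelow, T.below_eq_none]
    by_cases hv' : T.out v = T.root
    · rw [dif_pos hv']
      have hs := hv.choose_spec.1
      constructor
      · rintro (h | h)
        · subst h
          exact absurd he (not_remains_root hv')
        · exact Subtype.ext (hv.choose_spec.2 e ⟨he (Or.inr h), Or.inr h⟩)
      · intro h
        have h : e = hv.choose := congrArg Subtype.val h
        right
        rw [h]
        refine hs.2.resolve_left fun h' => hs.1.1 (h'.symm.trans hv')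
    · rw [dif_neg hv']
      constructor
      · rintro (h | h)
        · exact Subtype.ext h
        · have h1 := hv.choose_spec.2 e ⟨he (Or.inr h), Or.inr h⟩
          have h2 := hv.choose_spec.2 (T.out v) ⟨⟨hv', v, rfl⟩, Or.inl rfl⟩
          rw [h1, ← h2] at h
          exact absurd h (T.below_out_ne v)
      · intro h
        exact Or.inl (congrArg Subtype.val h)
  path := by
    have main : ∀ e, Relation.ReflTransGen (fun a b => ∃ v, T.below a = some v ∧ T.out v = b)
        e T.root → ∀ he : T.Remains v e,
        Relation.ReflTransGen (fun (a b : {e : T.Edge // T.Remains v e}) =>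
          ∃ w : {w : T.Vertex // w ≠ v}, ((T.below a.1).bind fun w => if h : w = v then none
            else some (⟨w, h⟩ : {w : T.Vertex // w ≠ v})) = some w ∧
            (⟨T.out w.1, remains_out w.2⟩ : {e : T.Edge // T.Remains v e}) = b) ⟨e, he⟩
        (if h : T.out v = T.root then ⟨hv.choose, fun _ => hv.choose_spec.1.1⟩
          else ⟨T.root, remains_root h⟩) := by
      intro e hp
      induction hp using Relation.ReflTransGen.head_induction_on with
      | refl =>
        intro he
        by_cases hv' : T.out v = T.root
        · exact absurd he (not_remains_root hv')
        · rw [dif_neg hv']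
      | @head a b hab _ ih =>
        intro he
        obtain ⟨w, hw, rfl⟩ := hab
        by_cases hwv : w = v
        · subst hwv
          have h1 := hv.choose_spec.2 a ⟨he (Or.inr hw), Or.inr hw⟩
          have hv' : T.out w = T.root := by
            by_contra hv'
            have h2 := hv.choose_spec.2 (T.out w) ⟨⟨hv', w, rfl⟩, Or.inl rfl⟩
            rw [h1, ← h2] at hw
            exact T.below_out_ne w hw
          rw [dif_pos hv']
          have : (⟨a, he⟩ : {e : T.Edge // T.Remains w e}) =
              ⟨hv.choose, fun _ => hv.choose_spec.1.1⟩ := Subtype.ext h1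
          rw [this]
        · refine .head ⟨⟨w, hwv⟩, ?_, rfl⟩ (ih (remains_out hwv))
          simp [hw, hwv]
    exact fun e => main e.1 (T.path e.1) e.2

open Classical in
/-- The outer face map `T/v ⟶ T`. -/
noncomputable def outerFaceHom (T : Tree) (v : T.Vertex) (hv : T.IsOuter v) :
    T.outerFace v hv ⟶ T :=
  homMk Subtype.val (by
    rintro ⟨w, hw⟩ n c ⟨hc, hc'⟩
    refine Operation.vertex w _ ⟨fun i j h => hc (Subtype.ext h), fun e => ?_⟩
    have key : ∀ x : {e : T.Edge // T.Remains v e},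
        (T.outerFace v hv).below x = some ⟨w, hw⟩ ↔ T.below x.1 = some w := by
      intro x
      change ((T.below x.1).bind fun w => if h : w = v then none
        else some (⟨w, h⟩ : {w : T.Vertex // w ≠ v})) = some ⟨w, hw⟩ ↔ _
      cases T.below x.1 with
      | none => simp
      | some w' =>
        by_cases h : w' = v
        · subst h
          simp [Ne.symm hw]
        · simp [h]
    constructor
    · rintro ⟨i, rfl⟩
      exact (key _).1 ((hc' _).1 ⟨i, rfl⟩)
    · intro h
      have he : T.Remains v e := by
        rintro (h' | h')
        · refine ⟨fun h'' => ?_, v, h'⟩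
          rw [h'', below_root] at h
          exact absurd h (by simp)
        · rw [h'] at h
          exact absurd (Option.some.inj h).symm hw
      obtain ⟨i, hi⟩ := (hc' ⟨e, he⟩).2 ((key ⟨e, he⟩).2 h)
      exact ⟨i, congrArg Subtype.val hi⟩)

/-! ### Inner faces -/

theorem Operation.of_range {T : Tree} {m n : ℕ} {c : Fin n → T.Edge} {c' : Fin m → T.Edge}
    {d : T.Edge} (p : T.Operation c d) (hc : Function.Injective c)
    (hc' : Function.Injective c') (h : Set.range c' = Set.range c) : T.Operation c' d := by
  let σ : Fin m ≃ Fin n := ((Equiv.ofInjective c' hc').trans (Equiv.setCongr h)).trans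
    (Equiv.ofInjective c hc).symm
  refine .act σ (fun i => ?_) p
  have := congrArg Subtype.val
    ((Equiv.ofInjective c hc).apply_symm_apply (Equiv.setCongr h (Equiv.ofInjective c' hc' i)))
  exact this.symm

theorem exists_enumerates (T : Tree) (v : T.Vertex) :
    ∃ (n : ℕ) (c : Fin n → T.Edge), T.Enumerates v c := by
  have := T.finite
  obtain ⟨n, ⟨f⟩⟩ := Finite.exists_equiv_fin {e : T.Edge // T.below e = some v}
  refine ⟨n, fun i => (f.symm i).1, fun i j h => f.symm.injective (Subtype.ext h), fun e => ?_⟩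
  constructor
  · rintro ⟨i, rfl⟩
    exact (f.symm i).2
  · intro h
    exact ⟨f ⟨e, h⟩, by simp⟩

open Classical in
/-- The tree `T/e` obtained from `T` by contracting an inner edge `e`: the edge `e` and the vertex
above it are deleted, and the inputs of the deleted vertex become inputs of the vertex below `e`. -/
noncomputable def innerFace (T : Tree) (e : T.Edge) (he : T.IsInner e) : Tree where
  Edge := {x : T.Edge // x ≠ e}
  Vertex := {w : T.Vertex // T.out w ≠ e}
  finite := by
    have := T.finite
    infer_instance
  root := ⟨T.root, he.1.symm⟩
  out w := ⟨T.out w.1, w.2⟩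
  out_injective w w' h := Subtype.ext (T.out_injective (congrArg Subtype.val h))
  below x := (T.below x.1).bind fun w =>
    if h : T.out w = e then
      (T.below e).pmap (fun u hu => ⟨u, fun h' => T.below_out_ne u (by rw [h', hu])⟩)
        (fun u hu => hu)
    else some ⟨w, h⟩
  below_eq_none := by
    rintro ⟨x, hx⟩
    obtain ⟨u, hu⟩ := Option.ne_none_iff_exists'.1 fun h => he.1 ((T.below_eq_none e).1 h)
    have : ((T.below x).bind fun w => if h : T.out w = e then
        (T.below e).pmap (fun u hu => (⟨u, fun h' => T.below_out_ne u (by rw [h', hu])⟩ :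
          {w : T.Vertex // T.out w ≠ e})) (fun u hu => hu)
        else some ⟨w, h⟩) = none ↔ T.below x = none := by
      cases T.below x with
      | none => simp
      | some w => by_cases h : T.out w = e <;> simp [h, hu]
    rw [this, T.below_eq_none, Subtype.mk.injEq]
  path := by
    obtain ⟨u, hu⟩ := Option.ne_none_iff_exists'.1 fun h => he.1 ((T.below_eq_none e).1 h)
    have hue : T.out u ≠ e := fun h' => T.below_out_ne u (by rw [h', hu])
    have main : ∀ e', Relation.ReflTransGen (fun a b => ∃ v, T.below a = some v ∧ T.out v = b)
        e' T.root → ∀ y : {x : T.Edge // x ≠ e}, (e' = y.1 ∨ e' = e ∧ y.1 = T.out u) →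
        Relation.ReflTransGen (fun (a b : {x : T.Edge // x ≠ e}) =>
          ∃ w : {w : T.Vertex // T.out w ≠ e}, ((T.below a.1).bind fun w =>
            if h : T.out w = e then
              (T.below e).pmap (fun u hu => (⟨u, fun h' => T.below_out_ne u (by rw [h', hu])⟩ :
                {w : T.Vertex // T.out w ≠ e})) (fun u hu => hu)
            else some ⟨w, h⟩) = some w ∧
            (⟨T.out w.1, w.2⟩ : {x : T.Edge // x ≠ e}) = b) y ⟨T.root, he.1.symm⟩ := by
      intro e' hp
      induction hp using Relation.ReflTransGen.head_induction_on with
      | refl =>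
        rintro ⟨y, hy⟩ (rfl | ⟨h, _⟩)
        · exact .refl
        · exact absurd h.symm he.1
      | @head a b hab _ ih =>
        obtain ⟨w, hw, rfl⟩ := hab
        rintro ⟨y, hy⟩ (rfl | ⟨rfl, h⟩)
        · by_cases hwe : T.out w = e
          · refine .head ⟨⟨u, hue⟩, ?_, rfl⟩ (ih _ (Or.inr ⟨hwe, rfl⟩))
            simp [hw, hwe, hu]
          · refine .head ⟨⟨w, hwe⟩, ?_, rfl⟩ (ih _ (Or.inl rfl))
            simp [hw, hwe]
        · have : w = u := Option.some.inj (hw.symm.trans hu)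
          subst this
          exact ih _ (Or.inl h.symm)
    exact fun x => main x.1 (T.path x.1) x (Or.inl rfl)

open Classical in
/-- The inner face map `T/e ⟶ T`, sending the merged vertex to the composite. -/
noncomputable def innerFaceHom (T : Tree) (e : T.Edge) (he : T.IsInner e) :
    T.innerFace e he ⟶ T :=
  homMk Subtype.val (by
    rintro ⟨w, hw⟩ n c ⟨hc, hc'⟩
    obtain ⟨u, hu⟩ := Option.ne_none_iff_exists'.1 fun h => he.1 ((T.below_eq_none e).1 h)
    have hue : T.out u ≠ e := fun h' => T.below_out_ne u (by rw [h', hu])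
    obtain ⟨v, hv⟩ := he.2
    have key : ∀ x : {x : T.Edge // x ≠ e}, (T.innerFace e he).below x = some ⟨w, hw⟩ ↔
        T.below x.1 = some w ∨ w = u ∧ T.below x.1 = some v := by
      intro x
      change ((T.below x.1).bind fun w => if h : T.out w = e then
        (T.below e).pmap (fun u hu => (⟨u, fun h' => T.below_out_ne u (by rw [h', hu])⟩ :
          {w : T.Vertex // T.out w ≠ e})) (fun u hu => hu)
        else some ⟨w, h⟩) = some ⟨w, hw⟩ ↔ _
      cases T.below x.1 with
      | none => simp
      | some w' =>
        by_cases h : T.out w' = e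
        · have hw' : w' = v := T.out_injective (h.trans hv.symm)
          subst hw'
          have : w' ≠ w := fun h' => hw (h' ▸ h)
          simp only [Option.bind_some, h, dite_true, hu, Option.pmap_some, Option.some.injEq,
            Subtype.mk.injEq, this, false_or, and_true]
          exact eq_comm
        · have : w' ≠ v := fun h' => h (h' ▸ hv)
          simp [h, this]
    have hrange : ∀ y : T.Edge, y ∈ Set.range (fun i => (c i).1) ↔
        y ≠ e ∧ (T.below y = some w ∨ w = u ∧ T.below y = some v) := by
      intro y
      constructor
      · rintro ⟨i, rfl⟩
        exact ⟨(c i).2, (key _).1 ((hc' _).1 ⟨i, rfl⟩)⟩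
      · rintro ⟨hy, h⟩
        obtain ⟨i, hi⟩ := (hc' ⟨y, hy⟩).2 ((key ⟨y, hy⟩).2 h)
        exact ⟨i, congrArg Subtype.val hi⟩
    have hcinj : Function.Injective (fun i => (c i).1) := fun i j h => hc (Subtype.ext h)
    have hve : T.below e ≠ some v := by
      rw [← hv]
      exact T.below_out_ne v
    by_cases hwu : w = u
    · subst hwu
      obtain ⟨m, a, ha⟩ := T.exists_enumerates w
      obtain ⟨m', a', ha'⟩ := T.exists_enumerates v
      have hb : ∀ i, ∃ (k : ℕ) (b : Fin k → T.Edge), Function.Injective b ∧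
          (∀ y, y ∈ Set.range b ↔ (a i = e ∧ T.below y = some v) ∨ (a i ≠ e ∧ y = a i)) ∧
          T.Operation b (a i) := by
        intro i
        by_cases hi : a i = e
        · refine ⟨m', a', ha'.1, fun y => ?_, ?_⟩
          · rw [ha'.2]
            simp [hi]
          · rw [hi, ← hv]
            exact .vertex v a' ha'
        · exact ⟨1, fun _ => a i, Function.injective_of_subsingleton _,
            fun y => by simp [hi, eq_comm], .one _⟩
      choose k b hb1 hb2 hb3 using hb
      have hmem : ∀ i, T.below (a i) = some w := fun i => (ha.2 _).1 ⟨i, rfl⟩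
      refine Operation.of_range (.comp (.vertex w a ha) hb3) ?_ hcinj ?_
      · intro x y hxy
        have hx := (hb2 (blocks k x).1 _).1 ⟨(blocks k x).2, rfl⟩
        have hy := (hb2 (blocks k y).1 _).1 ⟨(blocks k y).2, rfl⟩
        change b (blocks k x).1 (blocks k x).2 = b (blocks k y).1 (blocks k y).2 at hxy
        rw [← hxy] at hy
        have h1 : (blocks k x).1 = (blocks k y).1 := by
          apply ha.1
          rcases hx with ⟨hx, hx'⟩ | ⟨hx, hx'⟩ <;> rcases hy with ⟨hy, hy'⟩ | ⟨hy, hy'⟩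
          · rw [hx, hy]
          · rw [hy', hmem] at hx'
            rw [Option.some.inj hx', hv] at hue
            exact absurd rfl hue
          · rw [hx', hmem] at hy'
            rw [Option.some.inj hy', hv] at hue
            exact absurd rfl hue
          · rw [← hx', ← hy']
        apply (blocks k).injective
        generalize blocks k x = p at h1 hxy
        generalize blocks k y = q at h1 hxy
        obtain ⟨p1, p2⟩ := p
        obtain ⟨q1, q2⟩ := q
        obtain rfl : p1 = q1 := h1
        exact congrArg (Sigma.mk p1) (hb1 p1 hxy)
      · ext y
        rw [hrange]
        constructor
        · rintro ⟨hy, h | ⟨_, h⟩⟩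
          · obtain ⟨i, rfl⟩ := (ha.2 y).2 h
            obtain ⟨j, hj⟩ := (hb2 i (a i)).2 (Or.inr ⟨hy, rfl⟩)
            exact ⟨(blocks k).symm ⟨i, j⟩, (concat_symm b ⟨i, j⟩).trans hj⟩
          · obtain ⟨i, hi⟩ := (ha.2 e).2 hu
            obtain ⟨j, hj⟩ := (hb2 i y).2 (Or.inl ⟨hi, h⟩)
            exact ⟨(blocks k).symm ⟨i, j⟩, (concat_symm b ⟨i, j⟩).trans hj⟩
        · rintro ⟨x, rfl⟩
          rcases (hb2 (blocks k x).1 _).1 ⟨(blocks k x).2, rfl⟩ with ⟨_, h⟩ | ⟨h, h'⟩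
          · refine ⟨fun h' => hve ?_, Or.inr ⟨rfl, h⟩⟩
            rw [← h']
            exact h
          · change b (blocks k x).1 (blocks k x).2 ≠ e ∧
              (T.below (b (blocks k x).1 (blocks k x).2) = some w ∨ _)
            rw [h']
            exact ⟨h, Or.inl (hmem _)⟩
    · refine .vertex w _ ⟨hcinj, fun y => ?_⟩
      rw [hrange]
      constructor
      · rintro ⟨_, h | ⟨h, _⟩⟩
        · exact h
        · exact absurd h hwu
      · intro h
        refine ⟨fun h' => hwu ?_, Or.inl h⟩
        rw [h', hu] at h
        exact (Option.some.inj h).symm)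

end Tree

/-! ### Dendroidal sets, horns and nerves -/

/-- Dendroidal sets: presheaves of sets on the category of trees. -/
abbrev DSet : Type (u + 1) := Treeᵒᵖ ⥤ Type u

namespace Tree

/-- The faces of a tree: contractions of inner edges, deletions of outer vertices and, for a tree
with exactly one vertex, its edges. -/
inductive Face (T : Tree) : Type
  | inner (e : T.Edge) (he : T.IsInner e)
  | outer (v : T.Vertex) (hv : T.IsOuter v)
  | edge (e : T.Edge) (hT : ∃! _v : T.Vertex, True)

/-- The source of a face map. -/
noncomputable def Face.source {T : Tree} : T.Face → Tree
  | .inner e he => T.innerFace e he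
  | .outer v hv => T.outerFace v hv
  | .edge _ _ => eta

/-- The face map. -/
noncomputable def Face.map {T : Tree} : (F : T.Face) → (F.source ⟶ T)
  | .inner e he => T.innerFaceHom e he
  | .outer v hv => T.outerFaceHom v hv
  | .edge e _ => edgeHom e

/-- The dendroidal set `Ω[T]` represented by a tree `T`. -/
abbrev representable (T : Tree) : DSet.{u} := uliftYoneda.{u}.obj T

/-- The inner horn `Λᵉ[T]`: the union in `Ω[T]` of all faces of `T` other than the contraction
of `e`. -/
noncomputable def innerHorn (T : Tree) (e : T.Edge) (he : T.IsInner e) :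
    Subfunctor (representable.{u} T) :=
  ⨆ F : {F : T.Face // F ≠ .inner e he}, Subfunctor.range (uliftYoneda.{u}.map F.1.map)

end Tree

/-- A dendroidal set `K` is a strict inner Kan complex if, for every tree `T` and every inner edge
`e`, restriction along `Λᵉ[T] ⟶ Ω[T]` is a bijection `Hom(Ω[T], K) → Hom(Λᵉ[T], K)`. -/
def IsStrictInnerKan (K : DSet.{u}) : Prop :=
  ∀ (T : Tree) (e : T.Edge) (he : T.IsInner e),
    Function.Bijective fun x : T.representable ⟶ K => (T.innerHorn e he).ι ≫ x

/-- The dendroidal nerve functor, `N_d(P)_T = Hom(Ω(T), P)`. -/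
def nerve : Operad.{u} ⥤ DSet.{u} where
  obj P :=
    { obj := fun T => Operad.Hom T.unop.operad P
      map := fun f => ↾fun x => Operad.Hom.comp f.unop x }
  map g := { app := fun _ => ↾fun x => Operad.Hom.comp x g }

/-! ### The operad generated by a dendroidal set -/

namespace Tree

/-- An operation of the operad of `T`, seen as a map from a corolla to `T`. -/
def opHom {T : Tree} {n : ℕ} {c : Fin n → T.Edge} {d : T.Edge} (p : T.Operation c d) :
    corolla n ⟶ T :=
  homMk (fun e => e.elim d c) (by
    rintro ⟨⟩ m a ha
    have h : ∀ i, ∃ j, a i = some j := by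
      intro i
      have := (ha.2 (a i)).1 ⟨i, rfl⟩
      exact Option.ne_none_iff_exists'.1 fun h' => by rw [h'] at this; cases this
    choose j hj using h
    have hbij : Function.Bijective j := by
      constructor
      · intro i i' h
        apply ha.1
        rw [hj, hj, h]
      · intro l
        obtain ⟨i, hi⟩ := (ha.2 (some l)).2 rfl
        exact ⟨i, Option.some.inj ((hj i).symm.trans hi)⟩
    exact .act (Equiv.ofBijective j hbij) (fun i => by rw [hj]; rfl) p)

/-- The operation of the corolla given by its vertex. -/
theorem corollaOp (n : ℕ) : (corolla n).Operation some none :=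
  .vertex (T := corolla n) () some ⟨Option.some_injective _, fun e => by
    cases e with
    | none => exact ⟨fun h => (by obtain ⟨i, hi⟩ := h; cases hi), fun h => (by cases h)⟩
    | some i => exact ⟨fun _ => rfl, fun _ => ⟨i, rfl⟩⟩⟩

end Tree

open Dendroidal.Tree

/-- The colour of the edge `e` in a dendrex `x` of shape `T`. -/
def DSet.edge (X : DSet.{u}) {T : Tree} (x : X.obj (op T)) (e : T.Edge) : X.obj (op eta) :=
  X.map (edgeHom e).op x

theorem DSet.edge_map (X : DSet.{u}) {S T : Tree} (f : S ⟶ T) (x : X.obj (op T)) (e : S.Edge) :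
    X.edge (X.map f.op x) e = X.edge x (edgeMap f e) := by
  have : edgeHom (edgeMap f e) = edgeHom e ≫ f := hom_ext fun _ => rfl
  rw [DSet.edge, DSet.edge, this, op_comp, Functor.map_comp]
  rfl

theorem DSet.edge_eta (X : DSet.{u}) (x : X.obj (op eta)) : X.edge x () = x := by
  have : edgeHom (T := eta) () = 𝟙 eta := hom_ext fun _ => rfl
  change X.map (edgeHom (T := eta) ()).op x = x
  rw [this, op_id, CategoryTheory.Functor.map_id]
  rfl

/-- Formal composites of dendrices of `X` whose shape is a corolla. -/
inductive Term (X : DSet.{u}) :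
    {n : ℕ} → (Fin n → X.obj (op eta)) → X.obj (op eta) → Type u
  | gen {n : ℕ} (x : X.obj (op (corolla n))) {c : Fin n → X.obj (op eta)} {d : X.obj (op eta)}
      (hc : ∀ i, X.edge x (some i) = c i) (hd : X.edge x none = d) : Term X c d
  | one (c : X.obj (op eta)) : Term X (fun _ : Fin 1 => c) c
  | act {m n : ℕ} (σ : Fin m ≃ Fin n) {c : Fin n → X.obj (op eta)} {c' : Fin m → X.obj (op eta)}
      {d : X.obj (op eta)} (h : ∀ i, c' i = c (σ i)) (p : Term X c d) : Term X c' d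
  | comp {n : ℕ} {k : Fin n → ℕ} {c : Fin n → X.obj (op eta)}
      {b : ∀ i, Fin (k i) → X.obj (op eta)} {d : X.obj (op eta)} (p : Term X c d)
      (q : ∀ i, Term X (b i) (c i)) : Term X (concat b) d

namespace Term

/-- The generator given by an operation in the shape of a dendrex. -/
def ofOperation {X : DSet.{u}} {T : Tree} (x : X.obj (op T)) {n : ℕ} {c : Fin n → T.Edge}
    {d : T.Edge} (p : T.Operation c d) :
    Term X (fun i => X.edge x (c i)) (X.edge x d) :=
  gen (X.map (opHom p).op x) (fun i => X.edge_map (opHom p) x (some i))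
    (X.edge_map (opHom p) x none)

/-- The relations: the axioms of an operad, and the requirement that every dendrex `x` of shape `T`
gives a map of operads from the operad of `T`. -/
inductive Rel {X : DSet.{u}} :
    {n : ℕ} → {c : Fin n → X.obj (op eta)} → {d : X.obj (op eta)} → Term X c d → Term X c d → Prop
  | refl {n : ℕ} {c : Fin n → X.obj (op eta)} {d : X.obj (op eta)} (p : Term X c d) : Rel p p
  | symm {n : ℕ} {c : Fin n → X.obj (op eta)} {d : X.obj (op eta)} {p q : Term X c d} :
      Rel p q → Rel q p
  | trans {n : ℕ} {c : Fin n → X.obj (op eta)} {d : X.obj (op eta)} {p q r : Term X c d} :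
      Rel p q → Rel q r → Rel p r
  | congr_act {m n : ℕ} (σ : Fin m ≃ Fin n) {c : Fin n → X.obj (op eta)}
      {c' : Fin m → X.obj (op eta)} {d : X.obj (op eta)} (h : ∀ i, c' i = c (σ i))
      {p q : Term X c d} : Rel p q → Rel (p.act σ h) (q.act σ h)
  | congr_comp {n : ℕ} {k : Fin n → ℕ} {c : Fin n → X.obj (op eta)}
      {b : ∀ i, Fin (k i) → X.obj (op eta)} {d : X.obj (op eta)} {p p' : Term X c d}
      {q q' : ∀ i, Term X (b i) (c i)} : Rel p p' → (∀ i, Rel (q i) (q' i)) →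
      Rel (p.comp q) (p'.comp q')
  | act_refl {n : ℕ} {c : Fin n → X.obj (op eta)} {d : X.obj (op eta)} (p : Term X c d) :
      Rel (p.act (Equiv.refl _) (fun _ => rfl)) p
  | act_act {l m n : ℕ} (τ : Fin l ≃ Fin m) (σ : Fin m ≃ Fin n) {c : Fin n → X.obj (op eta)}
      {c' : Fin m → X.obj (op eta)} {c'' : Fin l → X.obj (op eta)} {d : X.obj (op eta)}
      (h : ∀ i, c' i = c (σ i)) (h' : ∀ i, c'' i = c' (τ i)) (p : Term X c d) :
      Rel ((p.act σ h).act τ h') (p.act (τ.trans σ) (fun i => (h' i).trans (h (τ i))))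
  | one_comp {n : ℕ} {c : Fin n → X.obj (op eta)} {d : X.obj (op eta)} (p : Term X c d) :
      Rel ((one d).comp fun _ => p) (p.act (oneBlock n) (concat_oneBlock c))
  | comp_one {n : ℕ} {c : Fin n → X.obj (op eta)} {d : X.obj (op eta)} (p : Term X c d) :
      Rel (p.comp fun i => one (c i)) (p.act (unitBlocks n) (concat_unitBlocks c))
  | act_comp {m n : ℕ} (σ : Fin m ≃ Fin n) {k : Fin n → ℕ} {c : Fin n → X.obj (op eta)}
      {b : ∀ i, Fin (k i) → X.obj (op eta)} {d : X.obj (op eta)} (p : Term X c d)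
      (q : ∀ i, Term X (b i) (c i)) :
      Rel ((p.act σ (c' := fun i => c (σ i)) (fun _ => rfl)).comp fun i => q (σ i))
        ((p.comp q).act (permBlocks σ k) (concat_permBlocks σ b))
  | comp_act {n : ℕ} {k k' : Fin n → ℕ} (τ : ∀ i, Fin (k' i) ≃ Fin (k i))
      {c : Fin n → X.obj (op eta)} {b : ∀ i, Fin (k i) → X.obj (op eta)}
      {b' : ∀ i, Fin (k' i) → X.obj (op eta)} {d : X.obj (op eta)}
      (h : ∀ i j, b' i j = b i (τ i j)) (p : Term X c d) (q : ∀ i, Term X (b i) (c i)) :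
      Rel (p.comp fun i => (q i).act (τ i) (h i))
        ((p.comp q).act (permInBlocks τ) (concat_permInBlocks τ h))
  | assoc {n : ℕ} {k : Fin n → ℕ} {l : ∀ i, Fin (k i) → ℕ} {c : Fin n → X.obj (op eta)}
      {b : ∀ i, Fin (k i) → X.obj (op eta)} {a : ∀ i j, Fin (l i j) → X.obj (op eta)}
      {d : X.obj (op eta)} (p : Term X c d) (q : ∀ i, Term X (b i) (c i))
      (r : ∀ i j, Term X (a i j) (b i j)) :
      Rel (comp (k := concat l) (p.comp q) fun y => r (blocks k y).1 (blocks k y).2)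
        ((p.comp fun i => (q i).comp (r i)).act (assocBlocks l) (concat_assocBlocks l a))
  | of_one {T : Tree} (x : X.obj (op T)) (e : T.Edge) :
      Rel (ofOperation x (.one e)) (one (X.edge x e))
  | of_act {T : Tree} (x : X.obj (op T)) {m n : ℕ} (σ : Fin m ≃ Fin n) {c : Fin n → T.Edge}
      {c' : Fin m → T.Edge} {d : T.Edge} (h : ∀ i, c' i = c (σ i)) (p : T.Operation c d) :
      Rel (ofOperation x (.act σ h p))
        ((ofOperation x p).act σ (fun i => congrArg (X.edge x) (h i)))
  | of_comp {T : Tree} (x : X.obj (op T)) {n : ℕ} {k : Fin n → ℕ} {c : Fin n → T.Edge}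
      {b : ∀ i, Fin (k i) → T.Edge} {d : T.Edge} (p : T.Operation c d)
      (q : ∀ i, T.Operation (b i) (c i)) :
      Rel (ofOperation x (.comp p q)) ((ofOperation x p).comp fun i => ofOperation x (q i))

/-- Formal composites up to the relations. -/
def setoid (X : DSet.{u}) {n : ℕ} (c : Fin n → X.obj (op eta)) (d : X.obj (op eta)) :
    Setoid (Term X c d) :=
  ⟨Rel, Rel.refl, Rel.symm, Rel.trans⟩

/-- The class of a formal composite. -/
def cls {X : DSet.{u}} {n : ℕ} {c : Fin n → X.obj (op eta)} {d : X.obj (op eta)}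
    (p : Term X c d) : Quotient (setoid X c d) := Quotient.mk _ p

theorem cls_eq {X : DSet.{u}} {n : ℕ} {c : Fin n → X.obj (op eta)} {d : X.obj (op eta)}
    {p q : Term X c d} (h : Rel p q) : cls p = cls q := Quotient.sound h

theorem rel_out {X : DSet.{u}} {n : ℕ} {c : Fin n → X.obj (op eta)} {d : X.obj (op eta)}
    (p : Term X c d) : Rel (cls p).out p := Quotient.exact (s := setoid X c d) (Quotient.out_eq _)

theorem exists_cls {X : DSet.{u}} {n : ℕ} {c : Fin n → X.obj (op eta)} {d : X.obj (op eta)}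
    (p : Quotient (setoid X c d)) : ∃ p' : Term X c d, p = cls p' :=
  ⟨p.out, (Quotient.out_eq p).symm⟩

/-- Composition of classes. -/
noncomputable def clsComp {X : DSet.{u}} {n : ℕ} {k : Fin n → ℕ} {c : Fin n → X.obj (op eta)}
    {b : ∀ i, Fin (k i) → X.obj (op eta)} {d : X.obj (op eta)} (p : Quotient (setoid X c d))
    (q : ∀ i, Quotient (setoid X (b i) (c i))) : Quotient (setoid X (concat b) d) :=
  cls (p.out.comp fun i => (q i).out)

theorem clsComp_cls {X : DSet.{u}} {n : ℕ} {k : Fin n → ℕ} {c : Fin n → X.obj (op eta)}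
    {b : ∀ i, Fin (k i) → X.obj (op eta)} {d : X.obj (op eta)} (p : Term X c d)
    (q : ∀ i, Term X (b i) (c i)) : clsComp (cls p) (fun i => cls (q i)) = cls (p.comp q) :=
  cls_eq (.congr_comp (rel_out p) fun i => rel_out (q i))

/-- Permutation of the inputs of a class. -/
noncomputable def clsAct {X : DSet.{u}} {m n : ℕ} (σ : Fin m ≃ Fin n) {c : Fin n → X.obj (op eta)}
    {c' : Fin m → X.obj (op eta)} {d : X.obj (op eta)} (h : ∀ i, c' i = c (σ i))
    (p : Quotient (setoid X c d)) : Quotient (setoid X c' d) :=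
  cls (p.out.act σ h)

theorem clsAct_cls {X : DSet.{u}} {m n : ℕ} (σ : Fin m ≃ Fin n) {c : Fin n → X.obj (op eta)}
    {c' : Fin m → X.obj (op eta)} {d : X.obj (op eta)} (h : ∀ i, c' i = c (σ i))
    (p : Term X c d) : clsAct σ h (cls p) = cls (p.act σ h) :=
  cls_eq (.congr_act σ h (rel_out p))

end Term

/-- The operad `τ_d(X)` generated by a dendroidal set `X`: its colours are the dendrices of `X`
whose shape is the tree with one edge, its operations are generated by the dendrices whose shape
is a corolla. -/
noncomputable def operadOf (X : DSet.{u}) : Operad.{u} where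
  Color := X.obj (op eta)
  Op c d := Quotient (Term.setoid X c d)
  one c := Term.cls (.one c)
  act σ _ _ _ h p := Term.clsAct σ h p
  comp p q := Term.clsComp p q
  act_refl p := by
    obtain ⟨p, rfl⟩ := Term.exists_cls p
    exact (Term.clsAct_cls _ _ p).trans (Term.cls_eq (.act_refl p))
  act_act τ σ _ _ _ _ h h' p := by
    obtain ⟨p, rfl⟩ := Term.exists_cls p
    rw [Term.clsAct_cls, Term.clsAct_cls, Term.clsAct_cls]
    exact Term.cls_eq (.act_act τ σ h h' p)
  one_comp p := by
    obtain ⟨p, rfl⟩ := Term.exists_cls p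
    rw [Term.clsAct_cls]
    exact (Term.clsComp_cls (.one _) fun _ => p).trans (Term.cls_eq (.one_comp p))
  comp_one p := by
    obtain ⟨p, rfl⟩ := Term.exists_cls p
    rw [Term.clsAct_cls]
    exact (Term.clsComp_cls p fun _ => .one _).trans (Term.cls_eq (.comp_one p))
  act_comp σ _ _ _ _ p q := by
    obtain ⟨p, rfl⟩ := Term.exists_cls p
    choose q' hq using fun i => Term.exists_cls (q i)
    obtain rfl := funext hq
    rw [Term.clsAct_cls]
    exact ((Term.clsComp_cls _ fun i => q' (σ i)).trans (Term.cls_eq (.act_comp σ p q'))).trans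
      ((congrArg (Term.clsAct _ _) (Term.clsComp_cls p q')).trans (Term.clsAct_cls _ _ _)).symm
  comp_act τ _ _ _ _ h p q := by
    obtain ⟨p, rfl⟩ := Term.exists_cls p
    choose q' hq using fun i => Term.exists_cls (q i)
    obtain rfl := funext hq
    rw [Term.clsComp_cls, Term.clsAct_cls]
    simp only [Term.clsAct_cls]
    exact (Term.clsComp_cls _ _).trans (Term.cls_eq (.comp_act τ h p q'))
  assoc p q r := by
    obtain ⟨p, rfl⟩ := Term.exists_cls p
    choose q' hq using fun i => Term.exists_cls (q i)
    obtain rfl := funext hq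
    choose r' hr using fun i j => Term.exists_cls (r i j)
    obtain rfl : r = fun i j => Term.cls (r' i j) := funext fun i => funext (hr i)
    simp only [Term.clsComp_cls, Term.clsAct_cls]
    exact Term.cls_eq (.assoc p q' r')

namespace Operad

theorem recolor_recolor (P : Operad.{u}) {n : ℕ} {c c' c'' : Fin n → P.Color}
    {d d' d'' : P.Color} (hc : ∀ i, c i = c' i) (hd : d = d') (hc' : ∀ i, c' i = c'' i)
    (hd' : d' = d'') (p : P.Op c d) :
    P.recolor hc' hd' (P.recolor hc hd p) =
      P.recolor (fun i => (hc i).trans (hc' i)) (hd.trans hd') p := by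
  obtain rfl := funext hc
  obtain rfl := funext hc'
  subst hd hd'
  rfl

theorem recolor_one (P : Operad.{u}) {c c' : P.Color} (h : c = c') :
    P.recolor (fun _ => h) h (P.one c) = P.one c' := by
  subst h
  rfl

theorem recolor_act (P : Operad.{u}) {m n : ℕ} (σ : Fin m ≃ Fin n) {c e : Fin n → P.Color}
    {c' e' : Fin m → P.Color} {d d' : P.Color} (h : ∀ i, c' i = c (σ i))
    (h' : ∀ i, e' i = e (σ i)) (hc : ∀ i, c i = e i) (hc' : ∀ i, c' i = e' i) (hd : d = d')
    (p : P.Op c d) :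
    P.recolor hc' hd (P.act σ h p) = P.act σ h' (P.recolor hc hd p) := by
  obtain rfl := funext hc
  obtain rfl := funext hc'
  subst hd
  rfl

theorem recolor_comp (P : Operad.{u}) {n : ℕ} {k : Fin n → ℕ} {c c' : Fin n → P.Color}
    {b b' : ∀ i, Fin (k i) → P.Color} {d d' : P.Color} (hc : ∀ i, c i = c' i)
    (hb : ∀ i j, b i j = b' i j) (hd : d = d') (p : P.Op c d) (q : ∀ i, P.Op (b i) (c i)) :
    P.recolor (fun _ => hb _ _) hd (P.comp p q) =
      P.comp (P.recolor hc hd p) (fun i => P.recolor (hb i) (hc i) (q i)) := by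
  obtain rfl := funext hc
  obtain rfl : b = b' := funext fun i => funext (hb i)
  subst hd
  rfl

theorem Hom.recolor_op {P : Operad.{u}} {Q : Operad.{v}} (f : Hom P Q) {n : ℕ}
    {c c' : Fin n → P.Color} {d d' : P.Color} (hc : ∀ i, c i = c' i) (hd : d = d')
    (p : P.Op c d) :
    Q.recolor (fun i => congrArg f.color (hc i)) (congrArg f.color hd) (f.op p) =
      f.op (P.recolor hc hd p) := by
  obtain rfl := funext hc
  subst hd
  rfl

end Operad

theorem recolor_gen {X : DSet.{u}} {n : ℕ} {x x' : X.obj (op (corolla n))} (hx : x = x')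
    {c c' : Fin n → X.obj (op eta)} {d d' : X.obj (op eta)} (hc : ∀ i, X.edge x (some i) = c i)
    (hd : X.edge x none = d) (hc' : ∀ i, X.edge x' (some i) = c' i) (hd' : X.edge x' none = d')
    (ec : ∀ i, c i = c' i) (ed : d = d') :
    (operadOf X).recolor ec ed (Term.cls (.gen x hc hd)) = Term.cls (.gen x' hc' hd') := by
  subst hx ed
  obtain rfl := funext ec
  rfl

/-- The map of dendroidal sets that corresponds to a map of operads. -/
noncomputable def toNerve {X : DSet.{u}} {P : Operad.{u}} (f : operadOf X ⟶ P) :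
    X ⟶ nerve.obj P where
  app T := ↾fun x =>
    { color := fun e => Operad.Hom.color f (X.edge x e)
      op := fun p => Operad.Hom.op f (Term.cls (Term.ofOperation x p.down))
      op_one := fun e => (congrArg (Operad.Hom.op f) (Term.cls_eq (.of_one x e))).trans
        (Operad.Hom.op_one f _)
      op_act := fun σ _ _ _ h p => (congrArg (Operad.Hom.op f)
        ((Term.cls_eq (.of_act x σ h p.down)).trans (Term.clsAct_cls _ _ _).symm)).trans
        (Operad.Hom.op_act f _ _ _)
      op_comp := fun p q => (congrArg (Operad.Hom.op f)
        ((Term.cls_eq (.of_comp x p.down fun i => (q i).down)).trans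
          (Term.clsComp_cls _ _).symm)).trans (Operad.Hom.op_comp f _ _) }
  naturality S T g := by
    ext x
    refine Operad.Hom.ext' (fun e => congrArg (Operad.Hom.color f) (X.edge_map g.unop x e)) ?_
    intro n c d p
    refine (Operad.Hom.recolor_op f (fun i => X.edge_map g.unop x (c i))
      (X.edge_map g.unop x d) _).trans (congrArg (Operad.Hom.op f) ?_)
    refine recolor_gen ?_ _ _ _ _ _ _
    have : opHom (Operad.Hom.op g.unop p).down = opHom p.down ≫ g.unop :=
      hom_ext fun e => by cases e <;> rfl
    change X.map (opHom p.down).op (X.map g x) =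
      X.map (opHom (Operad.Hom.op g.unop p).down).op x
    rw [this, op_comp, Functor.map_comp]
    rfl

section

variable {X : DSet.{u}} {P : Operad.{u}} (f : X ⟶ nerve.obj P)

/-- The map of operads given by a dendrex, via a map to a nerve. -/
def dendrexHom {T : Tree} (x : X.obj (op T)) : Operad.Hom T.operad P := f.app (op T) x

theorem dendrexHom_map {S T : Tree} (g : S ⟶ T) (x : X.obj (op T)) :
    dendrexHom f (X.map g.op x) = Operad.Hom.comp g (dendrexHom f x) :=
  ConcreteCategory.congr_hom (f.naturality g.op) x

/-- The colour of a dendrex whose shape is the tree with one edge. -/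
def dendrexColor (y : X.obj (op eta)) : P.Color := (dendrexHom f y).color ()

theorem dendrexColor_edge {T : Tree} (x : X.obj (op T)) (e : T.Edge) :
    dendrexColor f (X.edge x e) = (dendrexHom f x).color e :=
  congrArg (fun h : Operad.Hom eta.operad P => h.color (show eta.Edge from ())) (dendrexHom_map f (edgeHom e) x)

/-- The value of a formal composite. -/
def value : {n : ℕ} → {c : Fin n → X.obj (op eta)} → {d : X.obj (op eta)} → Term X c d →
    P.Op (fun i => dendrexColor f (c i)) (dendrexColor f d)
  | n, _, _, .gen x hc hd =>
    P.recolor (fun i => (dendrexColor_edge f x (some i)).symm.trans (congrArg _ (hc i)))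
      ((dendrexColor_edge f x none).symm.trans (congrArg _ hd))
      ((dendrexHom f x).op (c := some) (d := none) ⟨corollaOp n⟩)
  | _, _, _, .one c => P.one (dendrexColor f c)
  | _, _, _, .act σ h p => P.act σ (fun i => congrArg (dendrexColor f) (h i)) (value p)
  | _, _, _, .comp p q => P.comp (value p) (fun i => value (q i))

theorem value_ofOperation {T : Tree} (x : X.obj (op T)) {n : ℕ} {c : Fin n → T.Edge}
    {d : T.Edge} (p : T.Operation c d) :
    value f (Term.ofOperation x p) =
      P.recolor (fun i => (dendrexColor_edge f x (c i)).symm) (dendrexColor_edge f x d).symm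
        ((dendrexHom f x).op ⟨p⟩) := by
  have key : ∀ (g : Operad.Hom (corolla n).operad P)
      (_ : g = Operad.Hom.comp (opHom p) (dendrexHom f x))
      (hc : ∀ i, g.color (some i) = dendrexColor f (X.edge x (c i)))
      (hd : g.color none = dendrexColor f (X.edge x d)),
      P.recolor hc hd (g.op (c := some) (d := none) ⟨corollaOp n⟩) =
      P.recolor (fun i => (dendrexColor_edge f x (c i)).symm) (dendrexColor_edge f x d).symm
        ((dendrexHom f x).op ⟨p⟩) := by
    rintro _ rfl hc hd
    rfl
  exact key _ (dendrexHom_map f (opHom p) x) _ _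

theorem value_rel {n : ℕ} {c : Fin n → X.obj (op eta)} {d : X.obj (op eta)}
    {p q : Term X c d} (h : Term.Rel p q) : value f p = value f q := by
  induction h with
  | refl => rfl
  | symm _ ih => exact ih.symm
  | trans _ _ ih ih' => exact ih.trans ih'
  | congr_act σ h _ ih => simp only [value, ih]
  | congr_comp _ _ ih ih' => simp only [value, ih, ih']
  | act_refl p => exact P.act_refl _
  | act_act τ σ h h' p => exact P.act_act _ _ _ _ _
  | one_comp p => exact P.one_comp _
  | comp_one p => exact P.comp_one _
  | act_comp σ p q => exact P.act_comp σ (value f p) fun i => value f (q i)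
  | comp_act τ h p q => exact P.comp_act τ _ (value f p) fun i => value f (q i)
  | assoc p q r =>
    exact P.assoc (value f p) (fun i => value f (q i)) fun i j => value f (r i j)
  | of_one x e =>
    rw [value_ofOperation]
    exact (congrArg _ ((dendrexHom f x).op_one e)).trans (P.recolor_one _)
  | of_act x σ h p =>
    rw [value_ofOperation]
    refine (congrArg _ ((dendrexHom f x).op_act σ h ⟨p⟩)).trans ?_
    refine (P.recolor_act σ _ (fun i => congrArg (fun e => dendrexColor f (X.edge x e)) (h i))
      (fun i => (dendrexColor_edge f x _).symm) _ _ _).trans ?_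
    exact congrArg _ (value_ofOperation f x p).symm
  | of_comp x p q =>
    rw [value_ofOperation]
    refine (congrArg _ ((dendrexHom f x).op_comp ⟨p⟩ fun i => ⟨q i⟩)).trans ?_
    refine (P.recolor_comp (fun i => (dendrexColor_edge f x _).symm)
      (fun i j => (dendrexColor_edge f x _).symm) _ _ _).trans ?_
    simp only [value, value_ofOperation]

/-- The map of operads that corresponds to a map of dendroidal sets. -/
noncomputable def ofNerve : operadOf X ⟶ P where
  color := dendrexColor f
  op := Quotient.lift (value f) fun _ _ h => value_rel f h
  op_one _ := rfl
  op_act σ _ _ _ h p := by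
    obtain ⟨p, rfl⟩ := Term.exists_cls p
    exact congrArg (Quotient.lift (value f) fun _ _ h => value_rel f h)
      (Term.clsAct_cls σ h p)
  op_comp p q := by
    obtain ⟨p, rfl⟩ := Term.exists_cls p
    choose q' hq using fun i => Term.exists_cls (q i)
    obtain rfl := funext hq
    exact congrArg (Quotient.lift (value f) fun _ _ h => value_rel f h)
      (Term.clsComp_cls p q')

theorem toNerve_ofNerve : toNerve (ofNerve f) = f := by
  ext T x
  refine Operad.Hom.ext' (f := (toNerve (ofNerve f)).app T x) (g := dendrexHom f x)
    (fun e => dendrexColor_edge f x e) ?_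
  intro n c d p
  refine (congrArg (P.recolor _ _) (value_ofOperation f x p.down)).trans ?_
  exact P.recolor_recolor _ _ _ _ _

end

theorem ofNerve_toNerve {X : DSet.{u}} {P : Operad.{u}} (f : operadOf X ⟶ P) :
    ofNerve (toNerve f) = f := by
  have hcol : ∀ y, dendrexColor (toNerve f) y = Operad.Hom.color f y := fun y =>
    congrArg (Operad.Hom.color f) (X.edge_eta y)
  refine Operad.Hom.ext' hcol ?_
  intro n c d p
  obtain ⟨p, rfl⟩ := Term.exists_cls p
  change P.recolor _ _ (value (toNerve f) p) = Operad.Hom.op f (Term.cls p)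
  induction p with
  | @gen n x c d hc hd =>
    refine (P.recolor_recolor _ _ _ _ _).trans ?_
    refine (Operad.Hom.recolor_op f (p := Term.cls (Term.ofOperation x (corollaOp n)))
      hc hd).trans (congrArg (Operad.Hom.op f) ?_)
    refine recolor_gen ?_ _ _ _ _ _ _
    have : opHom (corollaOp n) = 𝟙 (corolla n) := hom_ext fun e => by cases e <;> rfl
    rw [this, op_id, CategoryTheory.Functor.map_id]
    rfl
  | one c => exact (P.recolor_one _).trans (Operad.Hom.op_one f c).symm
  | act σ h p ih =>
    refine (P.recolor_act σ _ (fun i => congrArg (Operad.Hom.color f) (h i)) (fun i => hcol _)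
      _ (hcol _) _).trans ?_
    refine (congrArg _ ih).trans ?_
    exact (Operad.Hom.op_act f σ h (Term.cls p)).symm.trans
      (congrArg (Operad.Hom.op f) (Term.clsAct_cls σ h p))
  | comp p q ih ih' =>
    refine (P.recolor_comp (fun i => hcol _) (fun i j => hcol _) (hcol _) _ _).trans ?_
    rw [ih]
    simp only [ih']
    exact (Operad.Hom.op_comp f (Term.cls p) fun i => Term.cls (q i)).symm.trans
      (congrArg (Operad.Hom.op f) (Term.clsComp_cls p q))

/-- Maps of operads `τ_d(X) ⟶ P` are the same as maps of dendroidal sets `X ⟶ N_d(P)`. -/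
noncomputable def nerveEquiv (X : DSet.{u}) (P : Operad.{u}) :
    (operadOf X ⟶ P) ≃ (X ⟶ nerve.obj P) where
  toFun := toNerve
  invFun := ofNerve
  left_inv := ofNerve_toNerve
  right_inv := toNerve_ofNerve

/-- The functor `τ_d`, left adjoint to the nerve; on objects it is `operadOf`. -/
noncomputable def tau : DSet.{u} ⥤ Operad.{u} :=
  Adjunction.leftAdjointOfEquiv (G := nerve) nerveEquiv fun _ _ _ _ _ => rfl

/-- The adjunction between `τ_d` and the dendroidal nerve. -/
noncomputable def tauAdjunction : tau.{u} ⊣ nerve.{u} :=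
  Adjunction.adjunctionOfEquivLeft (G := nerve) nerveEquiv fun _ _ _ _ _ => rfl

end Dendroidal

/-! Everything rests on a Segal property: a dendrex of shape `T` in a strict inner Kan complex
amounts to colours for the edges of `T` and matching corollas for its vertices. Uniqueness is
`IsStrictInnerKan.ext`, existence is `IsStrictInnerKan.exists_extends`.

The combinatorial input is that the operations of the operad of `T` are exactly the cuts of `T`
above an edge (`Operation.isCut`, `IsCut.operation`), so lifting an operation along an injective map
of trees is a question about leaves. An operation that misses some vertex, called proper, spans a
subtree with fewer vertices and, if `T` has an inner edge, lifts to an outer face. Every face other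
than the contraction of `e` still contains `e`, so its vertices become proper operations of `T`.

The Segal property follows by induction on the number of vertices. Values on proper operations are
computed in the spanned subtrees. They determine the dendrex on every face of the horn, which gives
uniqueness. For existence they produce dendrices on these faces, and the point is compatibility. Two
faces agree wherever the image in `T` is proper. A vertex with an image that is not proper occurs
only over two contractions of inner edges `e₁`, `e₂` different from `e`. If these differ, its
operation comes from the double contraction, which still contains `e`, and there the two dendrices
agree by uniqueness. The filler of the horn is the extension.

Consequently the corollas of `X` form an operad: compose by grafting and taking the total composite.
Each axiom compares two values of a single dendrex on operations with the same profile. By the Segal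
property, and since a map out of the operad of a tree is determined by edges and vertices
(`hom_ext_vertex`), `X` is isomorphic to the nerve of this operad.

Conversely, the operad of a tree is free (`FreeData.hom`). When there is an inner edge, all edges
and vertices lie on outer faces, so a horn in a nerve has exactly one filler.

The unit is injective because the isomorphism from `X` to the nerve of its operad factors through
it. It is surjective because grafting collapses every formal composite to one corolla
(`Term.isGen`), so that a map from the operad of `T` to `τ_d(X)` comes from a spine in `X`, which
extends. -/

namespace Dendroidal

namespace Tree

/-! ### The order on the edges of a tree -/

/-- `T.Step a b`: the edge `a` is an input of the vertex whose output is `b`. -/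
def Step (T : Tree) (a b : T.Edge) : Prop := ∃ v, T.below a = some v ∧ T.out v = b

/-- `T.Above a b`: the path from `a` to the root passes through `b`. -/
def Above (T : Tree) : T.Edge → T.Edge → Prop := Relation.ReflTransGen T.Step

variable {S T : Tree}

theorem Above.refl (a : T.Edge) : T.Above a a := Relation.ReflTransGen.refl

theorem Above.trans {a b c : T.Edge} (h : T.Above a b) (h' : T.Above b c) : T.Above a c :=
  Relation.ReflTransGen.trans h h'

theorem above_root (a : T.Edge) : T.Above a T.root := T.path a

theorem above_out {a : T.Edge} {v : T.Vertex} (h : T.below a = some v) : T.Above a (T.out v) :=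
  .single ⟨v, h, rfl⟩

theorem step_rightUnique (T : Tree) : Relator.RightUnique T.Step := by
  rintro a b c ⟨v, hv, rfl⟩ ⟨w, hw, rfl⟩
  rw [Option.some.inj (hv.symm.trans hw)]

theorem Above.total {a b c : T.Edge} (h : T.Above a b) (h' : T.Above a c) :
    T.Above b c ∨ T.Above c b :=
  Relation.ReflTransGen.total_of_right_unique T.step_rightUnique h h'

theorem above_cases {a b : T.Edge} (h : T.Above a b) :
    a = b ∨ ∃ v, T.below a = some v ∧ T.Above (T.out v) b := by
  rcases Relation.ReflTransGen.cases_head h with h | ⟨_, ⟨v, hv, rfl⟩, h⟩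
  · exact .inl h
  · exact .inr ⟨v, hv, h⟩

theorem above_out_cases {a : T.Edge} {v : T.Vertex} (h : T.Above a (T.out v)) :
    a = T.out v ∨ ∃ f, T.below f = some v ∧ T.Above a f := by
  rcases Relation.ReflTransGen.cases_tail h with h | ⟨f, haf, w, hw, hwv⟩
  · exact .inl h.symm
  · obtain rfl := T.out_injective hwv
    exact .inr ⟨f, hw, haf⟩

/-- Induction along the path from `a` to the root: the root has no vertex below it, so a descending
path cannot return to its start. -/
theorem Above.antisymm {a b : T.Edge} (h : T.Above a b) (h' : T.Above b a) : a = b := by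
  revert b
  have := T.path a
  induction this using Relation.ReflTransGen.head_induction_on with
  | refl =>
    intro b h _
    rcases above_cases h with h | ⟨v, hv, _⟩
    · exact h
    · rw [below_root] at hv
      cases hv
  | @head a a' haa' _ ih =>
    intro b h h'
    rcases above_cases h with h | ⟨v, hv, hb⟩
    · exact h
    · obtain rfl : T.out v = a' := T.step_rightUnique ⟨v, hv, rfl⟩ haa'
      have h1 : T.out v = b := ih hb (h'.trans (above_out hv))
      subst h1
      exact (ih h' (above_out hv)).symm

theorem not_above_out {a : T.Edge} {v : T.Vertex} (h : T.below a = some v) :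
    ¬ T.Above (T.out v) a := fun h' => by
  have := (above_out h).antisymm h'
  rw [this] at h
  exact T.below_out_ne v h

/-- Induction from the leaves towards the root. -/
theorem above_induction {p : T.Edge → Prop}
    (h : ∀ d, (∀ v e, T.out v = d → T.below e = some v → p e) → p d) (d : T.Edge) : p d := by
  have := T.finite
  -- Being strictly above is transitive and irreflexive on a finite type, hence well founded.
  let r : T.Edge → T.Edge → Prop := fun a b => T.Above a b ∧ a ≠ b
  have : IsTrans T.Edge r := ⟨fun a b c hab hbc => ⟨hab.1.trans hbc.1, fun hac => by
    subst hac
    exact hab.2 (hab.1.antisymm hbc.1)⟩⟩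
  have : Std.Irrefl r := ⟨fun a ha => ha.2 rfl⟩
  refine (Finite.wellFounded_of_trans_of_irrefl r).induction d fun d ih => h d ?_
  rintro v e rfl he
  refine ih e ⟨above_out he, fun h' => ?_⟩
  rw [h'] at he
  exact T.below_out_ne v he

/-- Incomparable edges lie over two different inputs of some vertex. -/
theorem exists_meet {a b : T.Edge} (h : ¬ T.Above a b) (h' : ¬ T.Above b a) :
    ∃ v f g, T.below f = some v ∧ T.below g = some v ∧ f ≠ g ∧ T.Above a f ∧ T.Above b g := by
  have := T.path a
  induction this using Relation.ReflTransGen.head_induction_on with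
  | refl => exact absurd (above_root b) h'
  | @head a a' haa' _ ih =>
    obtain ⟨v, hv, rfl⟩ := haa'
    have h1 : ¬ T.Above (T.out v) b := fun h1 => h ((above_out hv).trans h1)
    by_cases h2 : T.Above b (T.out v)
    · rcases above_out_cases h2 with rfl | ⟨f, hf, hbf⟩
      · exact absurd (Above.refl _) h1
      · exact ⟨v, a, f, hv, hf, fun h3 => h' (h3 ▸ hbf), .refl _, hbf⟩
    · obtain ⟨w, f, g, hf, hg, hfg, haf, hbg⟩ := ih h1 h2
      exact ⟨w, f, g, hf, hg, hfg, (above_out hv).trans haf, hbg⟩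

/-! ### Operations as cuts -/

/-- The edges `c` form a cut of the part of `T` above `d`. -/
structure IsCut (T : Tree) {n : ℕ} (c : Fin n → T.Edge) (d : T.Edge) : Prop where
  above : ∀ i, T.Above (c i) d
  antichain : ∀ i j, T.Above (c i) (c j) → i = j
  cut : ∀ e, T.Above e d → (∀ v, T.out v ≠ e) → ∃ i, T.Above e (c i)

theorem IsCut.injective {n : ℕ} {c : Fin n → T.Edge} {d : T.Edge} (h : T.IsCut c d) :
    Function.Injective c := fun i j hij => h.antichain i j (hij ▸ .refl _)

theorem isCut_vertex {v : T.Vertex} {n : ℕ} {c : Fin n → T.Edge} (hc : T.Enumerates v c) :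
    T.IsCut c (T.out v) := by
  have hb : ∀ i, T.below (c i) = some v := fun i => (hc.2 _).1 ⟨i, rfl⟩
  refine ⟨fun i => above_out (hb i), fun i j h => ?_, fun e he hv => ?_⟩
  · rcases above_cases h with h | ⟨w, hw, h⟩
    · exact hc.1 h
    · rw [hb, Option.some.injEq] at hw
      subst hw
      exact absurd h (not_above_out (hb j))
  · rcases above_out_cases he with rfl | ⟨f, hf, h⟩
    · exact absurd rfl (hv v)
    · obtain ⟨i, rfl⟩ := (hc.2 f).2 hf
      exact ⟨i, h⟩

/-- Cuts can be refined. Edges in different blocks lie over incomparable inputs of `p`, so they are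
incomparable; a leaf above `d` lies over an input of `p`, and then over an input of the
corresponding `q i`. -/
theorem Operation.isCut {n : ℕ} {c : Fin n → T.Edge} {d : T.Edge} (p : T.Operation c d) :
    T.IsCut c d := by
  induction p with
  | vertex v c hc => exact isCut_vertex hc
  | one e => exact ⟨fun _ => .refl _, fun _ _ _ => Subsingleton.elim _ _, fun f hf _ => ⟨0, hf⟩⟩
  | @act m n σ c c' d h p ih =>
    refine ⟨fun i => h i ▸ ih.above _, fun i j hij => ?_, fun e he hv => ?_⟩
    · rw [h, h] at hij
      exact σ.injective (ih.antichain _ _ hij)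
    · obtain ⟨i, hi⟩ := ih.cut e he hv
      refine ⟨σ.symm i, ?_⟩
      rwa [h, σ.apply_symm_apply]
  | @comp n k c b d p q ih ih' =>
    refine ⟨fun x => ((ih' _).above _).trans (ih.above _), fun x y h => ?_, fun e he hv => ?_⟩
    · apply (blocks k).injective
      change T.Above (b (blocks k x).1 (blocks k x).2) (b (blocks k y).1 (blocks k y).2) at h
      generalize blocks k x = s at h
      generalize blocks k y = t at h
      obtain ⟨s1, s2⟩ := s
      obtain ⟨t1, t2⟩ := t
      have h1 := (ih' s1).above s2
      have h2 := h.trans ((ih' t1).above t2)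
      obtain rfl : s1 = t1 := (h1.total h2).elim (ih.antichain _ _)
        fun h => (ih.antichain _ _ h).symm
      exact congrArg (Sigma.mk s1) ((ih' s1).antichain _ _ h)
    · obtain ⟨i, hi⟩ := ih.cut e he hv
      obtain ⟨j, hj⟩ := (ih' i).cut e hi hv
      exact ⟨(blocks k).symm ⟨i, j⟩, (concat_symm b ⟨i, j⟩).symm ▸ hj⟩

theorem exists_enum_of_finite {α : Type*} (s : Set α) [Finite s] :
    ∃ (n : ℕ) (c : Fin n → α), Function.Injective c ∧ Set.range c = s := by
  obtain ⟨n, ⟨f⟩⟩ := Finite.exists_equiv_fin s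
  refine ⟨n, fun i => (f.symm i).1, fun i j h => f.symm.injective (Subtype.ext h), ?_⟩
  ext x
  exact ⟨fun ⟨i, hi⟩ => hi ▸ (f.symm i).2, fun h => ⟨f ⟨x, h⟩, by simp⟩⟩

/-- Induction from the leaves. If `d` belongs to the cut, the cut is a unit. Otherwise `d` is the
output of a vertex, each member of the cut lies above one input of it, and the members above a given
input again form a cut. -/
theorem IsCut.operation {n : ℕ} {c : Fin n → T.Edge} {d : T.Edge} (h : T.IsCut c d) :
    T.Operation c d := by
  revert n c
  refine above_induction (p := fun d => ∀ {n : ℕ} {c : Fin n → T.Edge}, T.IsCut c d →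
    T.Operation c d) ?_ d
  intro d ih n c h
  by_cases hd : ∃ i, c i = d
  · obtain ⟨i, rfl⟩ := hd
    have hi : ∀ j, j = i := fun j => h.antichain _ _ (h.above j)
    have : Unique (Fin n) := ⟨⟨i⟩, hi⟩
    exact .act (Equiv.ofUnique (Fin n) (Fin 1)) (c := fun _ => c i)
      (fun j => congrArg c (hi j)) (.one (c i))
  · obtain ⟨v, rfl⟩ : ∃ v, T.out v = d := by
      by_contra hv
      obtain ⟨i, hi⟩ := h.cut d (.refl _) fun v hv' => hv ⟨v, hv'⟩
      exact hd ⟨i, (h.above i).antisymm hi⟩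
    obtain ⟨m, a, ha⟩ := T.exists_enumerates v
    have hav := isCut_vertex ha
    have hb : ∀ i, T.below (a i) = some v := fun i => (ha.2 _).1 ⟨i, rfl⟩
    have hca : ∀ j, ∃ i, T.Above (c j) (a i) := fun j => by
      rcases above_out_cases (h.above j) with h' | ⟨f, hf, h'⟩
      · exact absurd ⟨j, h'⟩ hd
      · obtain ⟨i, rfl⟩ := (ha.2 f).2 hf
        exact ⟨i, h'⟩
    -- The part of the cut above `a i`, listed in an arbitrary order; `of_range` restores the order
    -- of `c` at the end.
    have : ∀ i, ∃ (k : ℕ) (b : Fin k → T.Edge), Function.Injective b ∧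
        Set.range b = {e | ∃ j, c j = e ∧ T.Above e (a i)} := fun i => by
      have := T.finite
      exact exists_enum_of_finite _
    choose k b hb1 hb2 using this
    have hb3 : ∀ i j, ∃ l, c l = b i j ∧ T.Above (b i j) (a i) := fun i j => by
      have : b i j ∈ {e | ∃ j, c j = e ∧ T.Above e (a i)} := hb2 i ▸ ⟨j, rfl⟩
      exact this
    have hb4 : ∀ i l, T.Above (c l) (a i) → ∃ j, b i j = c l := fun i l hl => by
      have : c l ∈ Set.range (b i) := (hb2 i).symm ▸ ⟨l, rfl, hl⟩
      exact this
    have hop : ∀ i, T.Operation (b i) (a i) := fun i => by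
      refine ih v (a i) rfl (hb i) ⟨fun j => (hb3 i j).choose_spec.2, fun j j' hj => ?_,
        fun e he hv => ?_⟩
      · obtain ⟨l, hl, _⟩ := hb3 i j
        obtain ⟨l', hl', _⟩ := hb3 i j'
        rw [← hl, ← hl'] at hj
        exact hb1 i (by rw [← hl, ← hl', h.antichain _ _ hj])
      · obtain ⟨l, hl⟩ := h.cut e (he.trans (hav.above i)) hv
        have hli : T.Above (c l) (a i) := by
          obtain ⟨i', hi'⟩ := hca l
          obtain rfl : i = i' := (he.total (hl.trans hi')).elim (hav.antichain _ _)
            fun h => (hav.antichain _ _ h).symm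
          exact hi'
        obtain ⟨j, hj⟩ := hb4 i l hli
        exact ⟨j, hj ▸ hl⟩
    have hcomp := Operation.comp (.vertex v a ha) hop
    refine hcomp.of_range hcomp.isCut.injective h.injective ?_
    ext e
    constructor
    · rintro ⟨l, rfl⟩
      obtain ⟨i, hi⟩ := hca l
      obtain ⟨j, hj⟩ := hb4 i l hi
      exact ⟨(blocks k).symm ⟨i, j⟩, (concat_symm b ⟨i, j⟩).trans hj⟩
    · rintro ⟨x, rfl⟩
      obtain ⟨l, hl, _⟩ := hb3 (blocks k x).1 (blocks k x).2
      exact ⟨l, hl⟩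

/-! ### Maps of trees and the order -/

theorem map_op (g : S ⟶ T) {n : ℕ} {c : Fin n → S.Edge} {d : S.Edge} (p : S.Operation c d) :
    T.Operation (fun i => edgeMap g (c i)) (edgeMap g d) :=
  (Operad.Hom.op g (c := c) (d := d) ⟨p⟩).down

theorem enumerates_of_below {v : T.Vertex} {e : T.Edge} (h : T.below e = some v) :
    ∃ (n : ℕ) (c : Fin n → T.Edge) (_ : T.Enumerates v c) (i : Fin n), c i = e := by
  obtain ⟨n, c, hc⟩ := T.exists_enumerates v
  exact ⟨n, c, hc, (hc.2 e).2 h⟩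

/-- An input of a vertex goes to an input of an operation, and the inputs of an operation lie above
its output. -/
theorem Above.map (g : S ⟶ T) {a b : S.Edge} (h : S.Above a b) :
    T.Above (edgeMap g a) (edgeMap g b) := by
  induction h using Relation.ReflTransGen.head_induction_on with
  | refl => exact .refl _
  | @head a a' haa' _ ih =>
    obtain ⟨v, hv, rfl⟩ := haa'
    obtain ⟨n, c, hc, i, rfl⟩ := enumerates_of_below hv
    exact ((map_op g (.vertex v c hc)).isCut.above i).trans ih

/-- Incomparable edges lie over different inputs of one vertex. The images of these inputs belong to
a cut, so edges above them stay incomparable. -/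
theorem Above.of_map {g : S ⟶ T} (hg : Function.Injective (edgeMap g)) {a b : S.Edge}
    (h : T.Above (edgeMap g a) (edgeMap g b)) : S.Above a b := by
  by_contra hab
  by_cases hba : S.Above b a
  · exact hab (hg (h.antisymm (hba.map g)) ▸ .refl _)
  · obtain ⟨v, e, f, he, hf, hef, hae, hbf⟩ := exists_meet hab hba
    obtain ⟨n, c, hc, i, rfl⟩ := enumerates_of_below he
    obtain ⟨j, rfl⟩ := (hc.2 f).2 hf
    have hcut := (map_op g (.vertex v c hc)).isCut
    refine hef (congrArg c ?_)
    exact ((hae.map g).total (h.trans (hbf.map g))).elim (hcut.antichain _ _)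
      fun h => (hcut.antichain _ _ h).symm

/-- An operation of `T` between edges of `S` is an operation of `S` if the leaves of `S` do not
prevent it. -/
theorem Operation.lift {g : S ⟶ T} (hg : Function.Injective (edgeMap g)) {n : ℕ}
    {c : Fin n → S.Edge} {d : S.Edge}
    (p : T.Operation (fun i => edgeMap g (c i)) (edgeMap g d))
    (h : ∀ e, S.Above e d → (∀ v, S.out v ≠ e) → ∃ i, T.Above (edgeMap g e) (edgeMap g (c i))) :
    S.Operation c d :=
  IsCut.operation ⟨fun i => .of_map hg (p.isCut.above i),
    fun i j hij => p.isCut.antichain i j (hij.map g), fun e he hv =>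
      (h e he hv).imp fun _ => .of_map hg⟩

theorem exists_equiv_of_range_eq {α : Type*} {m n : ℕ} {c : Fin n → α} {c' : Fin m → α}
    (hc : Function.Injective c) (hc' : Function.Injective c')
    (h : Set.range c' = Set.range c) : ∃ σ : Fin m ≃ Fin n, ∀ i, c' i = c (σ i) :=
  ⟨((Equiv.ofInjective c' hc').trans (Equiv.setCongr h)).trans (Equiv.ofInjective c hc).symm,
    fun i => (congrArg Subtype.val ((Equiv.ofInjective c hc).apply_symm_apply
      (Equiv.setCongr h (Equiv.ofInjective c' hc' i)))).symm⟩

theorem Enumerates.exists_equiv {v : T.Vertex} {m n : ℕ} {c : Fin n → T.Edge}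
    {c' : Fin m → T.Edge} (hc : T.Enumerates v c) (hc' : T.Enumerates v c') :
    ∃ σ : Fin m ≃ Fin n, ∀ i, c' i = c (σ i) :=
  exists_equiv_of_range_eq hc.1 hc'.1 (Set.ext fun e => (hc'.2 e).trans (hc.2 e).symm)

/-- A map of trees can be given by the images of the vertices, each with one enumeration of its
inputs. -/
def homMk' (f : S.Edge → T.Edge)
    (hf : ∀ v : S.Vertex, ∃ (n : ℕ) (c : Fin n → S.Edge), S.Enumerates v c ∧
      T.Operation (fun i => f (c i)) (f (S.out v))) : S ⟶ T :=
  homMk f fun v n c hc => by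
    obtain ⟨m, a, ha, p⟩ := hf v
    obtain ⟨σ, hσ⟩ := ha.exists_equiv hc
    exact .act σ (fun i => congrArg f (hσ i)) p

@[simp] theorem edgeMap_comp {R : Tree} (f : R ⟶ S) (g : S ⟶ T) (e : R.Edge) :
    edgeMap (f ≫ g) e = edgeMap g (edgeMap f e) := rfl

instance (T : Tree) : Finite T.Vertex :=
  have := T.finite
  Finite.of_injective _ T.out_injective

/-! ### The subtree spanned by an operation -/

/-- The vertex `v` lies between the edges `c` and the edge `d`. -/
def InSupport (T : Tree) {n : ℕ} (c : Fin n → T.Edge) (d : T.Edge) (v : T.Vertex) : Prop :=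
  T.Above (T.out v) d ∧ ∀ i, ¬ T.Above (T.out v) (c i)

/-- The edge `e` lies between the edges `c` and the edge `d`, inclusively. -/
def Between (T : Tree) {n : ℕ} (c : Fin n → T.Edge) (d e : T.Edge) : Prop :=
  T.Above e d ∧ ∀ i, T.Above e (c i) → e = c i

theorem InSupport.between_out {n : ℕ} {c : Fin n → T.Edge} {d : T.Edge} {v : T.Vertex}
    (h : T.InSupport c d v) : T.Between c d (T.out v) :=
  ⟨h.1, fun i hi => absurd hi (h.2 i)⟩

theorem InSupport.between_input {n : ℕ} {c : Fin n → T.Edge} {d e : T.Edge} {v : T.Vertex}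
    (h : T.InSupport c d v) (he : T.below e = some v) : T.Between c d e :=
  ⟨(above_out he).trans h.1, fun i hi => (above_cases hi).resolve_right fun ⟨w, hw, h'⟩ => by
    obtain rfl := Option.some.inj (he.symm.trans hw)
    exact h.2 i h'⟩

theorem Operation.between_output {n : ℕ} {c : Fin n → T.Edge} {d : T.Edge}
    (p : T.Operation c d) : T.Between c d d :=
  ⟨.refl _, fun i h => h.antisymm (p.isCut.above i)⟩

theorem Operation.between_input {n : ℕ} {c : Fin n → T.Edge} {d : T.Edge}
    (p : T.Operation c d) (i : Fin n) : T.Between c d (c i) :=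
  ⟨p.isCut.above i, fun j h => congrArg c (p.isCut.antichain i j h)⟩

theorem Between.inSupport {n : ℕ} {c : Fin n → T.Edge} {d e : T.Edge} {v : T.Vertex}
    (h : T.Between c d e) (he : T.below e = some v) (hd : e ≠ d) : T.InSupport c d v := by
  constructor
  · refine (above_cases h.1).elim (fun h' => absurd h' hd) fun ⟨w, hw, h'⟩ => ?_
    obtain rfl := Option.some.inj (he.symm.trans hw)
    exact h'
  · intro i hi
    have := h.2 i ((above_out he).trans hi)
    exact not_above_out he (this ▸ hi)

open Classical in
/-- The subtree of `T` spanned by an operation. -/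
noncomputable def spanned (T : Tree) {n : ℕ} {c : Fin n → T.Edge} {d : T.Edge}
    (p : T.Operation c d) : Tree where
  Edge := {e : T.Edge // T.Between c d e}
  Vertex := {v : T.Vertex // T.InSupport c d v}
  finite := by
    have := T.finite
    infer_instance
  root := ⟨d, p.between_output⟩
  out v := ⟨T.out v.1, v.2.between_out⟩
  out_injective v w h := Subtype.ext (T.out_injective (congrArg Subtype.val h))
  below e := (T.below e.1).bind fun v => if h : T.InSupport c d v then some ⟨v, h⟩ else none
  below_eq_none := by
    rintro ⟨e, he⟩
    rw [Subtype.mk.injEq]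
    constructor
    · intro h
      by_contra hd
      cases hb : T.below e with
      | none =>
        rw [T.below_eq_none] at hb
        subst hb
        exact hd ((above_root d).antisymm he.1).symm
      | some v => simp [hb, he.inSupport hb hd] at h
    · rintro rfl
      cases hb : T.below e with
      | none => simp
      | some v =>
        have : ¬ T.InSupport c e v := fun h => not_above_out hb h.1
        simp [this]
  path := by
    rintro ⟨e, he⟩
    have := T.path e
    induction this using Relation.ReflTransGen.head_induction_on with
    | refl =>
      obtain rfl := (above_root d).antisymm he.1
      exact .refl
    | @head a a' haa' _ ih =>
      obtain ⟨v, hv, rfl⟩ := haa'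
      by_cases hd : a = d
      · subst hd
        exact .refl
      · have hs := he.inSupport hv hd
        refine .head ⟨⟨v, hs⟩, ?_, rfl⟩ (ih hs.between_out)
        simp [hv, hs]

section

variable {n : ℕ} {c : Fin n → T.Edge} {d : T.Edge} (p : T.Operation c d)

theorem spanned_below (e : (T.spanned p).Edge) (v : (T.spanned p).Vertex) :
    (T.spanned p).below e = some v ↔ T.below e.1 = some v.1 := by
  classical
  change ((T.below e.1).bind fun v => if h : T.InSupport c d v then
    some (⟨v, h⟩ : {v : T.Vertex // T.InSupport c d v}) else none) = some v ↔ _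
  obtain ⟨v, hv⟩ := v
  cases T.below e.1 with
  | none => simp
  | some w =>
    by_cases hw : T.InSupport c d w
    · simp only [Option.bind_some, hw, dite_true, Option.some.injEq w v]
      exact ⟨fun h => congrArg Subtype.val (Option.some.inj h),
        fun h => congrArg some (Subtype.ext h)⟩
    · have : w ≠ v := fun h => hw (h ▸ hv)
      simp [hw, this]

theorem spanned_enumerates {v : T.Vertex} (hv : T.InSupport c d v) {m : ℕ} {a : Fin m → T.Edge}
    (ha : T.Enumerates v a) :
    (T.spanned p).Enumerates ⟨v, hv⟩ fun i =>
      ⟨a i, hv.between_input ((ha.2 _).1 ⟨i, rfl⟩)⟩ := by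
  refine ⟨fun i j h => ha.1 (congrArg Subtype.val h), fun e => ?_⟩
  refine Iff.trans ?_ ((ha.2 e.1).trans (spanned_below p e ⟨v, hv⟩).symm)
  exact ⟨fun ⟨i, hi⟩ => ⟨i, congrArg Subtype.val hi⟩, fun ⟨i, hi⟩ => ⟨i, Subtype.ext hi⟩⟩

/-- The inclusion of the subtree spanned by an operation. -/
noncomputable def spannedHom : T.spanned p ⟶ T :=
  homMk' Subtype.val fun ⟨v, hv⟩ => by
    obtain ⟨m, a, ha⟩ := T.exists_enumerates v
    exact ⟨m, _, spanned_enumerates p hv ha, .vertex v a ha⟩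

theorem spannedHom_injective : Function.Injective (edgeMap (spannedHom p)) :=
  Subtype.val_injective

/-- The operation, seen in the subtree that it spans. -/
theorem spannedOp : (T.spanned p).Operation
    (fun i => (⟨c i, p.between_input i⟩ : (T.spanned p).Edge)) ⟨d, p.between_output⟩ := by
  refine Operation.lift (spannedHom_injective p) p fun e he hl => ?_
  have hed : T.Above e.1 d := he.map (spannedHom p)
  -- A leaf of the subtree is either a leaf of `T`, where the cut property applies, or the output of
  -- a vertex outside the support, and then it lies above some `c i`.
  by_cases h : ∃ v, T.out v = e.1
  · obtain ⟨v, hv⟩ := h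
    by_contra hc
    refine hl ⟨v, ?_, fun i hi => hc ⟨i, ?_⟩⟩ (Subtype.ext hv)
    · rwa [hv]
    · exact (hv ▸ hi :)
  · exact p.isCut.cut e.1 hed fun v hv => h ⟨v, hv⟩

end

theorem above_out_of_enumerates {v : T.Vertex} {m : ℕ} {a : Fin m → T.Edge}
    (ha : T.Enumerates v a) {e : T.Edge} (h : T.Above e (T.out v)) :
    e = T.out v ∨ ∃ i, T.Above e (a i) := by
  rcases above_out_cases h with h | ⟨f, hf, h⟩
  · exact .inl h
  · obtain ⟨i, rfl⟩ := (ha.2 f).2 hf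
    exact .inr ⟨i, h⟩

section

variable {g : S ⟶ T} (hg : Function.Injective (edgeMap g)) {n : ℕ} {c : Fin n → S.Edge}
  {d : S.Edge} (p : S.Operation c d)

include hg in
theorem Between.map {e : S.Edge} (h : S.Between c d e) :
    T.Between (fun i => edgeMap g (c i)) (edgeMap g d) (edgeMap g e) :=
  ⟨h.1.map g, fun i hi => congrArg _ (h.2 i (.of_map hg hi))⟩

include hg in
/-- The image of a vertex in the subtree spanned by the image of an operation. -/
theorem InSupport.map_op {v : S.Vertex} (hv : S.InSupport c d v) {m : ℕ} {a : Fin m → S.Edge}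
    (ha : S.Enumerates v a) :
    (T.spanned (Tree.map_op g p)).Operation
      (fun i => (⟨edgeMap g (a i), (hv.between_input ((ha.2 _).1 ⟨i, rfl⟩)).map hg⟩ :
        (T.spanned (Tree.map_op g p)).Edge))
      ⟨edgeMap g (S.out v), hv.between_out.map hg⟩ := by
  refine Operation.lift (spannedHom_injective _) (Tree.map_op g (.vertex v a ha))
    fun e he hl => ?_
  have hed : T.Above e.1 (edgeMap g (S.out v)) := he.map (spannedHom _)
  by_cases h : ∃ w, T.out w = e.1
  · obtain ⟨w, hw⟩ := h
    obtain ⟨i, hi⟩ : ∃ i, T.Above e.1 (edgeMap g (c i)) := by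
      by_contra hc
      refine hl ⟨w, ?_, fun i hi => hc ⟨i, ?_⟩⟩ (Subtype.ext hw)
      · exact hw ▸ e.2.1
      · exact (hw ▸ hi :)
    -- Both `S.out v` and `c i` have images below `e`, so these are comparable. As `v` is in the
    -- support, `c i` must lie strictly above `S.out v`, hence above an input of `v`.
    rcases hed.total hi with h | h
    · exact absurd (.of_map hg h) (hv.2 i)
    · rcases above_out_of_enumerates ha (.of_map hg h) with h' | ⟨j, hj⟩
      · exact absurd (h' ▸ .refl _) (hv.2 i)
      · exact ⟨j, hi.trans (hj.map g)⟩
  · exact (Tree.map_op g (.vertex v a ha)).isCut.cut e.1 hed fun v hv => h ⟨v, hv⟩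

/-- The map between the subtrees spanned by an operation and by its image. -/
noncomputable def spannedMap : S.spanned p ⟶ T.spanned (map_op g p) :=
  homMk' (fun e => ⟨edgeMap g e.1, e.2.map hg⟩) fun ⟨v, hv⟩ => by
    obtain ⟨m, a, ha⟩ := S.exists_enumerates v
    exact ⟨m, _, spanned_enumerates p hv ha, hv.map_op hg p ha⟩

end

/-! ### Proper operations -/

/-- An operation is proper if it does not involve all vertices. -/
def IsProper (T : Tree) {n : ℕ} (c : Fin n → T.Edge) (d : T.Edge) : Prop :=
  ∃ v, ¬ T.InSupport c d v

theorem card_spanned_lt {n : ℕ} {c : Fin n → T.Edge} {d : T.Edge} (p : T.Operation c d)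
    (h : T.IsProper c d) : Nat.card (T.spanned p).Vertex < Nat.card T.Vertex := by
  obtain ⟨v, hv⟩ := h
  exact Finite.card_subtype_lt hv

/-- The image of a vertex is proper under a map that hits an inner edge. -/
theorem isProper_map_vertex {g : S ⟶ T} (hg : Function.Injective (edgeMap g)) {e : S.Edge}
    (he : T.IsInner (edgeMap g e)) {v : S.Vertex} {m : ℕ} {a : Fin m → S.Edge}
    (ha : S.Enumerates v a) :
    T.IsProper (fun i => edgeMap g (a i)) (edgeMap g (S.out v)) := by
  by_contra hp
  simp only [IsProper, not_exists, not_not] at hp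
  -- If no vertex were missed, the vertex `w` on top of the inner edge would force `e = S.out v`;
  -- but then the vertex `x` below that edge is missed.
  obtain ⟨w, hw⟩ := he.2
  obtain ⟨h1, h2⟩ := hp w
  rw [hw] at h1 h2
  rcases above_out_of_enumerates ha (.of_map hg h1) with rfl | ⟨i, hi⟩
  · obtain ⟨x, hx⟩ := Option.ne_none_iff_exists'.1 fun h => he.1 ((T.below_eq_none _).1 h)
    exact not_above_out hx (hp x).1
  · exact h2 i (hi.map g)

/-! ### Lifting operations to faces -/

theorem innerFaceHom_injective (e : T.Edge) (he : T.IsInner e) :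
    Function.Injective (edgeMap (T.innerFaceHom e he)) := Subtype.val_injective

theorem outerFaceHom_injective (v : T.Vertex) (hv : T.IsOuter v) :
    Function.Injective (edgeMap (T.outerFaceHom v hv)) := Subtype.val_injective

/-- A contraction creates no leaves: an edge other than `e` keeps the vertex of which it is the
output. -/
theorem Operation.lift_innerFace {e : T.Edge} (he : T.IsInner e) {n : ℕ}
    {c : Fin n → (T.innerFace e he).Edge} {d : (T.innerFace e he).Edge}
    (p : T.Operation (fun i => edgeMap (T.innerFaceHom e he) (c i))
      (edgeMap (T.innerFaceHom e he) d)) : (T.innerFace e he).Operation c d := by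
  refine .lift (innerFaceHom_injective e he) p fun x hx hl => ?_
  refine p.isCut.cut _ (hx.map (T.innerFaceHom e he)) fun v hv => ?_
  exact hl ⟨v, fun h => x.2 (hv.symm.trans h)⟩ (Subtype.ext hv)

/-- The only possible new leaf of `T/v` is `T.out v`. If it lies above the output of an operation
that misses `v`, it lies above one of the inputs. -/
theorem Operation.lift_outerFace {v : T.Vertex} (hv : T.IsOuter v) {n : ℕ}
    {c : Fin n → (T.outerFace v hv).Edge} {d : (T.outerFace v hv).Edge}
    (p : T.Operation (fun i => edgeMap (T.outerFaceHom v hv) (c i))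
      (edgeMap (T.outerFaceHom v hv) d))
    (h : ¬ T.InSupport (fun i => edgeMap (T.outerFaceHom v hv) (c i))
      (edgeMap (T.outerFaceHom v hv) d) v) : (T.outerFace v hv).Operation c d := by
  refine .lift (outerFaceHom_injective v hv) p fun x hx hl => ?_
  have hxd := hx.map (T.outerFaceHom v hv)
  by_cases hxv : T.out v = x.1
  · by_contra hc
    refine h ⟨hxv ▸ hxd, fun i hi => hc ⟨i, ?_⟩⟩
    rw [hxv] at hi
    exact hi
  · refine p.isCut.cut _ hxd fun w hw => ?_
    exact hl ⟨w, fun h => hxv (h ▸ hw)⟩ (Subtype.ext hw)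

/-- The missed vertex is `v`. Either its output survives as a leaf of `T/v` and is caught by an
input, or `v` is the lowest vertex of `T` and lies below all of `T/v`. -/
theorem isProper_outerFace {v : T.Vertex} (hv : T.IsOuter v) {n : ℕ}
    {c : Fin n → (T.outerFace v hv).Edge} {d : (T.outerFace v hv).Edge}
    (p : (T.outerFace v hv).Operation c d) :
    T.IsProper (fun i => edgeMap (T.outerFaceHom v hv) (c i))
      (edgeMap (T.outerFaceHom v hv) d) := by
  refine ⟨v, fun ⟨h1, h2⟩ => ?_⟩
  by_cases hr : T.Remains v (T.out v)
  · obtain ⟨i, hi⟩ := p.isCut.cut ⟨T.out v, hr⟩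
      (.of_map (outerFaceHom_injective v hv) h1)
      fun w hw => w.2 (T.out_injective (congrArg Subtype.val hw))
    exact h2 i (hi.map (T.outerFaceHom v hv))
  · have hroot : T.out v = T.root := by
      by_contra h
      exact hr fun _ => ⟨h, v, rfl⟩
    rw [hroot] at h1
    exact not_remains_root hroot ((above_root _).antisymm h1 ▸ d.2)

/-- Supplies a topmost vertex with a given property; without one, it would be possible to climb
forever in a finite tree. -/
theorem exists_maximal {p : T.Vertex → Prop} (h : ∃ v, p v) :
    ∃ v, p v ∧ ∀ w, p w → T.below (T.out w) ≠ some v := by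
  by_contra! hc
  have : ∀ d, ∀ v, p v → T.out v ≠ d := fun d => by
    refine above_induction (T := T) (p := fun d => ∀ v, p v → T.out v ≠ d) ?_ d
    rintro d ih v hv rfl
    obtain ⟨w, hw, hwv⟩ := hc v hv
    exact ih v (T.out w) rfl hwv w hw rfl
  obtain ⟨v, hv⟩ := h
  exact this _ v hv rfl

theorem eq_of_above_of_below {v : T.Vertex} {e f : T.Edge} (he : T.below e = some v)
    (hf : T.below f = some v) (h : T.Above e f) : e = f :=
  (above_cases h).resolve_right fun ⟨w, hw, h'⟩ => by
    obtain rfl := Option.some.inj (he.symm.trans hw)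
    exact not_above_out hf h'

theorem ne_root_of_below {e : T.Edge} {v : T.Vertex} (h : T.below e = some v) :
    e ≠ T.root := fun h' => by
  rw [h', below_root] at h
  cases h

/-- A proper operation avoids an outer vertex. -/
theorem exists_outer_of_isProper {e : T.Edge} (he : T.IsInner e) {n : ℕ} {c : Fin n → T.Edge}
    {d : T.Edge} (p : T.Operation c d) (h : T.IsProper c d) :
    ∃ v, T.IsOuter v ∧ ¬ T.InSupport c d v ∧ T.Remains v d ∧ ∀ i, T.Remains v (c i) := by
  -- First case: a vertex is missed above an input or beside the output. This property passes to
  -- vertices further up, so a topmost such vertex has only leaves as inputs and is outer.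
  by_cases hA : ∃ v, (∃ i, T.Above (T.out v) (c i)) ∨
      (¬ T.Above (T.out v) d ∧ ¬ T.Above d (T.out v))
  · obtain ⟨v, hv, hmax⟩ := exists_maximal hA
    have hleaf : ∀ x, T.below x = some v → ∀ w, T.out w ≠ x := by
      rintro x hx w rfl
      refine hmax w ?_ hx
      rcases hv with ⟨i, hi⟩ | ⟨h1, h2⟩
      · exact .inl ⟨i, (above_out hx).trans hi⟩
      · exact .inr ⟨fun h => ((above_out hx).total h).elim h1 h2,
          fun h => h2 (h.trans (above_out hx))⟩
    -- Otherwise all inputs of the lowest vertex would be leaves, and `T` would have no inner edge.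
    have hroot : T.out v ≠ T.root := by
      intro hr
      obtain ⟨w, hw⟩ := he.2
      rcases above_out_cases (hr ▸ above_root e : T.Above e (T.out v)) with h' | ⟨f, hf, hef⟩
      · exact he.1 (h'.trans hr)
      · rcases Relation.ReflTransGen.cases_tail hef with h' | ⟨_, _, x, _, hx⟩
        · exact hleaf f hf w (hw.trans h'.symm)
        · exact hleaf f hf x hx
    have hd : T.below d ≠ some v := by
      intro hd
      rcases hv with ⟨i, hi⟩ | ⟨_, h2⟩
      · exact not_above_out hd (hi.trans (p.isCut.above i))
      · exact h2 (above_out hd)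
    have hc : ∀ j, T.below (c j) ≠ some v := by
      intro j hj
      rcases hv with ⟨i, hi⟩ | ⟨h1, h2⟩
      · obtain rfl := p.isCut.antichain _ _ ((above_out hj).trans hi)
        exact not_above_out hj hi
      · exact ((above_out hj).total (p.isCut.above j)).elim h1 h2
    have hinner : T.IsInner (T.out v) := ⟨hroot, v, rfl⟩
    refine ⟨v, ⟨T.out v, ⟨hinner, .inl rfl⟩, ?_⟩, ?_, ?_, ?_⟩
    · rintro x ⟨⟨_, w, hw⟩, h | h⟩
      · exact h.symm
      · exact absurd hw (hleaf x h w)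
    · rintro ⟨h1, h2⟩
      rcases hv with ⟨i, hi⟩ | ⟨h3, _⟩
      · exact h2 i hi
      · exact h3 h1
    · rintro (h | h)
      · exact h ▸ hinner
      · exact absurd h hd
    · rintro i (h | h)
      · exact h ▸ hinner
      · exact absurd h (hc i)
  -- Second case: every missed vertex lies below `d`, and all vertices are comparable with `d`. The
  -- lowest vertex `r` is then outer, its one inner edge being the input `a` that leads to `d`.
  · push Not at hA
    obtain ⟨v₀, hv₀⟩ := h
    have hdv₀ : T.Above d (T.out v₀) := by
      by_contra h
      exact hv₀ ⟨by_contra fun h' => h ((hA v₀).2 h'), (hA v₀).1⟩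
    have hd : d ≠ T.root := by
      rintro rfl
      exact hv₀ ⟨(above_root _).antisymm hdv₀ ▸ .refl _, (hA v₀).1⟩
    obtain ⟨r, hr⟩ : ∃ r, T.out r = T.root := by
      rcases Relation.ReflTransGen.cases_tail (above_root d) with h | ⟨_, _, r, _, hr⟩
      · exact absurd h.symm hd
      · exact ⟨r, hr⟩
    obtain ⟨a, ha, hda⟩ : ∃ a, T.below a = some r ∧ T.Above d a :=
      (above_out_cases (hr ▸ above_root d : T.Above d (T.out r))).resolve_left
        fun h => hd (h.trans hr)
    have hcomp : ∀ w, T.Above (T.out w) a ∨ T.Above a (T.out w) := fun w => by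
      by_cases h : T.Above (T.out w) d
      · exact .inl (h.trans hda)
      · exact ((hA w).2 h).total hda
    have hinner : T.IsInner a := by
      refine ⟨ne_root_of_below ha, ?_⟩
      obtain ⟨w, hw⟩ := he.2
      rcases hcomp w with h | h
      · rcases Relation.ReflTransGen.cases_tail h with h | ⟨_, _, x, _, hx⟩
        · exact ⟨w, h.symm⟩
        · exact ⟨x, hx⟩
      · rcases above_cases h with h | ⟨x, hx, h⟩
        · exact ⟨w, h.symm⟩
        · obtain rfl := Option.some.inj (ha.symm.trans hx)
          rw [hw, hr] at h
          exact absurd ((above_root e).antisymm h) he.1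
    have hx : ∀ x, T.Above x d → T.Remains r x := by
      rintro x hxd (h | h)
      · rw [← h, hr] at hxd
        exact absurd ((above_root d).antisymm hxd) hd
      · exact eq_of_above_of_below h ha (hxd.trans hda) ▸ hinner
    refine ⟨r, ⟨a, ⟨hinner, .inr ha⟩, ?_⟩, ?_, hx d (.refl _), fun i => hx _ (p.isCut.above i)⟩
    · rintro x ⟨⟨hx, w, rfl⟩, h | h⟩
      · exact absurd (h.symm.trans hr) hx
      · exact (hcomp w).elim (eq_of_above_of_below h ha)
          fun h' => (eq_of_above_of_below ha h h').symm
    · rintro ⟨h, _⟩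
      rw [hr] at h
      exact hd ((above_root d).antisymm h)

/-- A proper operation lifts to an outer face. -/
theorem exists_lift_outerFace {e : T.Edge} (he : T.IsInner e) {n : ℕ} {c : Fin n → T.Edge}
    {d : T.Edge} (p : T.Operation c d) (h : T.IsProper c d) :
    ∃ (v : T.Vertex) (hv : T.IsOuter v) (c' : Fin n → (T.outerFace v hv).Edge)
      (d' : (T.outerFace v hv).Edge), (T.outerFace v hv).Operation c' d' ∧
      (fun i => edgeMap (T.outerFaceHom v hv) (c' i)) = c ∧
      edgeMap (T.outerFaceHom v hv) d' = d := by
  obtain ⟨v, hv, h1, h2, h3⟩ := exists_outer_of_isProper he p h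
  exact ⟨v, hv, fun i => ⟨c i, h3 i⟩, ⟨d, h2⟩, .lift_outerFace hv p h1, rfl, rfl⟩

/-- A unit involves no vertex at all; the inner edge guarantees that there is a vertex to miss. -/
theorem isProper_one {e : T.Edge} (he : T.IsInner e) (d : T.Edge) :
    T.IsProper (fun _ : Fin 1 => d) d := by
  obtain ⟨v, _⟩ := he.2
  exact ⟨v, fun h => h.2 0 h.1⟩

theorem isProper_vertex {e : T.Edge} (he : T.IsInner e) {v : T.Vertex} {n : ℕ}
    {c : Fin n → T.Edge} (hc : T.Enumerates v c) : T.IsProper c (T.out v) :=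
  isProper_map_vertex (g := 𝟙 T) (fun _ _ h => h) he hc

/-! ### Faces of trees with an inner edge -/

section

variable {e : T.Edge} (he : T.IsInner e)

-- The vertices on the two sides of an inner edge are different. This rules out the faces given by
-- single edges in all that follows.
include he in
theorem not_existsUnique_vertex : ¬ ∃! _v : T.Vertex, True := by
  rintro ⟨v, _, hv⟩
  obtain ⟨w, hw⟩ := he.2
  obtain ⟨x, hx⟩ := Option.ne_none_iff_exists'.1 fun h => he.1 ((T.below_eq_none _).1 h)
  rw [hv w trivial, ← hv x trivial] at hw
  exact T.below_out_ne x (hw ▸ hx)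

include he in
theorem Face.map_injective (F : T.Face) : Function.Injective (edgeMap F.map) := by
  cases F with
  | inner e he => exact innerFaceHom_injective e he
  | outer v hv => exact outerFaceHom_injective v hv
  | edge _ hT => exact absurd hT (not_existsUnique_vertex he)

/-- Deleting an outer vertex keeps all inner edges, so only the contraction of `e` loses `e`. By
`isProper_map_vertex`, the vertices of all other faces become proper operations. -/
theorem Face.exists_edge {F : T.Face} (hF : F ≠ .inner e he) :
    ∃ e' : F.source.Edge, edgeMap F.map e' = e := by
  cases F with
  | inner e' he' =>
    refine ⟨⟨e, ?_⟩, rfl⟩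
    rintro rfl
    exact hF rfl
  | outer v hv => exact ⟨⟨e, fun _ => he⟩, rfl⟩
  | edge _ hT => exact absurd hT (not_existsUnique_vertex he)

include he in
theorem Face.card_vertex_lt (F : T.Face) : Nat.card F.source.Vertex < Nat.card T.Vertex := by
  cases F with
  | inner e he =>
    obtain ⟨v, hv⟩ := he.2
    exact Finite.card_subtype_lt (p := fun w => T.out w ≠ e) (x := v) (by simpa using hv)
  | outer v hv => exact Finite.card_subtype_lt (p := fun w => w ≠ v) (x := v) (by simp)
  | edge _ hT => exact absurd hT (not_existsUnique_vertex he)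

end

/-- An operation that lifts to two different inner faces lifts to a common face of these. -/
theorem exists_common_innerFace {e₁ e₂ : T.Edge} (h₁ : T.IsInner e₁) (h₂ : T.IsInner e₂)
    (hne : e₂ ≠ e₁) {n : ℕ} {c₁ : Fin n → (T.innerFace e₁ h₁).Edge}
    {d₁ : (T.innerFace e₁ h₁).Edge} {c₂ : Fin n → (T.innerFace e₂ h₂).Edge}
    {d₂ : (T.innerFace e₂ h₂).Edge} (p : (T.innerFace e₁ h₁).Operation c₁ d₁)
    (hc : ∀ i, (c₁ i).1 = (c₂ i).1) (hd : d₁.1 = d₂.1) :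
    ∃ (D : Tree) (a : D ⟶ T.innerFace e₁ h₁) (b : D ⟶ T.innerFace e₂ h₂),
      a ≫ T.innerFaceHom e₁ h₁ = b ≫ T.innerFaceHom e₂ h₂ ∧
      Function.Injective (edgeMap (a ≫ T.innerFaceHom e₁ h₁)) ∧
      (∀ e, e ≠ e₁ → e ≠ e₂ → ∃ e', edgeMap (a ≫ T.innerFaceHom e₁ h₁) e' = e) ∧
      ∃ (c : Fin n → D.Edge) (d : D.Edge), D.Operation c d ∧ (∀ i, edgeMap a (c i) = c₁ i) ∧
        edgeMap a d = d₁ ∧ (∀ i, edgeMap b (c i) = c₂ i) ∧ edgeMap b d = d₂ := by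
  have h : (T.innerFace e₁ h₁).IsInner ⟨e₂, hne⟩ := by
    obtain ⟨w, hw⟩ := h₂.2
    exact ⟨fun h => h₂.1 (congrArg Subtype.val h), ⟨w, hw ▸ hne⟩, Subtype.ext hw⟩
  have hval : ∀ x : ((T.innerFace e₁ h₁).innerFace _ h).Edge, x.1.1 ≠ e₂ :=
    fun x hx => x.2 (Subtype.ext hx)
  -- `D` is the double contraction `(T/e₁)/e₂`. Its map to `T/e₂` forgets down to `T` and lifts
  -- back, which `lift_innerFace` permits without further conditions.
  refine ⟨_, innerFaceHom _ _ h, homMk' (fun x => ⟨x.1.1, hval x⟩) fun v => ?_,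
    hom_ext fun _ => rfl, (innerFaceHom_injective _ _).comp (innerFaceHom_injective _ _),
    fun e he he' => ⟨⟨⟨e, he⟩, fun h => he' (congrArg Subtype.val h)⟩, rfl⟩,
    fun i => ⟨c₁ i, fun h => (c₂ i).2 ((hc i).symm.trans (congrArg Subtype.val h))⟩,
    ⟨d₁, fun h => d₂.2 (hd.symm.trans (congrArg Subtype.val h))⟩,
    .lift_innerFace h p, fun _ => rfl, rfl, fun i => Subtype.ext (hc i), Subtype.ext hd⟩
  obtain ⟨m, a, ha⟩ := Tree.exists_enumerates _ v
  exact ⟨m, a, ha, .lift_innerFace h₂ (map_op (innerFaceHom _ _ h ≫ T.innerFaceHom e₁ h₁)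
    (.vertex v a ha))⟩

/-! ### Trees without inner edges -/

/-- Every vertex must have the root as its output, and `out` is injective. -/
theorem subsingleton_vertex (h : ∀ e, ¬ T.IsInner e) : Subsingleton T.Vertex := by
  have : ∀ v, T.out v = T.root := fun v => by_contra fun hv => h _ ⟨hv, v, rfl⟩
  exact ⟨fun v w => T.out_injective ((this v).trans (this w).symm)⟩

/-- A tree without vertices is trivial. -/
theorem exists_inv_edgeHom (h : IsEmpty T.Vertex) :
    ∃ g : T ⟶ eta, g ≫ edgeHom T.root = 𝟙 T ∧ edgeHom T.root ≫ g = 𝟙 eta := by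
  refine ⟨homMk (fun _ => show eta.Edge from ()) fun v => h.elim v, hom_ext fun e => ?_,
    hom_ext fun e => rfl⟩
  exact ((above_cases (above_root e)).resolve_right fun ⟨v, _⟩ => h.elim v).symm

/-- A tree with only one vertex is a corolla. -/
theorem exists_inv_opHom {v : T.Vertex} (h : ∀ w, w = v) {n : ℕ} {c : Fin n → T.Edge}
    (hc : T.Enumerates v c) :
    ∃ g : T ⟶ corolla n, g ≫ opHom (.vertex v c hc) = 𝟙 T ∧
      opHom (.vertex v c hc) ≫ g = 𝟙 (corolla n) := by
  have hinj : Function.Injective (edgeMap (opHom (.vertex v c hc))) := by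
    have hne : ∀ i, c i ≠ T.out v := fun i h =>
      T.below_out_ne v (h ▸ (hc.2 _).1 ⟨i, rfl⟩)
    rintro (_ | i) (_ | j) hij
    · rfl
    · exact absurd hij.symm (hne j)
    · exact absurd hij (hne i)
    · exact congrArg some (hc.1 hij)
  have hsurj : Function.Surjective (edgeMap (opHom (.vertex v c hc))) := by
    intro e
    cases hb : T.below e with
    | none =>
      have hroot : T.root = T.out v := by
        by_contra h'
        rcases Relation.ReflTransGen.cases_tail (above_root (T.out v)) with h'' | ⟨_, _, w, _, hw⟩
        · exact h' h''
        · exact h' (hw.symm.trans (congrArg T.out (h w)))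
      exact ⟨none, ((T.below_eq_none e).1 hb).symm ▸ hroot.symm⟩
    | some w =>
      obtain ⟨i, rfl⟩ := (hc.2 e).2 (h w ▸ hb)
      exact ⟨some i, rfl⟩
  let f := (Equiv.ofBijective _ ⟨hinj, hsurj⟩).symm
  have hf : ∀ x, f (edgeMap (opHom (.vertex v c hc)) x) = x :=
    (Equiv.ofBijective _ ⟨hinj, hsurj⟩).symm_apply_apply
  refine ⟨homMk' f fun w => ?_, hom_ext (Equiv.ofBijective _ ⟨hinj, hsurj⟩).apply_symm_apply,
    hom_ext hf⟩
  obtain rfl := h w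
  refine ⟨n, c, hc, ?_⟩
  have h1 : (fun i => f (c i)) = some := funext fun i => hf (some i)
  have h2 : f (T.out w) = none := hf none
  rw [h1, h2]
  exact corollaOp n

end Tree

open Dendroidal.Tree

theorem DSet.map_comp_apply (X : DSet.{u}) {R S T : Tree} (f : R ⟶ S) (g : S ⟶ T) (x : X.obj (op T)) :
    X.map f.op (X.map g.op x) = X.map (f ≫ g).op x := by
  rw [op_comp, Functor.map_comp]
  rfl

theorem DSet.map_id_apply (X : DSet.{u}) {T : Tree} (x : X.obj (op T)) : X.map (𝟙 T).op x = x := by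
  rw [op_id, CategoryTheory.Functor.map_id]
  rfl

/-! ### Strict inner Kan complexes in terms of dendrices -/

section

variable {X : DSet.{u}} {T : Tree} {e : T.Edge} {he : T.IsInner e}

theorem mem_innerHorn {S : Tree} (g : (T.representable : DSet.{u}).obj (op S)) :
    g ∈ (T.innerHorn e he : Subfunctor (T.representable : DSet.{u})).obj (op S) ↔
      ∃ (F : T.Face) (_ : F ≠ .inner e he) (a : S ⟶ F.source), a ≫ F.map = g.down := by
  rw [innerHorn, Subfunctor.iSup_obj]
  simp only [Set.mem_iUnion]
  constructor
  · rintro ⟨⟨F, hF⟩, a, rfl⟩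
    exact ⟨F, hF, a.down, rfl⟩
  · rintro ⟨F, hF, a, h⟩
    exact ⟨⟨F, hF⟩, ⟨a⟩, ULift.ext _ _ h⟩

/-- A compatible family of dendrices on the faces of an inner horn. -/
structure HornFamily (X : DSet.{u}) (T : Tree) (e : T.Edge) (he : T.IsInner e) where
  /-- the dendrices -/
  val : ∀ F : T.Face, F ≠ .inner e he → X.obj (op F.source)
  compat : ∀ (F F' : T.Face) (hF : F ≠ .inner e he) (hF' : F' ≠ .inner e he) {R : Tree}
    (a : R ⟶ F.source) (b : R ⟶ F'.source), a ≫ F.map = b ≫ F'.map →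
    X.map a.op (val F hF) = X.map b.op (val F' hF')

/-- The dendrex `x` fills the horn. -/
def HornFamily.Fills (y : HornFamily X T e he) (x : X.obj (op T)) : Prop :=
  ∀ F hF, X.map F.map.op x = y.val F hF

/-- The map on the horn given by a compatible family. -/
noncomputable def HornFamily.hom (y : HornFamily X T e he) :
    (T.innerHorn e he).toFunctor ⟶ X where
  -- An element of the horn factors through some face; `compat` makes the choice of the
  -- factorisation irrelevant.
  app U := ↾fun g =>
    X.map ((mem_innerHorn g.1).1 g.2).choose_spec.choose_spec.choose.op
      (y.val ((mem_innerHorn g.1).1 g.2).choose ((mem_innerHorn g.1).1 g.2).choose_spec.choose)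
  naturality U V f := by
    ext g
    obtain ⟨g, hg⟩ := g
    refine Eq.trans (y.compat _ _ _ ((mem_innerHorn g).1 hg).choose_spec.choose _
      (f.unop ≫ ((mem_innerHorn g).1 hg).choose_spec.choose_spec.choose) ?_) ?_
    · rw [Category.assoc, ((mem_innerHorn g).1 hg).choose_spec.choose_spec.choose_spec]
      exact ((mem_innerHorn _).1
        ((T.innerHorn e he).toFunctor.map f ⟨g, hg⟩).2).choose_spec.choose_spec.choose_spec
    · rw [op_comp, Functor.map_comp]
      rfl

theorem HornFamily.hom_app (y : HornFamily X T e he) {S : Tree}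
    (g : (T.innerHorn e he).toFunctor.obj (op S)) (F : T.Face) (hF : F ≠ .inner e he)
    (a : S ⟶ F.source) (h : a ≫ F.map = g.1.down) :
    y.hom.app (op S) g = X.map a.op (y.val F hF) :=
  y.compat _ _ _ _ _ _
    (((mem_innerHorn g.1).1 g.2).choose_spec.choose_spec.choose_spec.trans h.symm)

/-- The generator of the horn given by a face. -/
noncomputable def hornFace (F : T.Face) (hF : F ≠ .inner e he) :
    (T.innerHorn e he : Subfunctor (T.representable : DSet.{u})).toFunctor.obj (op F.source) :=
  ⟨⟨F.map⟩, (mem_innerHorn _).2 ⟨F, hF, 𝟙 _, Category.id_comp _⟩⟩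

/-- The compatible family given by a map on the horn. -/
noncomputable def HornFamily.ofHom (f : (T.innerHorn e he).toFunctor ⟶ X) :
    HornFamily X T e he where
  val F hF := f.app _ (hornFace F hF)
  compat F F' hF hF' R a b h := by
    rw [← f.naturality_apply, ← f.naturality_apply]
    exact congrArg (f.app (op R)) (Subtype.ext (ULift.ext _ _ h))

theorem HornFamily.fills_iff (y : HornFamily X T e he) (x : T.representable ⟶ X) :
    y.Fills (uliftYonedaEquiv x) ↔ (T.innerHorn e he).ι ≫ x = y.hom := by
  have key : ∀ {S : Tree} (g : S ⟶ T), X.map g.op (uliftYonedaEquiv x) = x.app (op S) ⟨g⟩ := by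
    intro S g
    rw [uliftYonedaEquiv_naturality, uliftYonedaEquiv_comp, uliftYonedaEquiv_uliftYoneda_map]
    rfl
  constructor
  · intro h
    ext U g
    obtain ⟨F, hF, a, ha⟩ := (mem_innerHorn g.1).1 g.2
    refine Eq.trans ?_ (y.hom_app g F hF a ha).symm
    rw [← h F hF, X.map_comp_apply, key]
    exact congrArg (x.app U) (ULift.ext _ _ ha.symm)
  · intro h F hF
    rw [key]
    have := congrArg (fun z => z.app _ (hornFace F hF)) h
    refine this.trans ((y.hom_app (hornFace F hF) F hF (𝟙 _) (Category.id_comp _)).trans ?_)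
    simp

theorem HornFamily.hom_ofHom (f : (T.innerHorn e he).toFunctor ⟶ X) :
    (HornFamily.ofHom f).hom = f := by
  ext U g
  obtain ⟨F, hF, a, ha⟩ := (mem_innerHorn g.1).1 g.2
  refine ((HornFamily.ofHom f).hom_app g F hF a ha).trans ?_
  change X.map a.op (f.app _ (hornFace F hF)) = _
  rw [← f.naturality_apply]
  exact congrArg (f.app U) (Subtype.ext (ULift.ext _ _ ha))

end

/-- The horn is a union of faces, so a map out of it is a family of dendrices on the faces that
agree on all common restrictions; the Yoneda lemma identifies the fillers. -/
theorem isStrictInnerKan_iff {X : DSet.{u}} : IsStrictInnerKan X ↔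
    ∀ (T : Tree) (e : T.Edge) (he : T.IsInner e) (y : HornFamily X T e he), ∃! x, y.Fills x := by
  constructor
  · intro h T e he y
    obtain ⟨x, hx, hu⟩ := (h T e he).existsUnique y.hom
    refine ⟨uliftYonedaEquiv x, (y.fills_iff x).2 hx, fun x' hx' => ?_⟩
    obtain ⟨x', rfl⟩ := uliftYonedaEquiv.surjective x'
    exact congrArg _ (hu x' ((y.fills_iff x').1 hx'))
  · intro h T e he
    rw [Function.bijective_iff_existsUnique]
    intro f
    obtain ⟨x, hx, hu⟩ := h T e he (.ofHom f)
    obtain ⟨x, rfl⟩ := uliftYonedaEquiv.surjective x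
    refine ⟨x, (((HornFamily.ofHom f).fills_iff x).1 hx).trans (HornFamily.hom_ofHom f),
      fun x' hx' => uliftYonedaEquiv.injective (hu _ ?_)⟩
    exact ((HornFamily.ofHom f).fills_iff x').2 (hx'.trans (HornFamily.hom_ofHom f).symm)

/-- Both dendrices fill the horn obtained by restricting `x`. -/
theorem IsStrictInnerKan.eq_of_faces {X : DSet.{u}} (hX : IsStrictInnerKan X) {T : Tree}
    {e : T.Edge} (he : T.IsInner e) {x y : X.obj (op T)}
    (h : ∀ F : T.Face, F ≠ .inner e he → X.map F.map.op x = X.map F.map.op y) : x = y := by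
  let z : HornFamily X T e he :=
    { val := fun F _ => X.map F.map.op x
      compat := fun F F' _ _ R a b hab => by
        change (X.map F.map.op ≫ X.map a.op) x = (X.map F'.map.op ≫ X.map b.op) x
        rw [← Functor.map_comp, ← Functor.map_comp, ← op_comp, ← op_comp, hab] }
  exact (isStrictInnerKan_iff.1 hX T e he z).unique (fun _ _ => rfl) fun F hF => (h F hF).symm

/-! ### The values of a dendrex on operations -/

section

variable (X : DSet.{u}) {S T : Tree}

/-- The value of a dendrex `x` of shape `T` on an operation of `T`. -/
def DSet.opAt (x : X.obj (op T)) {n : ℕ} {c : Fin n → T.Edge} {d : T.Edge}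
    (p : T.Operation c d) : X.obj (op (corolla n)) :=
  X.map (opHom p).op x

theorem opHom_comp (g : S ⟶ T) {n : ℕ} {c : Fin n → S.Edge} {d : S.Edge}
    (p : S.Operation c d) : opHom p ≫ g = opHom (map_op g p) :=
  hom_ext fun e => by cases e <;> rfl

theorem DSet.opAt_map (g : S ⟶ T) (x : X.obj (op T)) {n : ℕ} {c : Fin n → S.Edge} {d : S.Edge}
    (p : S.Operation c d) : X.opAt (X.map g.op x) p = X.opAt x (map_op g p) := by
  rw [opAt, map_comp_apply, opHom_comp]
  rfl

theorem DSet.opAt_congr (x : X.obj (op T)) {n : ℕ} {c c' : Fin n → T.Edge} {d d' : T.Edge}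
    (hc : ∀ i, c i = c' i) (hd : d = d') (p : T.Operation c d) (p' : T.Operation c' d') :
    X.opAt x p = X.opAt x p' := by
  obtain rfl := funext hc
  subst hd
  rfl

theorem DSet.edge_opAt_some (x : X.obj (op T)) {n : ℕ} {c : Fin n → T.Edge} {d : T.Edge}
    (p : T.Operation c d) (i : Fin n) : X.edge (X.opAt x p) (some i) = X.edge x (c i) :=
  X.edge_map (opHom p) x (some i)

theorem DSet.edge_opAt_none (x : X.obj (op T)) {n : ℕ} {c : Fin n → T.Edge} {d : T.Edge}
    (p : T.Operation c d) : X.edge (X.opAt x p) none = X.edge x d :=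
  X.edge_map (opHom p) x none

theorem DSet.opAt_corollaOp {n : ℕ} (x : X.obj (op (corolla n))) :
    X.opAt x (corollaOp n) = x := by
  have : opHom (corollaOp n) = 𝟙 (corolla n) := hom_ext fun e => by cases e <;> rfl
  exact (congrArg (fun f => X.map (Quiver.Hom.op f) x) this).trans (X.map_id_apply x)

/-- Permuting the inputs of a corolla. -/
def corollaPerm {m n : ℕ} (σ : Fin m ≃ Fin n) : corolla m ⟶ corolla n :=
  opHom (.act σ (c' := fun i => some (σ i)) (fun _ => rfl) (corollaOp n))

theorem DSet.opAt_act (x : X.obj (op T)) {m n : ℕ} (σ : Fin m ≃ Fin n) {c : Fin n → T.Edge}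
    {c' : Fin m → T.Edge} {d : T.Edge} (h : ∀ i, c' i = c (σ i)) (p : T.Operation c d)
    (p' : T.Operation c' d) : X.opAt x p' = X.map (corollaPerm σ).op (X.opAt x p) := by
  have : opHom p' = corollaPerm σ ≫ opHom p := hom_ext fun e => by
    cases e with
    | none => rfl
    | some i => exact h i
  exact (congrArg (fun f => X.map (Quiver.Hom.op f) x) this).trans
    (X.map_comp_apply _ _ x).symm

/-- The map from the unary corolla factors through the tree with one edge, so a unit depends only on
its colour. -/
theorem DSet.opAt_one (x : X.obj (op T)) (e : T.Edge) :
    X.opAt x (.one e) = X.opAt (X.edge x e) (.one (T := eta) ()) :=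
  (X.opAt_map (edgeHom e) x (.one (T := eta) ())).symm

theorem DSet.opAt_spannedOp {n : ℕ} {c : Fin n → T.Edge} {d : T.Edge} (p : T.Operation c d)
    (x : X.obj (op T)) : X.opAt (X.map (spannedHom p).op x) (spannedOp p) = X.opAt x p :=
  X.opAt_map (spannedHom p) x (spannedOp p)

theorem DSet.opAt_spanned_vertex {n : ℕ} {c : Fin n → T.Edge} {d : T.Edge}
    (p : T.Operation c d) (x : X.obj (op T)) {v : T.Vertex} (hv : T.InSupport c d v) {m : ℕ}
    {a : Fin m → T.Edge} (ha : T.Enumerates v a) :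
    X.opAt (X.map (spannedHom p).op x) (.vertex _ _ (spanned_enumerates p hv ha)) =
      X.opAt x (.vertex v a ha) :=
  X.opAt_map (spannedHom p) x (.vertex _ _ (spanned_enumerates p hv ha))

end

/-- A dendrex of a strict inner Kan complex is determined by its values on the edges and
vertices. -/
theorem IsStrictInnerKan.ext {X : DSet.{u}} (hX : IsStrictInnerKan X) {T : Tree}
    {x y : X.obj (op T)} (hE : ∀ e, X.edge x e = X.edge y e)
    (hV : ∀ v, ∃ (n : ℕ) (c : Fin n → T.Edge) (hc : T.Enumerates v c),
      X.opAt x (.vertex v c hc) = X.opAt y (.vertex v c hc)) : x = y := by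
  induction hN : Nat.card T.Vertex using Nat.strong_induction_on generalizing T with
  | h N ih =>
    subst hN
    by_cases hT : ∃ e, T.IsInner e
    · obtain ⟨e, he⟩ := hT
      -- The value on a proper operation is computed in the subtree it spans, which has fewer
      -- vertices.
      have hp : ∀ {n : ℕ} {c : Fin n → T.Edge} {d : T.Edge} (p : T.Operation c d),
          T.IsProper c d → X.opAt x p = X.opAt y p := by
        intro n c d p hp
        have h : X.map (spannedHom p).op x = X.map (spannedHom p).op y := by
          refine ih _ (card_spanned_lt p hp) (fun f => ?_) (fun v => ?_) rfl
          · rw [X.edge_map, X.edge_map, hE]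
          · obtain ⟨m, a, ha, h⟩ := hV v.1
            refine ⟨m, _, spanned_enumerates p v.2 ha, ?_⟩
            exact (X.opAt_spanned_vertex p x v.2 ha).trans
              (h.trans (X.opAt_spanned_vertex p y v.2 ha).symm)
        exact (X.opAt_spannedOp p x).symm.trans
          ((congrArg (fun z => X.opAt z (spannedOp p)) h).trans (X.opAt_spannedOp p y))
      -- Faces in the horn also have fewer vertices. They contain `e`, so the values on their
      -- vertices are values of `x` and `y` on proper operations.
      refine hX.eq_of_faces he fun F hF => ih _ (F.card_vertex_lt he) (fun f => ?_)
        (fun v => ?_) rfl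
      · rw [X.edge_map, X.edge_map, hE]
      · obtain ⟨m, a, ha⟩ := F.source.exists_enumerates v
        refine ⟨m, a, ha, ?_⟩
        rw [X.opAt_map, X.opAt_map]
        obtain ⟨e', he'⟩ := F.exists_edge he hF
        exact hp _ (isProper_map_vertex (F.map_injective he) (he'.symm ▸ he) ha)
    · push Not at hT
      have := subsingleton_vertex hT
      rcases isEmpty_or_nonempty T.Vertex with h | ⟨⟨v⟩⟩
      · obtain ⟨g, hg, -⟩ := exists_inv_edgeHom h
        rw [← X.map_id_apply x, ← X.map_id_apply y, ← hg, ← X.map_comp_apply,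
          ← X.map_comp_apply]
        exact congrArg _ (hE _)
      · obtain ⟨m, a, ha, h⟩ := hV v
        obtain ⟨g, hg, -⟩ := exists_inv_opHom (fun w => Subsingleton.elim w v) ha
        rw [← X.map_id_apply x, ← X.map_id_apply y, ← hg, ← X.map_comp_apply,
          ← X.map_comp_apply]
        exact congrArg _ h

/-! ### Spines -/

/-- Values for the edges and the vertices of a tree, the latter for one enumeration of the inputs
each. -/
structure Spine (X : DSet.{u}) (T : Tree) where
  /-- the values on the edges -/
  color : T.Edge → X.obj (op eta)
  /-- the number of inputs of a vertex -/
  arity : T.Vertex → ℕ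
  /-- the inputs of a vertex -/
  input : ∀ v, Fin (arity v) → T.Edge
  enum : ∀ v, T.Enumerates v (input v)
  /-- the values on the vertices -/
  label : ∀ v, X.obj (op (corolla (arity v)))
  label_some : ∀ v i, X.edge (label v) (some i) = color (input v i)
  label_none : ∀ v, X.edge (label v) none = color (T.out v)

/-- The dendrex `x` has the given values on the edges and vertices. -/
structure Spine.Extends {X : DSet.{u}} {T : Tree} (s : Spine X T) (x : X.obj (op T)) : Prop where
  edge : ∀ e, X.edge x e = s.color e
  vertex : ∀ v, X.opAt x (.vertex v _ (s.enum v)) = s.label v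

/-- The restriction of a spine to a subtree. -/
noncomputable def Spine.restrict {X : DSet.{u}} {T : Tree} (s : Spine X T) {n : ℕ}
    {c : Fin n → T.Edge} {d : T.Edge} (p : T.Operation c d) : Spine X (T.spanned p) where
  color e := s.color e.1
  arity v := s.arity v.1
  input v i := ⟨s.input v.1 i, v.2.between_input (((s.enum v.1).2 _).1 ⟨i, rfl⟩)⟩
  enum v := spanned_enumerates p v.2 (s.enum v.1)
  label v := s.label v.1
  label_some v i := s.label_some v.1 i
  label_none v := s.label_none v.1

namespace IsStrictInnerKan

variable {X : DSet.{u}} (hX : IsStrictInnerKan X)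

include hX in
/-- To compare values on an operation it suffices to compare values on the edges and vertices
involved. -/
theorem opAt_eq {S T : Tree} {g : S ⟶ T} (hg : Function.Injective (edgeMap g)) {n : ℕ}
    {c : Fin n → S.Edge} {d : S.Edge} (p : S.Operation c d) (y : X.obj (op S))
    (z : X.obj (op (T.spanned (map_op g p))))
    (hE : ∀ e (he : S.Between c d e), X.edge y e =
      X.edge z (⟨edgeMap g e, he.map hg⟩ : (T.spanned (map_op g p)).Edge))
    (hV : ∀ v (hv : S.InSupport c d v), ∃ (m : ℕ) (a : Fin m → S.Edge) (ha : S.Enumerates v a),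
      X.opAt y (.vertex v a ha) = X.opAt z (hv.map_op hg p ha)) :
    X.opAt y p = X.opAt z (spannedOp (map_op g p)) := by
  have h : X.map (spannedHom p).op y = X.map (spannedMap hg p).op z := by
    refine hX.ext (fun e => ?_) fun v => ?_
    · exact (X.edge_map (spannedHom p) y e).trans
        ((hE e.1 e.2).trans (X.edge_map (spannedMap hg p) z e).symm)
    · obtain ⟨m, a, ha, h⟩ := hV v.1 v.2
      exact ⟨m, _, spanned_enumerates p v.2 ha, (X.opAt_spanned_vertex p y v.2 ha).trans
        (h.trans (X.opAt_map (spannedMap hg p) z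
          (.vertex _ _ (spanned_enumerates p v.2 ha))).symm)⟩
  exact (X.opAt_spannedOp p y).symm.trans ((congrArg (fun x => X.opAt x (spannedOp p)) h).trans
    (X.opAt_map (spannedMap hg p) z (spannedOp p)))

/-- Values for the proper operations of a tree. -/
abbrev ProperValues (X : DSet.{u}) (T : Tree) :=
  ∀ (n : ℕ) (c : Fin n → T.Edge) (d : T.Edge), T.Operation c d → T.IsProper c d →
    X.obj (op (corolla n))

/-- The dendrex `y` has the prescribed values on the edges and vertices. -/
structure Respects {T : Tree} (s : Spine X T) (val : ProperValues X T) {S : Tree} (g : S ⟶ T)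
    (y : X.obj (op S)) : Prop where
  edge : ∀ e, X.edge y e = s.color (edgeMap g e)
  vertex : ∀ w, ∃ (n : ℕ) (a : Fin n → S.Edge) (ha : S.Enumerates w a)
    (hp : T.IsProper (fun i => edgeMap g (a i)) (edgeMap g (S.out w))),
    X.opAt y (.vertex w a ha) = val _ _ _ (map_op g (.vertex w a ha)) hp

include hX in
/-- A spine has canonical values on proper operations, provided that spines on smaller trees can be
extended. -/
theorem exists_properValues {T : Tree} (s : Spine X T)
    (ih : ∀ S : Tree, Nat.card S.Vertex < Nat.card T.Vertex → ∀ s : Spine X S, ∃ x, s.Extends x) :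
    ∃ val : ProperValues X T,
      (∀ n c d p hp i, X.edge (val n c d p hp) (some i) = s.color (c i)) ∧
      (∀ n c d p hp, X.edge (val n c d p hp) none = s.color d) ∧
      (∀ v hp, val _ _ _ (.vertex v _ (s.enum v)) hp = s.label v) ∧
      ∀ (S : Tree) (g : S ⟶ T) (_ : Function.Injective (edgeMap g)) (y : X.obj (op S)),
        Respects s val g y → ∀ {n : ℕ} {c : Fin n → S.Edge} {d : S.Edge} (p : S.Operation c d)
        (hp : T.IsProper (fun i => edgeMap g (c i)) (edgeMap g d)),
        X.opAt y p = val _ _ _ (map_op g p) hp := by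
  -- The canonical value on a proper operation is the total composite of an extension of `s` over
  -- its span.
  have hsub : ∀ (n : ℕ) (c : Fin n → T.Edge) (d : T.Edge) (p : T.Operation c d),
      T.IsProper c d → ∃ x, (s.restrict p).Extends x :=
    fun n c d p hp => ih _ (card_spanned_lt p hp) _
  choose xs hxs using hsub
  -- Consistency: an operation `q` inside the span of `p` gets the same value from the extension
  -- over the span of `p` as from the one over its own span.
  have stage : ∀ {n : ℕ} {c : Fin n → T.Edge} {d : T.Edge} (p : T.Operation c d)
      (hp : T.IsProper c d) {n' : ℕ} {c' : Fin n' → (T.spanned p).Edge} {d' : (T.spanned p).Edge}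
      (q : (T.spanned p).Operation c' d')
      (hq : T.IsProper (fun i => edgeMap (spannedHom p) (c' i)) (edgeMap (spannedHom p) d')),
      X.opAt (xs _ _ _ p hp) q =
        X.opAt (xs _ _ _ (map_op (spannedHom p) q) hq) (spannedOp (map_op (spannedHom p) q)) := by
    intro n c d p hp n' c' d' q hq
    refine hX.opAt_eq (spannedHom_injective p) q _ _ (fun e he => ?_) fun v hv => ?_
    · exact ((hxs _ _ _ p hp).edge e).trans
        ((hxs _ _ _ _ hq).edge ⟨edgeMap (spannedHom p) e, he.map (spannedHom_injective p)⟩).symm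
    · have hv' : T.InSupport (fun i => edgeMap (spannedHom p) (c' i))
          (edgeMap (spannedHom p) d') v.1 :=
        ⟨hv.1.map (spannedHom p), fun i hi => hv.2 i (.of_map (spannedHom_injective p) hi)⟩
      exact ⟨_, _, (s.restrict p).enum v, ((hxs _ _ _ p hp).vertex v).trans
        ((hxs _ _ _ _ hq).vertex ⟨v.1, hv'⟩).symm⟩
  refine ⟨fun n c d p hp => X.opAt (xs n c d p hp) (spannedOp p), fun n c d p hp i => ?_,
    fun n c d p hp => ?_, fun v hp => ?_, fun S g hg y hy n c d p hp => ?_⟩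
  · exact (X.edge_opAt_some _ (spannedOp p) i).trans ((hxs _ _ _ p hp).edge _)
  · exact (X.edge_opAt_none _ (spannedOp p)).trans ((hxs _ _ _ p hp).edge _)
  · exact (hxs _ _ _ _ hp).vertex
      ⟨v, .refl _, fun i => not_above_out (((s.enum v).2 _).1 ⟨i, rfl⟩)⟩
  · refine hX.opAt_eq hg p _ _ (fun e he => ?_) fun v hv => ?_
    · exact (hy.edge e).trans
        ((hxs _ _ _ _ hp).edge ⟨edgeMap g e, he.map hg⟩).symm
    · obtain ⟨m, a, ha, hq, h⟩ := hy.vertex v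
      exact ⟨m, a, ha, h.trans (stage _ hp (hv.map_op hg p ha) hq).symm⟩

include hX in
/-- Every spine in a strict inner Kan complex can be extended. -/
theorem exists_extends {T : Tree} (s : Spine X T) : ∃ x, s.Extends x := by
  induction hN : Nat.card T.Vertex using Nat.strong_induction_on generalizing T with
  | h N ih =>
    subst hN
    by_cases hT : ∃ e, T.IsInner e
    · obtain ⟨e, he⟩ := hT
      obtain ⟨val, hsome, hnone, hlabel, hval⟩ :=
        hX.exists_properValues s fun S hS s => ih _ hS s rfl
      -- On a face of the horn, the canonical values at the images of the vertices form a spine,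
      -- which extends by induction.
      have hface : ∀ F : T.Face, F ≠ .inner e he → ∃ y, Respects s val F.map y := by
        intro F hF
        choose n a ha using F.source.exists_enumerates
        obtain ⟨e', he'⟩ := F.exists_edge he hF
        have hp : ∀ w, T.IsProper (fun i => edgeMap F.map (a w i))
            (edgeMap F.map (F.source.out w)) := fun w =>
          isProper_map_vertex (F.map_injective he) (he'.symm ▸ he) (ha w)
        obtain ⟨y, hy⟩ := ih _ (F.card_vertex_lt he)
          { color := fun e => s.color (edgeMap F.map e)
            arity := n
            input := a
            enum := ha
            label := fun w => val _ _ _ (map_op F.map (.vertex w _ (ha w))) (hp w)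
            label_some := fun w i => hsome _ _ _ _ _ i
            label_none := fun w => hnone _ _ _ _ _ } rfl
        exact ⟨y, hy.edge, fun w => ⟨_, _, ha w, hp w, hy.vertex w⟩⟩
      choose y hy using hface
      have hyval : ∀ F hF {n : ℕ} {c : Fin n → F.source.Edge} {d : F.source.Edge}
          (p : F.source.Operation c d)
          (hp : T.IsProper (fun i => edgeMap F.map (c i)) (edgeMap F.map d)),
          X.opAt (y F hF) p = val _ _ _ (map_op F.map p) hp :=
        fun F hF => hval _ F.map (F.map_injective he) _ (hy F hF)
      have hedge : ∀ (F F' : T.Face) (hF : F ≠ .inner e he) (hF' : F' ≠ .inner e he) {R : Tree}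
          (a : R ⟶ F.source) (b : R ⟶ F'.source), a ≫ F.map = b ≫ F'.map → ∀ f,
          X.edge (X.map a.op (y F hF)) f = X.edge (X.map b.op (y F' hF')) f := by
        intro F F' hF hF' R a b hab f
        rw [X.edge_map, X.edge_map, (hy F hF).edge, (hy F' hF').edge, ← edgeMap_comp, hab]
        rfl
      -- Where the image in `T` is proper, both restrictions take the canonical value.
      have hproper : ∀ (F F' : T.Face) (hF : F ≠ .inner e he) (hF' : F' ≠ .inner e he) {R : Tree}
          (a : R ⟶ F.source) (b : R ⟶ F'.source), a ≫ F.map = b ≫ F'.map →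
          ∀ {n : ℕ} {c : Fin n → R.Edge} {d : R.Edge} (p : R.Operation c d),
          T.IsProper (fun i => edgeMap (a ≫ F.map) (c i)) (edgeMap (a ≫ F.map) d) →
          X.opAt (X.map a.op (y F hF)) p = X.opAt (X.map b.op (y F' hF')) p := by
        intro F F' hF hF' R a b hab n c d p hp
        rw [X.opAt_map, X.opAt_map, hyval F hF (map_op a p) hp]
        have hp' := hp
        rw [hab] at hp'
        rw [hyval F' hF' (map_op b p) hp']
        -- The types depend on the composite `a ≫ F.map`; generalising its target value to a
        -- variable `f` allows the equation to be eliminated.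
        have : ∀ (f : R ⟶ T) (hf : a ≫ F.map = f) (hp'),
            val _ _ _ (map_op (a ≫ F.map) p) hp = val _ _ _ (map_op f p) hp' := by
          rintro f rfl _
          rfl
        exact this _ hab hp'
      have hcompat : ∀ (F F' : T.Face) (hF : F ≠ .inner e he) (hF' : F' ≠ .inner e he) {R : Tree}
          (a : R ⟶ F.source) (b : R ⟶ F'.source), a ≫ F.map = b ≫ F'.map →
          X.map a.op (y F hF) = X.map b.op (y F' hF') := by
        intro F F' hF hF' R a b hab
        refine hX.ext (hedge F F' hF hF' a b hab) fun w => ?_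
        obtain ⟨m, c, hc⟩ := R.exists_enumerates w
        refine ⟨m, c, hc, ?_⟩
        by_cases hp : T.IsProper (fun i => edgeMap (a ≫ F.map) (c i))
            (edgeMap (a ≫ F.map) (R.out w))
        · exact hproper F F' hF hF' a b hab _ hp
        -- The image of `w` now involves all vertices of `T`. This excludes outer faces, so that `F`
        -- and `F'` are both contractions.
        · have hq := map_op a (.vertex w c hc)
          cases F with
          | edge _ h => exact absurd h (not_existsUnique_vertex he)
          | outer v hv => exact absurd (isProper_outerFace hv hq) hp
          | inner e₁ h₁ =>
            cases F' with
            | edge _ h => exact absurd h (not_existsUnique_vertex he)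
            | outer v hv =>
              rw [hab] at hp
              exact absurd (isProper_outerFace hv (map_op b (.vertex w c hc))) hp
            | inner e₂ h₂ =>
              have hab' : ∀ f, (edgeMap a f).1 = (edgeMap b f).1 := fun f =>
                congrArg (fun g => edgeMap g f) hab
              by_cases hne : e₂ = e₁
              · subst hne
                obtain rfl : a = b := hom_ext fun f => Subtype.ext (hab' f)
                rfl
              -- The operation already lives on the double contraction. The latter still contains
              -- `e`, so all its vertices have proper images and the two dendrices agree on it.
              · obtain ⟨D, a', b', hab₁, hinj, hmem, c', d', q, hca, hda, hcb, hdb⟩ :=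
                  exists_common_innerFace h₁ h₂ hne hq (fun i => hab' (c i)) (hab' _)
                have hD : X.map a'.op (y _ hF) = X.map b'.op (y _ hF') := by
                  refine hX.ext (hedge _ _ hF hF' a' b' hab₁) fun w => ?_
                  obtain ⟨m, c, hc⟩ := D.exists_enumerates w
                  obtain ⟨f, hf⟩ := hmem e (fun h => by subst h; exact hF rfl)
                    (fun h => by subst h; exact hF' rfl)
                  exact ⟨m, c, hc, hproper _ _ hF hF' a' b' hab₁ _
                    (isProper_map_vertex hinj (hf.symm ▸ he) hc)⟩
                have hA : X.opAt (X.map a.op (y _ hF)) (.vertex w c hc) =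
                    X.opAt (X.map a'.op (y _ hF)) q :=
                  (X.opAt_map a _ (.vertex w c hc)).trans
                    ((X.opAt_congr _ (fun i => (hca i).symm) hda.symm _ (map_op a' q)).trans
                      (X.opAt_map a' _ q).symm)
                have hB : X.opAt (X.map b.op (y _ hF')) (.vertex w c hc) =
                    X.opAt (X.map b'.op (y _ hF')) q :=
                  (X.opAt_map b _ (.vertex w c hc)).trans
                    ((X.opAt_congr _ (fun i => (hcb i).symm) hdb.symm _ (map_op b' q)).trans
                      (X.opAt_map b' _ q).symm)
                rw [hA, hB, hD]
      obtain ⟨x, hx, -⟩ := isStrictInnerKan_iff.1 hX T e he ⟨y, hcompat⟩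
      -- A proper operation lifts to an outer face, which belongs to the horn, so the filler has the
      -- canonical value on it.
      have hxp : ∀ {n : ℕ} {c : Fin n → T.Edge} {d : T.Edge} (p : T.Operation c d)
          (hp : T.IsProper c d), X.opAt x p = val _ _ _ p hp := by
        intro n c d p hp
        obtain ⟨v, hv, c', d', p', rfl, rfl⟩ := exists_lift_outerFace he p hp
        have hF : Face.outer v hv ≠ .inner e he := by simp
        refine Eq.trans ?_ (hyval _ hF p' hp)
        exact (X.opAt_map (T.outerFaceHom v hv) x p').symm.trans
          (congrArg (fun z => X.opAt z p') (hx _ hF))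
      refine ⟨x, fun f => ?_, fun v => ?_⟩
      -- Units are proper, so the colour of `f` can be read off as the output of the unit at `f`.
      · rw [← X.edge_opAt_none x (.one f), hxp _ (isProper_one he f), hnone]
      · rw [hxp _ (isProper_vertex he (s.enum v)), hlabel]
    · push Not at hT
      have := subsingleton_vertex hT
      rcases isEmpty_or_nonempty T.Vertex with h | ⟨⟨v⟩⟩
      · obtain ⟨g, -, hg⟩ := exists_inv_edgeHom h
        have hE : ∀ f, f = T.root := fun f =>
          (above_cases (above_root f)).resolve_right fun ⟨v, _⟩ => h.elim v
        refine ⟨X.map g.op (s.color T.root), fun f => ?_, fun v => h.elim v⟩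
        rw [hE f, DSet.edge, X.map_comp_apply, hg, X.map_id_apply]
      · obtain ⟨g, hg', hg⟩ := exists_inv_opHom (fun w => Subsingleton.elim w v) (s.enum v)
        refine ⟨X.map g.op (s.label v), fun f => ?_, fun w => ?_⟩
        · rw [X.edge_map]
          have hf : edgeMap (opHom (.vertex v _ (s.enum v))) (edgeMap g f) = f :=
            congrArg (fun h => edgeMap h f) hg'
          cases hk : edgeMap g f with
          | none =>
            rw [hk] at hf
            exact (s.label_none v).trans (congrArg s.color hf)
          | some i =>
            rw [hk] at hf
            exact (s.label_some v i).trans (congrArg s.color hf)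
        · obtain rfl := Subsingleton.elim v w
          rw [DSet.opAt, X.map_comp_apply, hg, X.map_id_apply]

end IsStrictInnerKan

namespace Tree

/-! ### Grafting -/

section

variable {n : ℕ} (U : Fin n → Tree)

/-- The tree obtained by grafting the trees `U i` on the inputs of a corolla. -/
def graft : Tree where
  Edge := Option (Σ i, (U i).Edge)
  Vertex := Option (Σ i, (U i).Vertex)
  finite := by
    have := fun i => (U i).finite
    infer_instance
  root := none
  out v := v.map fun s => ⟨s.1, (U s.1).out s.2⟩
  out_injective := Option.map_injective fun ⟨i, v⟩ ⟨j, w⟩ h => by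
    obtain ⟨h₁, h₂⟩ := Sigma.mk.inj h
    dsimp only at h₁
    subst h₁
    exact congrArg (Sigma.mk i) ((U i).out_injective (eq_of_heq h₂))
  -- The value `none` changes its meaning: for the root of `U i` it says that no vertex of `U i`
  -- lies below, and as an element of the new vertex type it is the lowest vertex of the graft.
  below e := e.map fun s => ((U s.1).below s.2).map (Sigma.mk s.1)
  below_eq_none e := by simp
  path e := by
    rcases e with _ | ⟨i, e⟩
    · exact .refl
    · have := (U i).path e
      induction this using Relation.ReflTransGen.head_induction_on with
      | refl => exact .single ⟨none, by simp [(U i).below_root], rfl⟩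
      | head h _ ih =>
        obtain ⟨v, hv, rfl⟩ := h
        exact .head ⟨some ⟨i, v⟩, by simp [hv], rfl⟩ ih

variable {U} in
theorem graft_below_some (i : Fin n) (e : (U i).Edge) : (graft U).below (some ⟨i, e⟩) =
    some (((U i).below e).map fun v => (⟨i, v⟩ : Σ i, (U i).Vertex)) := rfl

/-- The inputs of the lowest vertex. -/
def graftInput (i : Fin n) : (graft U).Edge := some ⟨i, (U i).root⟩

theorem graft_enumerates_none : (graft U).Enumerates none (graftInput U) := by
  refine ⟨fun i j h => congrArg Sigma.fst (Option.some.inj h), fun e => ?_⟩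
  constructor
  · rintro ⟨i, rfl⟩
    exact (graft_below_some i _).trans (by rw [(U i).below_root]; rfl)
  · rcases e with _ | ⟨i, e⟩
    · intro h
      cases h
    · intro h
      have h' := Option.some.inj ((graft_below_some i e).symm.trans h)
      rw [Option.map_eq_none_iff, (U i).below_eq_none] at h'
      exact ⟨i, congrArg (fun x => some (Sigma.mk i x)) h'.symm⟩

variable {U} in
theorem graft_enumerates_some {i : Fin n} {v : (U i).Vertex} {m : ℕ} {a : Fin m → (U i).Edge}
    (ha : (U i).Enumerates v a) :
    (graft U).Enumerates (some ⟨i, v⟩) fun j => some ⟨i, a j⟩ := by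
  have hinj : ∀ {x y : (U i).Edge}, (some ⟨i, x⟩ : (graft U).Edge) = some ⟨i, y⟩ → x = y :=
    fun h => eq_of_heq (Sigma.mk.inj (Option.some.inj h)).2
  refine ⟨fun j k h => ha.1 (hinj h), fun e => ?_⟩
  constructor
  · rintro ⟨j, rfl⟩
    exact (graft_below_some i _).trans (by rw [(ha.2 _).1 ⟨j, rfl⟩]; rfl)
  · rcases e with _ | ⟨i', e⟩
    · intro h
      cases h
    · intro h
      have h' := Option.some.inj ((graft_below_some i' e).symm.trans h)
      obtain ⟨w, hw, hwv⟩ := Option.map_eq_some_iff.1 h'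
      obtain ⟨rfl, hwv⟩ := Sigma.mk.inj hwv
      obtain rfl := eq_of_heq hwv
      obtain ⟨j, rfl⟩ := (ha.2 e).2 hw
      exact ⟨j, rfl⟩

/-- The operation given by the lowest vertex. -/
theorem graftOp : (graft U).Operation (graftInput U) (graft U).root :=
  .vertex (T := graft U) none _ (graft_enumerates_none U)

/-- The inclusion of a grafted tree. -/
def graftHom (i : Fin n) : U i ⟶ graft U :=
  homMk' (fun e => some ⟨i, e⟩) fun v => by
    obtain ⟨m, a, ha⟩ := (U i).exists_enumerates v
    exact ⟨m, a, ha, .vertex (T := graft U) _ _ (graft_enumerates_some ha)⟩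

end

/-- The composite of all vertices of a tree of height two. -/
theorem graftCorollaOp {n : ℕ} (k : Fin n → ℕ) :
    (graft fun i => corolla (k i)).Operation
      (concat fun i j => edgeMap (graftHom (fun i => corolla (k i)) i) (some j))
      (graft fun i => corolla (k i)).root :=
  .comp (graftOp _) fun i => map_op (graftHom (fun i => corolla (k i)) i) (corollaOp (k i))

theorem corolla_enumerates (n : ℕ) :
    (corolla n).Enumerates () (some : Fin n → (corolla n).Edge) :=
  ⟨Option.some_injective _, fun e => by
    cases e with
    | none => exact ⟨fun h => (by obtain ⟨i, hi⟩ := h; cases hi), fun h => (by cases h)⟩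
    | some i => exact ⟨fun _ => rfl, fun _ => ⟨i, rfl⟩⟩⟩

/-- The map from a tree of height two given by a composite of operations. -/
def graftCorollaHom {T : Tree} {n : ℕ} {k : Fin n → ℕ} {c : Fin n → T.Edge}
    {b : ∀ i, Fin (k i) → T.Edge} {d : T.Edge} (p : T.Operation c d)
    (q : ∀ i, T.Operation (b i) (c i)) : graft (fun i => corolla (k i)) ⟶ T :=
  homMk' (fun e => Option.elim e d fun s => Option.elim s.2 (c s.1) (b s.1)) fun v => by
    rcases v with _ | ⟨i, ⟨⟩⟩
    · exact ⟨_, _, graft_enumerates_none _, p⟩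
    · exact ⟨_, _, graft_enumerates_some (corolla_enumerates (k i)), q i⟩

end Tree

/-! ### The operad of a strict inner Kan complex -/

namespace IsStrictInnerKan

variable {X : DSet.{u}} (hX : IsStrictInnerKan X)

include hX in
/-- Dendrices can be grafted. -/
theorem exists_graft {n : ℕ} {U : Fin n → Tree} (x : X.obj (op (corolla n)))
    (y : ∀ i, X.obj (op (U i))) (h : ∀ i, X.edge (y i) (U i).root = X.edge x (some i)) :
    ∃ z : X.obj (op (graft U)), X.opAt z (graftOp U) = x ∧
      ∀ i, X.map (graftHom U i).op z = y i := by
  choose m a ha using fun i => (U i).exists_enumerates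
  obtain ⟨z, hz⟩ := hX.exists_extends (T := graft U)
    { color := fun e => Option.elim e (X.edge x none) fun s => X.edge (y s.1) s.2
      arity := fun v => Option.elim v n fun s => m s.1 s.2
      input := fun v => match v with
        | none => graftInput U
        | some ⟨i, w⟩ => fun j => some ⟨i, a i w j⟩
      enum := fun v => match v with
        | none => graft_enumerates_none U
        | some ⟨i, w⟩ => graft_enumerates_some (ha i w)
      label := fun v => match v with
        | none => x
        | some ⟨i, w⟩ => X.opAt (y i) (.vertex w _ (ha i w))
      label_some := fun v => match v with
        | none => fun i => (h i).symm
        | some ⟨i, w⟩ => fun j => X.edge_opAt_some _ _ _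
      label_none := fun v => match v with
        | none => rfl
        | some ⟨i, w⟩ => X.edge_opAt_none _ _ }
  refine ⟨z, hz.vertex none, fun i => hX.ext (fun e => ?_) fun w => ⟨_, _, ha i w, ?_⟩⟩
  · exact (X.edge_map (graftHom U i) z e).trans (hz.edge (some ⟨i, e⟩))
  · exact (X.opAt_map (graftHom U i) z _).trans (hz.vertex (some ⟨i, w⟩))

/-- The composition of corollas. -/
noncomputable def compVal {n : ℕ} {k : Fin n → ℕ} (x : X.obj (op (corolla n)))
    (y : ∀ i, X.obj (op (corolla (k i))))
    (h : ∀ i, X.edge (y i) none = X.edge x (some i)) : X.obj (op (corolla (∑ i, k i))) :=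
  X.opAt (hX.exists_graft (U := fun i => corolla (k i)) x y h).choose (graftCorollaOp k)

theorem edge_eq_of_opAt {T : Tree} {z : X.obj (op T)} {n : ℕ} {k : Fin n → ℕ}
    {c : Fin n → T.Edge} {b : ∀ i, Fin (k i) → T.Edge} {d : T.Edge} {p : T.Operation c d}
    {q : ∀ i, T.Operation (b i) (c i)} {x : X.obj (op (corolla n))}
    {y : ∀ i, X.obj (op (corolla (k i)))} (hx : X.opAt z p = x)
    (hy : ∀ i, X.opAt z (q i) = y i) (i : Fin n) :
    X.edge (y i) none = X.edge x (some i) := by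
  rw [← hx, ← hy]
  exact (X.edge_opAt_none z (q i)).trans (X.edge_opAt_some z p i).symm

/-- Composites can be computed inside any dendrex `z` that contains the factors: pulling `z` back to
the tree of height two gives a graft of the factors, and grafts are unique by `ext`. The operad
axioms reduce to this. -/
theorem compVal_opAt {T : Tree} (z : X.obj (op T)) {n : ℕ} {k : Fin n → ℕ} {c : Fin n → T.Edge}
    {b : ∀ i, Fin (k i) → T.Edge} {d : T.Edge} (p : T.Operation c d)
    (q : ∀ i, T.Operation (b i) (c i)) {x : X.obj (op (corolla n))}
    {y : ∀ i, X.obj (op (corolla (k i)))} (hx : X.opAt z p = x)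
    (hy : ∀ i, X.opAt z (q i) = y i) :
    hX.compVal x y (edge_eq_of_opAt hx hy) = X.opAt z (.comp p q) := by
  have h := edge_eq_of_opAt hx hy
  subst hx
  obtain rfl := funext hy
  have hex := hX.exists_graft (U := fun i => corolla (k i)) _ _ h
  have key : hex.choose = X.map (graftCorollaHom p q).op z := by
    obtain ⟨h1, h2⟩ := hex.choose_spec
    refine hX.ext (fun e => ?_) fun v => ?_
    · refine Eq.trans ?_ (X.edge_map (graftCorollaHom p q) z e).symm
      rcases e with _ | ⟨i, e⟩
      · exact (X.edge_opAt_none _ (graftOp _)).symm.trans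
          ((congrArg (fun w => X.edge w none) h1).trans (X.edge_opAt_none z p))
      · refine (X.edge_map (graftHom _ i) hex.choose e).symm.trans
          ((congrArg (fun w => X.edge w e) (h2 i)).trans ?_)
        cases e with
        | none => exact X.edge_opAt_none z (q i)
        | some j => exact X.edge_opAt_some z (q i) j
    · rcases v with _ | ⟨i, ⟨⟩⟩
      · exact ⟨_, _, graft_enumerates_none _, h1.trans
          (X.opAt_map (graftCorollaHom p q) z (graftOp _)).symm⟩
      · refine ⟨_, _, graft_enumerates_some (corolla_enumerates (k i)), ?_⟩
        refine (X.opAt_map (graftHom _ i) hex.choose (corollaOp (k i))).symm.trans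
          ((congrArg (fun w => X.opAt w (corollaOp (k i))) (h2 i)).trans ?_)
        exact (X.opAt_corollaOp _).trans (X.opAt_map (graftCorollaHom p q) z
          (.vertex _ _ (graft_enumerates_some (corolla_enumerates (k i))))).symm
  exact (congrArg (fun w => X.opAt w (graftCorollaOp k)) key).trans
    (X.opAt_map (graftCorollaHom p q) z (graftCorollaOp k))

theorem edge_compVal_some {n : ℕ} {k : Fin n → ℕ} (x : X.obj (op (corolla n)))
    (y : ∀ i, X.obj (op (corolla (k i))))
    (h : ∀ i, X.edge (y i) none = X.edge x (some i)) (l : Fin (∑ i, k i)) :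
    X.edge (hX.compVal x y h) (some l) = X.edge (y (blocks k l).1) (some (blocks k l).2) := by
  have hex := hX.exists_graft (U := fun i => corolla (k i)) _ _ h
  refine (X.edge_opAt_some _ (graftCorollaOp k) l).trans ?_
  rw [← hex.choose_spec.2]
  exact (X.edge_map _ _ _).symm

theorem edge_compVal_none {n : ℕ} {k : Fin n → ℕ} (x : X.obj (op (corolla n)))
    (y : ∀ i, X.obj (op (corolla (k i))))
    (h : ∀ i, X.edge (y i) none = X.edge x (some i)) :
    X.edge (hX.compVal x y h) none = X.edge x none := by
  have hex := hX.exists_graft (U := fun i => corolla (k i)) _ _ h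
  refine (X.edge_opAt_none _ (graftCorollaOp k)).trans ?_
  exact (X.edge_opAt_none hex.choose (graftOp _)).symm.trans
    (congrArg (fun w => X.edge w none) hex.choose_spec.1)

theorem opAt_map_op {S T : Tree} {g : S ⟶ T} {z : X.obj (op T)} {y : X.obj (op S)}
    (h : X.map g.op z = y) {n : ℕ} {c : Fin n → S.Edge} {d : S.Edge} (p : S.Operation c d) :
    X.opAt z (map_op g p) = X.opAt y p :=
  h ▸ (X.opAt_map g z p).symm

/-- The counterpart of `compVal_opAt` for permutations: they too can be computed inside any ambient
dendrex. -/
theorem map_corollaPerm_opAt {T : Tree} (z : X.obj (op T)) {m n : ℕ} (σ : Fin m ≃ Fin n)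
    {c : Fin n → T.Edge} {c' : Fin m → T.Edge} {d : T.Edge} (h : ∀ i, c' i = c (σ i))
    (p : T.Operation c d) {x : X.obj (op (corolla n))} (hx : X.opAt z p = x) :
    X.map (corollaPerm σ).op x = X.opAt z (.act σ h p) :=
  hx ▸ (X.opAt_act z σ h p _).symm

/-- The operad of a strict inner Kan complex: its operations are the dendrices whose shape is a
corolla. -/
noncomputable def operad : Operad.{u} where
  Color := X.obj (op eta)
  Op {n} c d := {x : X.obj (op (corolla n)) // (∀ i, X.edge x (some i) = c i) ∧ X.edge x none = d}
  one c := ⟨X.opAt c (.one (T := eta) ()),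
    fun _ => (X.edge_opAt_some c (.one (T := eta) ()) _).trans (X.edge_eta c),
    (X.edge_opAt_none c (.one (T := eta) ())).trans (X.edge_eta c)⟩
  act σ c c' d h p := ⟨X.map (corollaPerm σ).op p.1,
    fun i => (X.edge_map (corollaPerm σ) p.1 (some i)).trans ((p.2.1 _).trans (h i).symm),
    (X.edge_map (corollaPerm σ) p.1 none).trans p.2.2⟩
  comp p q := ⟨hX.compVal p.1 (fun i => (q i).1) fun i => (q i).2.2.trans (p.2.1 i).symm,
    fun l => (hX.edge_compVal_some _ _ _ l).trans ((q _).2.1 _),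
    (hX.edge_compVal_none _ _ _).trans p.2.2⟩
  act_refl p := Subtype.ext <|
    (map_corollaPerm_opAt p.1 (.refl _) (fun _ => rfl) _ (X.opAt_corollaOp _)).trans
      (X.opAt_corollaOp p.1)
  act_act τ σ _ _ _ _ h h' p := Subtype.ext <| by
    have hp := X.opAt_corollaOp p.1
    exact (map_corollaPerm_opAt p.1 τ (fun _ => rfl) _
      (map_corollaPerm_opAt p.1 σ (fun _ => rfl) _ hp).symm).trans
      (map_corollaPerm_opAt p.1 (τ.trans σ) (fun _ => rfl) _ hp).symm
  one_comp {n c d} p := Subtype.ext <| by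
    have hp := X.opAt_corollaOp p.1
    -- For the unit laws `p` itself is the ambient dendrex: its restriction to a unit is the unit on
    -- the colour concerned.
    have h1 : X.opAt p.1 (.one (T := corolla n) none) = X.opAt d (.one (T := eta) ()) :=
      (X.opAt_one _ _).trans (congrArg (fun e => X.opAt e (.one (T := eta) ())) p.2.2)
    exact (hX.compVal_opAt p.1 _ (fun _ => corollaOp n) h1 (fun _ => hp)).trans
      (map_corollaPerm_opAt p.1 (oneBlock n) (concat_oneBlock some) _ hp).symm
  comp_one {n c d} p := Subtype.ext <| by
    have hp := X.opAt_corollaOp p.1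
    have h1 : ∀ i, X.opAt p.1 (.one (T := corolla n) (some i)) =
        X.opAt (c i) (.one (T := eta) ()) := fun i =>
      (X.opAt_one _ _).trans (congrArg (fun e => X.opAt e (.one (T := eta) ())) (p.2.1 i))
    exact (hX.compVal_opAt p.1 (corollaOp n) _ hp h1).trans
      (map_corollaPerm_opAt p.1 (unitBlocks n) (concat_unitBlocks some) _ hp).symm
  act_comp {m n} σ {k c b d} p q := Subtype.ext <| by
    -- In the graft `z` of `p` and the `q i`, both sides are values of `z` on operations with equal
    -- inputs and output, and such operations of a tree coincide.
    obtain ⟨z, h1, h2⟩ := hX.exists_graft (U := fun i => corolla (k i)) p.1 (fun i => (q i).1)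
      fun i => (q i).2.2.trans (p.2.1 i).symm
    have hq : ∀ i, X.opAt z (map_op (graftHom (fun i => corolla (k i)) i) (corollaOp (k i))) =
        (q i).1 := fun i =>
      (opAt_map_op (h2 i) _).trans (X.opAt_corollaOp _)
    exact (hX.compVal_opAt z _ _ (map_corollaPerm_opAt z σ (fun _ => rfl) _ h1).symm
      (fun i => hq (σ i))).trans
      (map_corollaPerm_opAt z (permBlocks σ k) (concat_permBlocks σ _) _
        (hX.compVal_opAt z _ _ h1 hq).symm).symm
  comp_act {n k k'} τ {c b b' d} h p q := Subtype.ext <| by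
    obtain ⟨z, h1, h2⟩ := hX.exists_graft (U := fun i => corolla (k i)) p.1 (fun i => (q i).1)
      fun i => (q i).2.2.trans (p.2.1 i).symm
    have hq : ∀ i, X.opAt z (map_op (graftHom (fun i => corolla (k i)) i) (corollaOp (k i))) =
        (q i).1 := fun i =>
      (opAt_map_op (h2 i) _).trans (X.opAt_corollaOp _)
    exact (hX.compVal_opAt z _ _ h1
      (fun i => (map_corollaPerm_opAt z (τ i) (fun _ => rfl) _ (hq i)).symm)).trans
      (map_corollaPerm_opAt z (permInBlocks τ) (concat_permInBlocks τ fun _ _ => rfl) _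
        (hX.compVal_opAt z _ _ h1 hq).symm).symm
  assoc {n k l c b a d} p q r := Subtype.ext <| by
    -- Associativity takes place in a tree of height three: first graft the `r i j` on `q i`, then
    -- the results on `p`.
    choose y h3 h4 using fun i => hX.exists_graft (U := fun j => corolla (l i j)) (q i).1
      (fun j => (r i j).1) fun j => (r i j).2.2.trans ((q i).2.1 j).symm
    obtain ⟨z, h1, h2⟩ := hX.exists_graft p.1 y fun i => by
      rw [p.2.1, ← (q i).2.2, ← h3 i]
      exact (X.edge_opAt_none (y i) (graftOp _)).symm
    have hq : ∀ i, X.opAt z (map_op (graftHom _ i) (graftOp fun j => corolla (l i j))) =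
        (q i).1 := fun i => (opAt_map_op (h2 i) _).trans (h3 i)
    have hr : ∀ i j, X.opAt z (map_op (graftHom _ i)
        (map_op (graftHom (fun j => corolla (l i j)) j) (corollaOp (l i j)))) = (r i j).1 :=
      fun i j => (opAt_map_op (h2 i) _).trans
        ((opAt_map_op (h4 i j) _).trans (X.opAt_corollaOp _))
    exact (hX.compVal_opAt z _ _ (hX.compVal_opAt z _ _ h1 hq).symm
      (fun y => hr (blocks k y).1 (blocks k y).2)).trans
      (map_corollaPerm_opAt z (assocBlocks l) (concat_assocBlocks l _) _
        (hX.compVal_opAt z _ _ h1 (fun i =>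
          (hX.compVal_opAt z _ _ (hq i) (hr i)).symm)).symm).symm

end IsStrictInnerKan

/-! ### The operad of a tree is free -/

/-- The values of a map from the operad of `T` to `P` on the edges and vertices. -/
structure FreeData (T : Tree) (P : Operad.{u}) where
  /-- the values on the edges -/
  color : T.Edge → P.Color
  /-- the number of inputs of a vertex -/
  arity : T.Vertex → ℕ
  /-- the inputs of a vertex -/
  input : ∀ v, Fin (arity v) → T.Edge
  enum : ∀ v, T.Enumerates v (input v)
  /-- the values on the vertices -/
  op : ∀ v, P.Op (fun i => color (input v i)) (color (T.out v))

namespace FreeData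

variable {T : Tree} {P : Operad.{u}} (D : FreeData T P)

/-- `D.Eval c d p`: the operation `p` is a composite of values of vertices of `T`, with inputs `c`
and output `d`. -/
inductive Eval : {n : ℕ} → (c : Fin n → T.Edge) → (d : T.Edge) →
    P.Op (fun i => D.color (c i)) (D.color d) → Prop
  | one (e : T.Edge) : Eval (fun _ : Fin 1 => e) e (P.one (D.color e))
  | node (v : T.Vertex) {k : Fin (D.arity v) → ℕ} {b : ∀ i, Fin (k i) → T.Edge}
      {q : ∀ i, P.Op (fun j => D.color (b i j)) (D.color (D.input v i))}
      (hq : ∀ i, Eval (b i) (D.input v i) (q i)) :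
      Eval (concat b) (T.out v) (P.comp (D.op v) q)
  | act {m n : ℕ} (σ : Fin m ≃ Fin n) {c : Fin n → T.Edge} {c' : Fin m → T.Edge} {d : T.Edge}
      (h : ∀ i, c' i = c (σ i)) {p : P.Op (fun i => D.color (c i)) (D.color d)}
      (hp : Eval c d p) : Eval c' d (P.act σ (fun i => congrArg D.color (h i)) p)

variable {D}

theorem Eval.operation {n : ℕ} {c : Fin n → T.Edge} {d : T.Edge}
    {p : P.Op (fun i => D.color (c i)) (D.color d)} (h : D.Eval c d p) : T.Operation c d := by
  induction h with
  | one e => exact .one e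
  | node v hq ih => exact .comp (.vertex v _ (D.enum v)) ih
  | act σ h hp ih => exact .act σ h ih

/-- The two normal forms of a composite. -/
inductive NormalForm (D : FreeData T P) {n : ℕ} (c : Fin n → T.Edge) :
    (d : T.Edge) → P.Op (fun i => D.color (c i)) (D.color d) → Prop
  | one (d : T.Edge) (σ : Fin n ≃ Fin 1) (h : ∀ i, c i = d) :
      NormalForm D c d (P.act σ (fun i => congrArg D.color (h i)) (P.one (D.color d)))
  | node (v : T.Vertex) {k : Fin (D.arity v) → ℕ} {b : ∀ i, Fin (k i) → T.Edge}
      {q : ∀ i, P.Op (fun j => D.color (b i j)) (D.color (D.input v i))}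
      (hq : ∀ i, D.Eval (b i) (D.input v i) (q i)) (σ : Fin n ≃ Fin (∑ i, k i))
      (h : ∀ i, c i = concat b (σ i)) :
      NormalForm D c (T.out v)
        (P.act σ (c := concat fun i j => D.color (b i j)) (fun i => congrArg D.color (h i))
          (P.comp (D.op v) q))

/-- Successive permutations merge into one outermost permutation, which leaves a unit or a vertex at
the bottom. -/
theorem Eval.normalForm {n : ℕ} {c : Fin n → T.Edge} {d : T.Edge}
    {p : P.Op (fun i => D.color (c i)) (D.color d)} (h : D.Eval c d p) : D.NormalForm c d p := by
  induction h with
  | one e =>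
    have := NormalForm.one (D := D) (c := fun _ => e) e (.refl _) fun _ => rfl
    rwa [P.act_refl] at this
  | @node v k b q hq _ =>
    have h : P.act (.refl _) (fun _ => rfl) (P.comp (D.op v) q) = P.comp (D.op v) q :=
      P.act_refl _
    rw [← h]
    exact .node v hq (.refl _) fun _ => rfl
  | @act m n σ c c' d h p hp ih =>
    cases ih with
    | one d τ h' =>
      rw [P.act_act]
      exact .one d (σ.trans τ) fun i => (h i).trans (h' (σ i))
    | node v hq τ h' =>
      rw [P.act_act]
      exact .node v hq (σ.trans τ) fun i => (h i).trans (h' (σ i))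

/-- The inputs lie strictly above the output as soon as a vertex is involved. Hence the profile
alone tells the two normal forms apart. -/
theorem concat_ne_out {v : T.Vertex} {k : Fin (D.arity v) → ℕ} {b : ∀ i, Fin (k i) → T.Edge}
    (hb : ∀ i, T.Operation (b i) (D.input v i)) (x : Fin (∑ i, k i)) :
    concat b x ≠ T.out v := fun h => by
  refine not_above_out (((D.enum v).2 _).1 ⟨(blocks k x).1, rfl⟩) ?_
  rw [← h]
  exact (hb _).isCut.above _

theorem NormalForm.exists_one {n : ℕ} {c : Fin n → T.Edge} {d : T.Edge}
    {p : P.Op (fun i => D.color (c i)) (D.color d)} (hp : D.NormalForm c d p) {i : Fin n}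
    (hi : c i = d) : ∃ (σ : Fin n ≃ Fin 1) (h : ∀ i, c i = d),
      p = P.act σ (fun i => congrArg D.color (h i)) (P.one (D.color d)) := by
  cases hp with
  | one _ σ h => exact ⟨σ, h, rfl⟩
  | node v hq σ h =>
    exact absurd ((h i).symm.trans hi) (concat_ne_out (fun i => (hq i).operation) _)

theorem NormalForm.exists_node {n : ℕ} {c : Fin n → T.Edge} {d : T.Edge}
    {p : P.Op (fun i => D.color (c i)) (D.color d)} (hp : D.NormalForm c d p)
    (hc : ∀ i, c i ≠ d) {v : T.Vertex} (hv : T.out v = d) :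
    ∃ (k : Fin (D.arity v) → ℕ) (b : ∀ i, Fin (k i) → T.Edge)
      (q : ∀ i, P.Op (fun j => D.color (b i j)) (D.color (D.input v i)))
      (_ : ∀ i, D.Eval (b i) (D.input v i) (q i)) (σ : Fin n ≃ Fin (∑ i, k i))
      (h : ∀ i, c i = concat b (σ i)),
      P.recolor (fun _ => rfl) (congrArg D.color hv.symm) p =
        P.act σ (c := concat fun i j => D.color (b i j)) (fun i => congrArg D.color (h i))
          (P.comp (D.op v) q) := by
  cases hp with
  | one _ σ h => exact absurd (h (σ.symm 0)) (hc _)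
  | node w hq σ h =>
    obtain rfl := T.out_injective hv
    exact ⟨_, _, _, hq, σ, h, rfl⟩

theorem act_congr (P : Operad.{u}) {m n : ℕ} {σ τ : Fin m ≃ Fin n} {c : Fin n → P.Color}
    {c' : Fin m → P.Color} {d : P.Color} (hσ : ∀ i, c' i = c (σ i)) (hτ : ∀ i, c' i = c (τ i))
    (h : σ = τ) (p : P.Op c d) : P.act σ hσ p = P.act τ hτ p := by
  subst h
  rfl

/-- The blocks of a composite are determined by their union. -/
theorem exists_eq_block {v : T.Vertex} {k k' : Fin (D.arity v) → ℕ}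
    {b : ∀ i, Fin (k i) → T.Edge} {b' : ∀ i, Fin (k' i) → T.Edge}
    (hb : ∀ i, T.Operation (b i) (D.input v i)) (hb' : ∀ i, T.Operation (b' i) (D.input v i))
    (h : ∀ x, ∃ y, concat b' x = concat b y) (i : Fin (D.arity v)) :
    Set.range (b' i) ⊆ Set.range (b i) := by
  rintro _ ⟨j, rfl⟩
  obtain ⟨y, hy⟩ := h ((blocks k').symm ⟨i, j⟩)
  rw [concat_symm] at hy
  change b' i j = b (blocks k y).1 (blocks k y).2 at hy
  generalize blocks k y = s at hy
  obtain ⟨i', j'⟩ := s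
  have hcut := isCut_vertex (D.enum v)
  have h1 := (hb' i).isCut.above j
  have h2 := (hb i').isCut.above j'
  rw [← hy] at h2
  obtain rfl : i = i' := (h1.total h2).elim (hcut.antichain _ _)
    fun h => (hcut.antichain _ _ h).symm
  exact ⟨j', hy.symm⟩

/-- Composites with the same profile up to a permutation agree up to this permutation. -/
theorem Eval.unique {n : ℕ} {c : Fin n → T.Edge} {d : T.Edge}
    {p : P.Op (fun i => D.color (c i)) (D.color d)} (hp : D.Eval c d p) :
    ∀ {m : ℕ} {c' : Fin m → T.Edge} {p' : P.Op (fun i => D.color (c' i)) (D.color d)},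
      D.Eval c' d p' → ∀ (σ : Fin m ≃ Fin n) (h : ∀ i, c' i = c (σ i)),
        p' = P.act σ (fun i => congrArg D.color (h i)) p := by
  induction hp with
  | one e =>
    intro m c' p' hp' σ h
    obtain ⟨τ, h', rfl⟩ := hp'.normalForm.exists_one (h (σ.symm 0))
    exact act_congr P _ _ (Equiv.ext fun _ => Subsingleton.elim _ _) _
  | @node v k b q hq ih =>
    intro m c' p' hp' σ h
    have hb := fun i => (hq i).operation
    -- No input equals the output, so the other composite also has a vertex at the bottom, and this
    -- must be `v`.
    obtain ⟨k', b', q', hq', τ, h', hτ⟩ := hp'.normalForm.exists_node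
      (fun i hi => concat_ne_out hb _ ((h i).symm.trans hi)) rfl
    have hb' := fun i => (hq' i).operation
    have h1 : ∀ x, ∃ y, concat b' x = concat b y := fun x =>
      ⟨σ (τ.symm x), by rw [← h, h', τ.apply_symm_apply]⟩
    have h2 : ∀ x, ∃ y, concat b x = concat b' y := fun x =>
      ⟨τ (σ.symm x), by rw [← h', h, σ.apply_symm_apply]⟩
    -- The blocks over each input of `v` have the same edges, hence differ by a permutation, and
    -- induction compares the operations on them.
    choose ρ hρ using fun i => exists_equiv_of_range_eq (hb i).isCut.injective
      (hb' i).isCut.injective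
      ((exists_eq_block hb hb' h1 i).antisymm (exists_eq_block hb' hb h2 i))
    obtain rfl : q' = fun i => P.act (ρ i) (fun j => congrArg D.color (hρ i j)) (q i) :=
      funext fun i => ih i (hq' i) (ρ i) (hρ i)
    have hcomp := P.comp_act ρ (fun i j => congrArg D.color (hρ i j)) (D.op v) q
    refine (hτ.trans ((congrArg (P.act τ _) hcomp).trans (P.act_act _ _ _ _ _))).trans
      (act_congr P _ _ (Equiv.ext fun x => ?_) _)
    -- The total permutation is forced, because the inputs of an operation of a tree are distinct.
    refine (Operation.comp (.vertex v _ (D.enum v)) hb).isCut.injective ?_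
    rw [← h]
    exact ((h' x).trans (concat_permInBlocks ρ hρ _)).symm
  | act τ h hp ih =>
    intro m c' p' hp' σ h'
    rw [P.act_act]
    exact ih hp' (σ.trans τ) fun i => (h' i).trans (h (σ i))

/-- Puts a family over concatenated or permuted indices into the shape in which the operad axioms
state it. -/
theorem exists_reindex {α β : Type*} (e : α ≃ β) {F : β → Type*} (f : ∀ a, F (e a)) :
    ∃ g : ∀ b, F b, f = fun a => g (e a) :=
  ⟨Equiv.piCongrLeft F e f, funext fun a => (Equiv.piCongrLeft_apply_apply F e f a).symm⟩

variable (D) in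
/-- Composites with a given output. -/
structure Composite (d : T.Edge) where
  /-- the number of inputs -/
  arity : ℕ
  /-- the inputs -/
  input : Fin arity → T.Edge
  /-- the operation -/
  op : P.Op (fun i => D.color (input i)) (D.color d)
  eval : D.Eval input d op

/-- Induction on the outer composite, using the unit law, associativity and equivariance in the
three cases. Packing the inner data into `Composite` lets the whole family be reindexed at once. -/
theorem Eval.comp_composite {n : ℕ} {c : Fin n → T.Edge} {d : T.Edge}
    {p : P.Op (fun i => D.color (c i)) (D.color d)} (hp : D.Eval c d p)
    (F : ∀ i, D.Composite (c i)) :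
    D.Eval (concat fun i => (F i).input) d (P.comp p fun i => (F i).op) := by
  induction hp with
  | one e =>
    obtain ⟨G, rfl⟩ : ∃ G : D.Composite e, F = fun _ => G :=
      ⟨F 0, funext fun i => by rw [Subsingleton.elim i 0]⟩
    have := Eval.act (oneBlock G.arity) (concat_oneBlock G.input) G.eval
    rw [P.one_comp]
    exact this
  | @node v k b q hq ih =>
    obtain ⟨G, rfl⟩ : ∃ G : ∀ i j, D.Composite (b i j),
        F = fun x => G (blocks k x).1 (blocks k x).2 := by
      obtain ⟨G, hG⟩ := exists_reindex (blocks k) (F := fun s => D.Composite (b s.1 s.2)) F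
      exact ⟨fun i j => G ⟨i, j⟩, hG⟩
    have := Eval.act (assocBlocks fun i j => (G i j).arity)
      (concat_assocBlocks (fun i j => (G i j).arity) fun i j => (G i j).input)
      (Eval.node v fun i => ih i (G i))
    rw [P.assoc (D.op v) q fun i j => (G i j).op]
    exact this
  | @act m n σ c c' d h p hp ih =>
    obtain rfl := funext h
    obtain ⟨G, rfl⟩ := exists_reindex σ (F := fun i => D.Composite (c i)) F
    have := Eval.act (permBlocks σ fun i => (G i).arity)
      (concat_permBlocks σ fun i => (G i).input) (ih G)
    rw [P.act_comp σ p fun i => (G i).op]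
    exact this

theorem Eval.comp {n : ℕ} {k : Fin n → ℕ} {c : Fin n → T.Edge} {b : ∀ i, Fin (k i) → T.Edge}
    {d : T.Edge} {p : P.Op (fun i => D.color (c i)) (D.color d)}
    {q : ∀ i, P.Op (fun j => D.color (b i j)) (D.color (c i))} (hp : D.Eval c d p)
    (hq : ∀ i, D.Eval (b i) (c i) (q i)) : D.Eval (concat b) d (P.comp p q) :=
  hp.comp_composite fun i => ⟨k i, b i, q i, hq i⟩

variable (D)

/-- `Eval` has no constructor for a bare vertex: compose it with units and undo the resulting
permutation. -/
theorem eval_vertex (v : T.Vertex) : D.Eval (D.input v) (T.out v) (D.op v) := by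
  have h := Eval.act (unitBlocks _).symm (c' := D.input v)
    (fun i => congrArg (D.input v) ((unitBlocks _).apply_symm_apply i).symm)
    (Eval.node v fun i => Eval.one (D.input v i))
  rw [P.comp_one, P.act_act] at h
  have h' := P.act_refl (D.op v)
  rw [← h']
  refine (act_congr P _ _ ?_ _ : _ = _) ▸ h
  simp

theorem exists_eval {n : ℕ} {c : Fin n → T.Edge} {d : T.Edge} (p : T.Operation c d) :
    ∃ q, D.Eval c d q := by
  induction p with
  | vertex v c hc =>
    obtain ⟨σ, hσ⟩ := (D.enum v).exists_equiv hc
    exact ⟨_, .act σ hσ (D.eval_vertex v)⟩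
  | one e => exact ⟨_, .one e⟩
  | act σ h _ ih =>
    obtain ⟨q, hq⟩ := ih
    exact ⟨_, .act σ h hq⟩
  | comp _ _ ih ih' =>
    obtain ⟨q, hq⟩ := ih
    choose r hr using ih'
    exact ⟨_, hq.comp hr⟩

variable {D} in
/-- Values on the same profile agree. -/
theorem Eval.eq {n : ℕ} {c : Fin n → T.Edge} {d : T.Edge}
    {p q : P.Op (fun i => D.color (c i)) (D.color d)} (hp : D.Eval c d p)
    (hq : D.Eval c d q) : p = q :=
  ((hp.unique hq (.refl _) fun _ => rfl).trans (P.act_refl p)).symm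

/-- The map of operads with the given values on the edges and vertices. -/
noncomputable def hom : Operad.Hom T.operad P where
  color := D.color
  op p := (D.exists_eval p.down).choose
  op_one e := Eval.eq (D.exists_eval (.one e)).choose_spec (.one e)
  op_act σ _ _ _ h p := Eval.eq (D.exists_eval (.act σ h p.down)).choose_spec
    (.act σ h (D.exists_eval p.down).choose_spec)
  op_comp p q := Eval.eq (D.exists_eval (.comp p.down fun i => (q i).down)).choose_spec
    ((D.exists_eval p.down).choose_spec.comp fun i => (D.exists_eval (q i).down).choose_spec)

theorem hom_op_vertex (v : T.Vertex) :
    D.hom.op (c := D.input v) (d := T.out v) ⟨.vertex v _ (D.enum v)⟩ = D.op v :=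
  Eval.eq (D.exists_eval (.vertex v _ (D.enum v))).choose_spec (D.eval_vertex v)

end FreeData

/-- A map from the operad of a tree is determined by its values on the edges and vertices. -/
theorem hom_ext_vertex {T : Tree} {P : Operad.{u}} {f g : Operad.Hom T.operad P}
    (hc : ∀ e : T.Edge, f.color e = g.color e)
    (hv : ∀ v, ∃ (n : ℕ) (c : Fin n → T.Edge) (hc' : T.Enumerates v c),
      P.recolor (fun i => hc (c i)) (hc (T.out v))
        (f.op (c := c) (d := T.out v) ⟨.vertex v c hc'⟩) =
      g.op (c := c) (d := T.out v) ⟨.vertex v c hc'⟩) : f = g := by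
  obtain ⟨fc, fo, f1, f2, f3⟩ := f
  obtain ⟨gc, go, g1, g2, g3⟩ := g
  obtain rfl : fc = gc := funext hc
  have key : ∀ {n : ℕ} {c : Fin n → T.Edge} {d : T.Edge} (p : T.Operation c d),
      fo (c := c) (d := d) ⟨p⟩ = go (c := c) (d := d) ⟨p⟩ := by
    intro n c d p
    induction p with
    | vertex v c hc =>
      obtain ⟨m, a, ha, h⟩ := hv v
      obtain ⟨σ, hσ⟩ := ha.exists_equiv hc
      refine (f2 σ (c := a) (d := T.out v) hσ ⟨.vertex v a ha⟩).trans (Eq.trans ?_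
        (g2 σ (c := a) (d := T.out v) hσ ⟨.vertex v a ha⟩).symm)
      exact congrArg (P.act σ _) h
    | one e => exact (f1 e).trans (g1 e).symm
    | @act m n σ c c' d h p ih =>
      exact (f2 σ (c := c) (d := d) h ⟨p⟩).trans
        ((congrArg (P.act σ _) ih).trans (g2 σ (c := c) (d := d) h ⟨p⟩).symm)
    | @comp n k c b d p q ih ih' =>
      refine (f3 (c := c) (d := d) (b := b) ⟨p⟩ fun i => ⟨q i⟩).trans (Eq.trans ?_
        (g3 (c := c) (d := d) (b := b) ⟨p⟩ fun i => ⟨q i⟩).symm)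
      rw [ih]
      exact congrArg (P.comp _) (funext ih')
  exact Operad.Hom.ext' (fun _ => rfl) fun p => key p.down

/-! ### Operations with their profiles -/

/-- An operation together with its colours. -/
def Operad.bundle (P : Operad.{u}) {n : ℕ} {c : Fin n → P.Color} {d : P.Color} (p : P.Op c d) :
    Σ s : (Fin n → P.Color) × P.Color, P.Op s.1 s.2 :=
  ⟨(c, d), p⟩

/-- Bundling makes recolouring invisible, so values on different faces can be compared without
transports. -/
theorem Operad.bundle_recolor (P : Operad.{u}) {n : ℕ} {c c' : Fin n → P.Color} {d d' : P.Color}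
    (hc : ∀ i, c i = c' i) (hd : d = d') (p : P.Op c d) :
    P.bundle (P.recolor hc hd p) = P.bundle p := by
  obtain rfl := funext hc
  subst hd
  rfl

theorem Operad.recolor_eq_of_bundle (P : Operad.{u}) {n : ℕ} {c c' : Fin n → P.Color}
    {d d' : P.Color} {p : P.Op c d} {p' : P.Op c' d'} (h : P.bundle p = P.bundle p')
    (hc : ∀ i, c i = c' i) (hd : d = d') : P.recolor hc hd p = p' := by
  obtain rfl := funext hc
  subst hd
  exact eq_of_heq (Sigma.mk.inj h).2

theorem hom_ext_bundle {T : Tree} {P : Operad.{u}} {f g : Operad.Hom T.operad P}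
    (hc : ∀ e : T.Edge, f.color e = g.color e)
    (hv : ∀ v, ∃ (n : ℕ) (c : Fin n → T.Edge) (hc' : T.Enumerates v c),
      P.bundle (f.op (c := c) (d := T.out v) ⟨.vertex v c hc'⟩) =
      P.bundle (g.op (c := c) (d := T.out v) ⟨.vertex v c hc'⟩)) : f = g :=
  hom_ext_vertex hc fun v => by
    obtain ⟨n, c, hc', h⟩ := hv v
    exact ⟨n, c, hc', P.recolor_eq_of_bundle h _ _⟩

/-- The value of a map on an operation. -/
def homBundle {T : Tree} {P : Operad.{u}} (f : Operad.Hom T.operad P) {n : ℕ}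
    {c : Fin n → T.Edge} {d : T.Edge} (p : T.Operation c d) :
    Σ s : (Fin n → P.Color) × P.Color, P.Op s.1 s.2 :=
  P.bundle (f.op (c := c) (d := d) ⟨p⟩)

theorem homBundle_congr {T : Tree} {P : Operad.{u}} (f : Operad.Hom T.operad P) {n : ℕ}
    {c c' : Fin n → T.Edge} {d d' : T.Edge} (hc : ∀ i, c i = c' i) (hd : d = d')
    (p : T.Operation c d) (p' : T.Operation c' d') : homBundle f p = homBundle f p' := by
  obtain rfl := funext hc
  subst hd
  rfl

/-! ### Nerves are strict inner Kan complexes -/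

theorem outerFace_below {T : Tree} {v : T.Vertex} (hv : T.IsOuter v)
    (x : (T.outerFace v hv).Edge) (w : (T.outerFace v hv).Vertex) :
    (T.outerFace v hv).below x = some w ↔ T.below x.1 = some w.1 := by
  classical
  obtain ⟨w, hw⟩ := w
  change ((T.below x.1).bind fun w => if h : w = v then none
    else some (⟨w, h⟩ : {w : T.Vertex // w ≠ v})) = some ⟨w, hw⟩ ↔ _
  cases T.below x.1 with
  | none => simp
  | some w' =>
    by_cases h : w' = v
    · subst h
      simp [Ne.symm hw]
    · simp [h]

/-- An input of another vertex can be attached to `v` only as the output of `v`, and then it is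
inner. -/
theorem remains_of_below {T : Tree} {v w : T.Vertex} (hw : w ≠ v) {x : T.Edge}
    (hx : T.below x = some w) : T.Remains v x := by
  rintro (h | h)
  · exact ⟨ne_root_of_below hx, v, h⟩
  · exact absurd (Option.some.inj (hx.symm.trans h)) hw

theorem outerFace_enumerates {T : Tree} {v w : T.Vertex} (hv : T.IsOuter v) (hw : w ≠ v)
    {n : ℕ} {a : Fin n → T.Edge} (ha : T.Enumerates w a) :
    (T.outerFace v hv).Enumerates ⟨w, hw⟩
      fun i => ⟨a i, remains_of_below hw ((ha.2 _).1 ⟨i, rfl⟩)⟩ := by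
  refine ⟨fun i j h => ha.1 (congrArg Subtype.val h), fun x => ?_⟩
  refine Iff.trans ?_ ((ha.2 x.1).trans (outerFace_below hv x ⟨w, hw⟩).symm)
  exact ⟨fun ⟨i, hi⟩ => ⟨i, congrArg Subtype.val hi⟩, fun ⟨i, hi⟩ => ⟨i, Subtype.ext hi⟩⟩

section

variable {P : Operad.{u}} {T : Tree} {e : T.Edge} {he : T.IsInner e}

/-- The map of operads given by a member of a horn family in a nerve. -/
def HornFamily.faceHom (y : HornFamily (nerve.obj P) T e he) (F : T.Face)
    (hF : F ≠ .inner e he) : Operad.Hom F.source.operad P := y.val F hF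

theorem HornFamily.faceHom_color_eq (y : HornFamily (nerve.obj P) T e he) {F F' : T.Face}
    (hF : F ≠ .inner e he) (hF' : F' ≠ .inner e he) {f : F.source.Edge} {f' : F'.source.Edge}
    (h : edgeMap F.map f = edgeMap F'.map f') :
    (y.faceHom F hF).color f = (y.faceHom F' hF').color f' := by
  have := y.compat F F' hF hF' (edgeHom f) (edgeHom f') (hom_ext fun _ => h)
  exact congrArg (fun g : Operad.Hom eta.operad P => g.color (show eta.Edge from ())) this

/-- Both operations are the same corolla in `T`, so compatibility applies to the two maps from this
corolla to the faces. -/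
theorem HornFamily.faceHom_op_eq (y : HornFamily (nerve.obj P) T e he) {F F' : T.Face}
    (hF : F ≠ .inner e he) (hF' : F' ≠ .inner e he) {n : ℕ} {c : Fin n → F.source.Edge}
    {d : F.source.Edge} {c' : Fin n → F'.source.Edge} {d' : F'.source.Edge}
    (p : F.source.Operation c d) (p' : F'.source.Operation c' d')
    (hc : ∀ i, edgeMap F.map (c i) = edgeMap F'.map (c' i))
    (hd : edgeMap F.map d = edgeMap F'.map d') :
    homBundle (y.faceHom F hF) p = homBundle (y.faceHom F' hF') p' := by
  have := y.compat F F' hF hF' (opHom p) (opHom p') (hom_ext fun x => by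
    cases x with
    | none => exact hd
    | some i => exact hc i)
  exact congrArg (fun g : Operad.Hom (corolla n).operad P => homBundle g (corollaOp n)) this

theorem exists_lift_face (he : T.IsInner e) {n : ℕ} {c : Fin n → T.Edge} {d : T.Edge}
    (p : T.Operation c d) (hp : T.IsProper c d) :
    ∃ (v : T.Vertex) (hv : T.IsOuter v) (c' : Fin n → (Face.outer v hv).source.Edge)
      (d' : (Face.outer v hv).source.Edge), (Face.outer v hv).source.Operation c' d' ∧
      (∀ i, edgeMap (Face.outer v hv).map (c' i) = c i) ∧
      edgeMap (Face.outer v hv).map d' = d := by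
  obtain ⟨v, hv, c', d', q, rfl, rfl⟩ := exists_lift_outerFace he p hp
  exact ⟨v, hv, c', d', q, fun _ => rfl, rfl⟩

/-- The values of a horn family in a nerve on the edges and vertices of `T`. -/
theorem HornFamily.exists_freeData (y : HornFamily (nerve.obj P) T e he) :
    ∃ D : FreeData T P,
      (∀ (F : T.Face) (hF : F ≠ .inner e he) (f : F.source.Edge),
        D.color (edgeMap F.map f) = (y.faceHom F hF).color f) ∧
      ∀ (v : T.Vertex) (F : T.Face) (hF : F ≠ .inner e he) (c : Fin (D.arity v) → F.source.Edge)
        (d : F.source.Edge) (p : F.source.Operation c d),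
        (∀ i, edgeMap F.map (c i) = D.input v i) → edgeMap F.map d = T.out v →
        P.bundle (D.op v) = homBundle (y.faceHom F hF) p := by
  -- Units and vertices are proper, so every edge and every vertex of `T` lies on an outer face. The
  -- faces are chosen arbitrarily; compatibility gives independence of the choice.
  have hE : ∀ x : T.Edge, ∃ (F : T.Face) (hF : F ≠ .inner e he) (f : F.source.Edge),
      edgeMap F.map f = x := by
    intro x
    obtain ⟨v, hv, c, d, -, -, hd⟩ := exists_lift_face he (.one x) (isProper_one he x)
    exact ⟨_, by simp, d, hd⟩
  choose F hF f hf using hE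
  choose n a ha using T.exists_enumerates
  have hV : ∀ v : T.Vertex, ∃ (F : T.Face) (_ : F ≠ .inner e he)
      (c : Fin (n v) → F.source.Edge) (d : F.source.Edge) (_ : F.source.Operation c d),
      (∀ i, edgeMap F.map (c i) = a v i) ∧ edgeMap F.map d = T.out v := by
    intro v
    obtain ⟨w, hw, c, d, p, hc, hd⟩ :=
      exists_lift_face he (.vertex v _ (ha v)) (isProper_vertex he (ha v))
    exact ⟨_, by simp, c, d, p, hc, hd⟩
  choose G hG c d p hc hd using hV
  refine ⟨{
    color := fun x => (y.faceHom (F x) (hF x)).color (f x)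
    arity := n
    input := a
    enum := ha
    op := fun v => P.recolor
      (fun i => y.faceHom_color_eq _ _ ((hc v i).trans (hf _).symm))
      (y.faceHom_color_eq _ _ ((hd v).trans (hf _).symm))
      ((y.faceHom (G v) (hG v)).op (c := c v) (d := d v) ⟨p v⟩) },
    fun F' hF' f' => y.faceHom_color_eq _ _ (hf _), fun v F' hF' c' d' p' hc' hd' => ?_⟩
  refine (P.bundle_recolor
    (fun i => y.faceHom_color_eq (hG v) (hF _) ((hc v i).trans (hf _).symm))
    (y.faceHom_color_eq (hG v) (hF _) ((hd v).trans (hf _).symm)) _).trans ?_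
  exact y.faceHom_op_eq (hG v) hF' (p v) p' (fun i => (hc v i).trans (hc' i).symm)
    ((hd v).trans hd'.symm)

/-- By freeness the values on edges and vertices define a map on the operad of `T`. It restricts
correctly to outer faces, whose vertices are vertices of `T`. A vertex of any other face of the horn
is a proper operation, which lifts to an outer face. -/
theorem HornFamily.exists_fills_nerve (y : HornFamily (nerve.obj P) T e he) :
    ∃ x, y.Fills x := by
  obtain ⟨D, hcol, hop⟩ := y.exists_freeData
  have outer : ∀ (v : T.Vertex) (hv : T.IsOuter v) (hF : Face.outer v hv ≠ .inner e he),
      Operad.Hom.comp (Face.outer v hv).map D.hom = y.faceHom (.outer v hv) hF := by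
    intro v hv hF
    refine hom_ext_bundle (T := (Face.outer v hv).source) (fun x => hcol _ hF x) ?_
    rintro ⟨w, hw⟩
    refine ⟨_, _, outerFace_enumerates hv hw (D.enum w), ?_⟩
    refine Eq.trans (congrArg P.bundle (D.hom_op_vertex w)) ?_
    exact hop w (.outer v hv) hF _ _ _ (fun _ => rfl) rfl
  refine ⟨D.hom, fun F hF => ?_⟩
  refine hom_ext_bundle (T := F.source) (f := Operad.Hom.comp F.map D.hom)
    (g := y.faceHom F hF) (fun x => hcol _ hF x) fun w => ?_
  obtain ⟨m, a, ha⟩ := F.source.exists_enumerates w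
  refine ⟨m, a, ha, ?_⟩
  obtain ⟨e', he'⟩ := F.exists_edge he hF
  obtain ⟨v, hv, c', d', q, hc, hd⟩ := exists_lift_face he (map_op F.map (.vertex w a ha))
    (isProper_map_vertex (F.map_injective he) (he'.symm ▸ he) ha)
  have hF' : Face.outer v hv ≠ .inner e he := by simp
  have h1 : homBundle D.hom (map_op F.map (.vertex w a ha)) =
      homBundle D.hom (map_op (Face.outer v hv).map q) :=
    homBundle_congr D.hom (fun i => (hc i).symm) hd.symm _ _
  have h2 : homBundle (Operad.Hom.comp (Face.outer v hv).map D.hom) q =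
      homBundle (y.faceHom _ hF') q := by rw [outer v hv hF']
  exact h1.trans (h2.trans (y.faceHom_op_eq hF' hF q (.vertex w a ha) hc hd))

/-- The outer faces determine the values on proper operations, in particular on units and vertices.
-/
theorem HornFamily.fills_nerve_unique (y : HornFamily (nerve.obj P) T e he)
    {x x' : (nerve.obj P).obj (op T)} (hx : y.Fills x) (hx' : y.Fills x') : x = x' := by
  have key : ∀ {n : ℕ} {c : Fin n → T.Edge} {d : T.Edge} (p : T.Operation c d),
      T.IsProper c d → homBundle (P := P) x p = homBundle (P := P) x' p := by
    intro n c d p hp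
    obtain ⟨v, hv, c', d', q, hc, hd⟩ := exists_lift_face he p hp
    have h := (hx (.outer v hv) (by simp)).trans (hx' (.outer v hv) (by simp)).symm
    have h' := congrArg
      (fun g : Operad.Hom (Face.outer v hv).source.operad P => homBundle g q) h
    exact (homBundle_congr (P := P) x (fun i => (hc i).symm) hd.symm p
      (map_op (Face.outer v hv).map q)).trans (h'.trans (homBundle_congr (P := P) x' hc hd _ p))
  refine hom_ext_bundle (T := T) (P := P) (f := x) (g := x') (fun d => ?_) fun v => ?_
  · exact congrArg (fun b => b.1.2) (key (.one d) (isProper_one he d))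
  · obtain ⟨n, c, hc⟩ := T.exists_enumerates v
    exact ⟨n, c, hc, key _ (isProper_vertex he hc)⟩

end

theorem isStrictInnerKan_nerve (P : Operad.{u}) : IsStrictInnerKan (nerve.obj P) :=
  isStrictInnerKan_iff.2 fun _ _ _ y => by
    obtain ⟨x, hx⟩ := y.exists_fills_nerve
    exact ⟨x, hx, fun x' hx' => y.fills_nerve_unique hx' hx⟩

/-! ### Strict inner Kan complexes are nerves -/

theorem IsStrictInnerKan.of_iso {X Y : DSet.{u}} (f : X ≅ Y) (hY : IsStrictInnerKan Y) :
    IsStrictInnerKan X := by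
  intro T e he
  have h1 : Function.Bijective fun x : T.representable ⟶ X => x ≫ f.hom :=
    (f.homToEquiv (Z := T.representable)).bijective
  have h2 : Function.Bijective fun x : (T.innerHorn e he).toFunctor ⟶ X => x ≫ f.hom :=
    (f.homToEquiv (Z := (T.innerHorn e he).toFunctor)).bijective
  rw [← Function.Bijective.of_comp_iff' h2]
  have h3 : ((fun x : (T.innerHorn e he).toFunctor ⟶ X => x ≫ f.hom) ∘
      fun x : T.representable ⟶ X => (T.innerHorn e he).ι ≫ x) =
      (fun x => (T.innerHorn e he).ι ≫ x) ∘ fun x => x ≫ f.hom :=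
    funext fun x => Category.assoc _ x f.hom
  rw [h3]
  exact (hY T e he).comp h1

theorem isIso_of_bijective {X Y : DSet.{u}} (f : X ⟶ Y)
    (h : ∀ T : Tree, Function.Bijective (f.app (op T))) : IsIso f :=
  (NatTrans.isIso_iff_isIso_app f).2 fun T => (isIso_iff_bijective _).2 (h T.unop)

namespace IsStrictInnerKan

variable {X : DSet.{u}} (hX : IsStrictInnerKan X)

theorem recolor_operad_val {n : ℕ} {c c' : Fin n → X.obj (op eta)} {d d' : X.obj (op eta)}
    (hc : ∀ i, c i = c' i) (hd : d = d') (p : hX.operad.Op c d) :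
    (hX.operad.recolor hc hd p).1 = p.1 := by
  obtain rfl := funext hc
  subst hd
  rfl

/-- The values of a dendrex of a strict inner Kan complex form a map of operads. -/
noncomputable def valueHom {T : Tree} (x : X.obj (op T)) : Operad.Hom T.operad hX.operad where
  color e := X.edge x e
  op p := ⟨X.opAt x p.down, X.edge_opAt_some x p.down, X.edge_opAt_none x p.down⟩
  op_one e := Subtype.ext (X.opAt_one x e)
  op_act σ _ _ _ h p := Subtype.ext (X.opAt_act x σ h p.down _)
  op_comp p q := Subtype.ext
    (hX.compVal_opAt x p.down (fun i => (q i).down) rfl fun _ => rfl).symm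

/-- The map from a strict inner Kan complex to the nerve of its operad. -/
noncomputable def toNerveOperad : X ⟶ nerve.obj hX.operad where
  app T := ↾fun x => hX.valueHom x
  naturality S T g := by
    ext x
    refine Operad.Hom.ext' (fun e => X.edge_map g.unop x e) ?_
    intro n c d p
    refine Subtype.ext ((hX.recolor_operad_val _ _ _).trans ?_)
    exact X.opAt_map g.unop x p.down

/-- Both sides are determined by edges and vertices. The values of an operad map on these form a
spine, and the Segal property turns it into a dendrex. -/
theorem valueHom_bijective (T : Tree) :
    Function.Bijective (hX.valueHom : X.obj (op T) → Operad.Hom T.operad hX.operad) := by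
  constructor
  · intro x y h
    refine hX.ext (fun e => congrArg (fun f : Operad.Hom T.operad hX.operad => f.color e) h) fun v => ?_
    obtain ⟨n, c, hc⟩ := T.exists_enumerates v
    exact ⟨n, c, hc, congrArg (fun f : Operad.Hom T.operad hX.operad =>
      (f.op (c := c) (d := T.out v) ⟨.vertex v c hc⟩).1) h⟩
  · intro f
    choose n a ha using T.exists_enumerates
    let s : Spine X T :=
      { color := f.color
        arity := n
        input := a
        enum := ha
        label := fun v => (f.op (c := a v) (d := T.out v) ⟨.vertex v _ (ha v)⟩).1
        label_some := fun v => (f.op (c := a v) (d := T.out v) ⟨.vertex v _ (ha v)⟩).2.1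
        label_none := fun v => (f.op (c := a v) (d := T.out v) ⟨.vertex v _ (ha v)⟩).2.2 }
    obtain ⟨z, hz⟩ := hX.exists_extends s
    refine ⟨z, hom_ext_vertex (fun e => hz.edge e) fun v => ⟨n v, a v, ha v, ?_⟩⟩
    exact Subtype.ext ((hX.recolor_operad_val _ _ _).trans (hz.vertex v))

theorem isIso_toNerveOperad : IsIso hX.toNerveOperad :=
  isIso_of_bijective _ hX.valueHom_bijective

end IsStrictInnerKan

theorem isStrictInnerKan_iff_nerve (X : DSet.{u}) :
    IsStrictInnerKan X ↔ ∃ P : Operad.{u}, Nonempty (X ≅ nerve.obj P) := by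
  constructor
  · intro hX
    have := hX.isIso_toNerveOperad
    exact ⟨hX.operad, ⟨asIso hX.toNerveOperad⟩⟩
  · rintro ⟨P, ⟨f⟩⟩
    exact .of_iso f (isStrictInnerKan_nerve P)

/-! ### The unit of the adjunction -/

namespace Term

variable {X : DSet.{u}}

/-- The class of a dendrex whose shape is a corolla. -/
def IsGen {n : ℕ} {c : Fin n → X.obj (op eta)} {d : X.obj (op eta)} (p : Term X c d) : Prop :=
  ∃ (x : X.obj (op (corolla n))) (hc : ∀ i, X.edge x (some i) = c i) (hd : X.edge x none = d),
    cls p = cls (.gen x hc hd)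

theorem isGen_one (c : X.obj (op eta)) : IsGen (.one c) := by
  -- The relation `of_one` speaks about `X.edge c ()`, which equals `c` only propositionally.
  have key : ∀ c', X.edge c () = c' → IsGen (.one c') := by
    rintro _ rfl
    exact ⟨_, _, _, (cls_eq (.of_one (T := eta) c ())).symm⟩
  exact key _ (X.edge_eta c)

theorem isGen_act {m n : ℕ} (σ : Fin m ≃ Fin n) {c : Fin n → X.obj (op eta)}
    {c' : Fin m → X.obj (op eta)} {d : X.obj (op eta)} (h : ∀ i, c' i = c (σ i))
    {p : Term X c d} (hp : IsGen p) : IsGen (p.act σ h) := by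
  obtain ⟨x, hc, hd, hp⟩ := hp
  -- After replacing `x` by its value on the vertex of the corolla, the generator is literally an
  -- `ofOperation`, as `of_act` requires.
  have key : ∀ (y : X.obj (op (corolla n))) (hy : y = X.opAt x (corollaOp n))
      (hc : ∀ i, X.edge y (some i) = c i) (hd : X.edge y none = d),
      IsGen ((Term.gen y hc hd).act σ h) := by
    rintro _ rfl hc hd
    obtain rfl : c = fun i => X.edge x (some i) :=
      funext fun i => (hc i).symm.trans (X.edge_opAt_some x (corollaOp n) i)
    obtain rfl : d = X.edge x none := hd.symm.trans (X.edge_opAt_none x (corollaOp n))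
    obtain rfl : c' = fun i => X.edge x (some (σ i)) := funext h
    exact ⟨_, _, _, (cls_eq (.of_act x σ (c' := fun i => some (σ i)) (fun _ => rfl)
      (corollaOp n))).symm⟩
  obtain ⟨y, hc', hd', hy⟩ := key x (X.opAt_corollaOp x).symm hc hd
  refine ⟨y, hc', hd', ?_⟩
  rw [← hy, ← clsAct_cls, ← clsAct_cls, hp]

/-- This is the relation `of_comp` read backwards; the values and colours are kept as variables so
that their equations can be eliminated. -/
theorem isGen_comp_gen {T : Tree} (z : X.obj (op T)) {n : ℕ} {k : Fin n → ℕ}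
    {c : Fin n → T.Edge} {b : ∀ i, Fin (k i) → T.Edge} {d : T.Edge} (p : T.Operation c d)
    (q : ∀ i, T.Operation (b i) (c i)) {c' : Fin n → X.obj (op eta)}
    {b' : ∀ i, Fin (k i) → X.obj (op eta)} {d' : X.obj (op eta)} {x : X.obj (op (corolla n))}
    {y : ∀ i, X.obj (op (corolla (k i)))} (hx : X.opAt z p = x) (hy : ∀ i, X.opAt z (q i) = y i)
    (hxc : ∀ i, X.edge x (some i) = c' i) (hxd : X.edge x none = d')
    (hyb : ∀ i j, X.edge (y i) (some j) = b' i j) (hyc : ∀ i, X.edge (y i) none = c' i) :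
    IsGen ((Term.gen x hxc hxd).comp fun i => Term.gen (y i) (hyb i) (hyc i)) := by
  subst hx
  obtain rfl := funext hy
  obtain rfl : c' = fun i => X.edge z (c i) :=
    funext fun i => (hxc i).symm.trans (X.edge_opAt_some z p i)
  obtain rfl : d' = X.edge z d := hxd.symm.trans (X.edge_opAt_none z p)
  obtain rfl : b' = fun i j => X.edge z (b i j) :=
    funext fun i => funext fun j => (hyb i j).symm.trans (X.edge_opAt_some z (q i) j)
  exact ⟨_, _, _, (cls_eq (.of_comp z p q)).symm⟩

/-- Grafting the representing corollas gives a dendrex in which the composite is the value of one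
operation. -/
theorem isGen_comp (hX : IsStrictInnerKan X) {n : ℕ} {k : Fin n → ℕ}
    {c : Fin n → X.obj (op eta)} {b : ∀ i, Fin (k i) → X.obj (op eta)} {d : X.obj (op eta)}
    {p : Term X c d} {q : ∀ i, Term X (b i) (c i)} (hp : IsGen p) (hq : ∀ i, IsGen (q i)) :
    IsGen (p.comp q) := by
  obtain ⟨x, hxc, hxd, hp⟩ := hp
  choose y hyb hyc hq using hq
  obtain ⟨z, h1, h2⟩ := hX.exists_graft (U := fun i => corolla (k i)) x y
    fun i => (hyc i).trans (hxc i).symm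
  obtain ⟨w, h3, h4, hw⟩ := isGen_comp_gen z _ _ h1
    (fun i => (IsStrictInnerKan.opAt_map_op (h2 i) (corollaOp (k i))).trans (X.opAt_corollaOp _))
    hxc hxd hyb hyc
  refine ⟨w, h3, h4, ?_⟩
  rw [← hw, ← clsComp_cls, ← clsComp_cls, hp]
  simp only [hq]

/-- In a strict inner Kan complex every formal composite is equivalent to a dendrex. -/
theorem isGen (hX : IsStrictInnerKan X) {n : ℕ} {c : Fin n → X.obj (op eta)}
    {d : X.obj (op eta)} (p : Term X c d) : IsGen p := by
  induction p with
  | gen x hc hd => exact ⟨x, hc, hd, rfl⟩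
  | one c => exact isGen_one c
  | act σ h p ih => exact isGen_act σ h ih
  | comp p q ih ih' => exact isGen_comp hX ih ih'

end Term

theorem tauAdjunction_unit_app (X : DSet.{u}) :
    tauAdjunction.unit.app X = toNerve (𝟙 (operadOf X)) := rfl

/-- The value of the unit on a dendrex. -/
noncomputable def unitHom {X : DSet.{u}} {T : Tree} (x : X.obj (op T)) :
    Operad.Hom T.operad (operadOf X) :=
  (toNerve (𝟙 (operadOf X))).app (op T) x

/-- By the adjunction, the bijective comparison with the nerve of the operad of `X` factors through
the unit. -/
theorem unitHom_injective {X : DSet.{u}} (hX : IsStrictInnerKan X) (T : Tree) :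
    Function.Injective (unitHom : X.obj (op T) → Operad.Hom T.operad (operadOf X)) := by
  intro x y h
  apply (hX.valueHom_bijective T).1
  have key : ∀ x : X.obj (op T),
      hX.valueHom x = Operad.Hom.comp (unitHom x) (ofNerve hX.toNerveOperad) := fun x =>
    congrArg (fun f : X ⟶ nerve.obj hX.operad => f.app (op T) x)
      (toNerve_ofNerve hX.toNerveOperad).symm
  rw [key, key, h]

/-- An operad map sends each vertex to the class of a single corolla. These corollas form a spine,
and an extension of it is a preimage. -/
theorem unitHom_surjective {X : DSet.{u}} (hX : IsStrictInnerKan X) (T : Tree) :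
    Function.Surjective (unitHom : X.obj (op T) → Operad.Hom T.operad (operadOf X)) := by
  intro f
  choose n a ha using T.exists_enumerates
  have hgen : ∀ v, ∃ (x : X.obj (op (corolla (n v))))
      (hc : ∀ i, X.edge x (some i) = f.color (a v i)) (hd : X.edge x none = f.color (T.out v)),
      f.op (c := a v) (d := T.out v) ⟨.vertex v _ (ha v)⟩ = Term.cls (.gen x hc hd) := by
    intro v
    obtain ⟨p, hp⟩ := Term.exists_cls (f.op (c := a v) (d := T.out v) ⟨.vertex v _ (ha v)⟩)
    obtain ⟨x, hc, hd, h⟩ := Term.isGen hX p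
    exact ⟨x, hc, hd, hp.trans h⟩
  choose x hc hd hx using hgen
  obtain ⟨z, hz⟩ := hX.exists_extends
    { color := f.color
      arity := n
      input := a
      enum := ha
      label := x
      label_some := hc
      label_none := hd }
  refine ⟨z, hom_ext_vertex (fun e => hz.edge e) fun v => ⟨n v, a v, ha v, ?_⟩⟩
  exact (recolor_gen (hz.vertex v) _ _ (hc v) (hd v) _ _).trans (hx v).symm

theorem isIso_tauAdjunction_unit_app {X : DSet.{u}} (hX : IsStrictInnerKan X) :
    IsIso (tauAdjunction.unit.app X) := by
  rw [tauAdjunction_unit_app]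
  exact isIso_of_bijective _ fun T => ⟨unitHom_injective hX T, unitHom_surjective hX T⟩

end Dendroidal

theorem theorem6p1 :
    (∀ X : Dendroidal.DSet.{u}, Dendroidal.IsStrictInnerKan X →
      IsIso (Dendroidal.tauAdjunction.unit.app X)) ∧
    (∀ X : Dendroidal.DSet.{u}, Dendroidal.IsStrictInnerKan X ↔
      ∃ P : Dendroidal.Operad.{u}, Nonempty (X ≅ Dendroidal.nerve.obj P)) :=
  ⟨fun _ hX => Dendroidal.isIso_tauAdjunction_unit_app hX, Dendroidal.isStrictInnerKan_iff_nerve⟩
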